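/- Let $m\ge 2$, let $e_0,\dots,e_m$ generate the real Clifford algebra $\mathbb R_{0,m+1}$ ($e_\alpha e_\beta+e_\beta e_\alpha=-2\delta_{\alpha\beta}$), identify $x\in\mathbb R^m$ with $\underline x=\sum_{j=1}^m x_je_j$, put $r=|\underline x|$, $\underline\omega=\underline x/r$, $\sigma_n=2\pi^{n/2}/\Gamma(n/2)$, let $\underline\partial=\sum_{j=1}^m e_j\partial_{x_j}$ be the Dirac operator on Clifford-valued tempered distributions on $\mathbb R^m$, and let $H=b_{-1}^{+}=b_{-1}^{-}=-\frac{2}{\sigma_{m+1}}\,\mathrm{Pv}\,\frac{\underline\omega}{r^m}$ be the Hilbert kernel and $\mathcal H[u]=H*u$ the Hilbert transform. For $\lambda>-m$ put $$T^*_\lambda=\frac{\pi^{(\lambda+m)/2}}{\Gamma(\frac{\lambda+m}2)}\,r^\lambda,\qquad U^*_\lambda=\frac{\pi^{(\lambda+m+1)/2}}{\Gamma(\frac{\lambda+m+1}2)}\,r^\lambda\,\underline\omega .$$ Let $p_0=-\frac1{2^{m-1}\pi^m}$, $q_0=0$ and, for $j\ge0$, $p_{2j+1}=-\frac1{2\pi}p_{2j}$,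 $q_{2j+1}=-\frac1{2\pi}\bigl(q_{2j}-\frac1{m+2j}p_{2j}\bigr)$, $p_{2j+2}=\frac1{2j+2}p_{2j+1}$, $q_{2j+2}=\frac1{2j+2}\bigl(q_{2j+1}-\frac1{2j+2}p_{2j+1}\bigr)$; let $L_{2j}=(p_{2j}\ln r+q_{2j})T^*_{2j}$ and $L_{2j+1}=(p_{2j+1}\ln r+q_{2j+1})U^*_{2j+1}$. The distributional boundary values $a_n^\pm,b_n^\pm$ ($n\ge0$) of the harmonic potentials from the upper and the lower half-space are the following locally integrable functions, regarded as tempered distributions: $$a_n^+=\frac{(-1)^{n+1}}{2^{n+1}}\,\frac{\Gamma(\frac{m-n-1}2)}{\pi^{(m+n+1)/2}}\,T^*_{-m+n+1}\quad (n\notin\{m-1,m+1,m+3,\dots\}),\qquad a^+_{m+2j-1}=(-1)^mL_{2j},$$ $$b_n^+=\frac{(-1)^{n}}{2^{n+1}}\,\frac{\Gamma(\frac{m-n}2)}{\pi^{(m+n+2)/2}}\,U^*_{-m+n+1}\quad (n\notin\{m,m+2,m+4,\dots\}),\qquad b^+_{m+2j}=(-1)^{m+1}L_{2j+1}$$ ($j\ge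 0$), and $a_n^-=a_n^+$, $b_n^-=(-1)^mb_n^+$ for $n$ even, $a_n^-=(-1)^ma_n^+$, $b_n^-=b_n^+$ for $n$ odd. Then for every $k\ge1$: (i) $-\underline\partial a_k^+=b_{k-1}^+$ and $-\underline\partial b_k^+=a_{k-1}^+$; (ii) $-\underline\partial a_k^-=b_{k-1}^-$ and $-\underline\partial b_k^-=a_{k-1}^-$; (iii) $\mathcal H[a_k^+]=b_{-1}^+*a_k^+=b_k^+$ and $\mathcal H[b_k^+]=b_{-1}^+*b_k^+=a_k^+$; (iv) $\mathcal H[a_k^-]=b_{-1}^-*a_k^-=(-1)^mb_k^-$ and $\mathcal H[b_k^-]=b_{-1}^-*b_k^-=(-1)^ma_k^-$. Here $\mathcal H[u]=v$ means that for test functions $\varphi\in\mathcal S(\mathbb R^m)$ $$\lim_{R\to\infty}\int_{|y|<R}\langle H(z),\varphi(y+z)\rangle\,u(y)\,dy=\langle v,\varphi\rangle .$$ For $\mathcal H[a_k^\pm]$ with $k\le m-1$ and for $\mathcal H[b_k^\pm]$ with $k\le m-2$ this holds for every $\varphi\in\mathcal S(\mathbb R^m)$. For the remaining $k$ the equalities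 in (iii) and (iv) are understood modulo polynomials of degree at most $k+1-m$, as usual for the Hilbert transform of functions for which the convolution integral diverges: the limit relation holds for all $\varphi\in\mathcal S(\mathbb R^m)$ with $\int\varphi P=0$ for every polynomial $P$ of degree at most $k+1-m$. -/

import Mathlib

open MeasureTheory Filter Topology Set
open scoped SchwartzMap LineDeriv

noncomputable section

/-- Euclidean space `ℝ^m`. -/
abbrev Eu (m : ℕ) : Type := EuclideanSpace ℝ (Fin m)

/-- The quadratic form `-(x_0² + ⋯ + x_m²)` on `ℝ^{m+1}`, of signature `(0, m+1)`. -/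
def negQuad (m : ℕ) : QuadraticForm ℝ (Fin (m + 1) → ℝ) :=
  QuadraticMap.weightedSumSquares ℝ (fun _ : Fin (m + 1) => (-1 : ℝ))

/-- The universal real Clifford algebra `ℝ_{0,m+1}`. -/
abbrev Cl (m : ℕ) : Type := CliffordAlgebra (negQuad m)

/-- The generators `e_0, e_1, …, e_m` of the Clifford algebra. -/
def gen (m : ℕ) (i : Fin (m + 1)) : Cl m := CliffordAlgebra.ι (negQuad m) (Pi.single i 1)

instance Cl.finite (m : ℕ) : Module.Finite ℝ (Cl m) :=
  haveI : Module.Finite ℝ (ExteriorAlgebra ℝ (Fin (m + 1) → ℝ)) :=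
    Module.Finite.of_basis (Pi.basisFun ℝ (Fin (m + 1))).ExteriorAlgebra
  Module.Finite.equiv (CliffordAlgebra.equivExterior (negQuad m)).symm

/-- Real coordinates on the Clifford algebra. They only serve to transport a norm. -/
def Cl.coords (m : ℕ) : Cl m →ₗ[ℝ] (Fin (Module.finrank ℝ (Cl m)) → ℝ) :=
  (Module.finBasis ℝ (Cl m)).equivFun.toLinearMap

/-- A norm on the finite-dimensional space `Cl m`. All norms on it are equivalent, and only the
topology and the resulting (coordinatewise) integral are used. -/
instance Cl.normedAddCommGroup (m : ℕ) : NormedAddCommGroup (Cl m) :=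
  NormedAddCommGroup.induced (Cl m) (Fin (Module.finrank ℝ (Cl m)) → ℝ) (Cl.coords m)
    (Module.finBasis ℝ (Cl m)).equivFun.injective

instance Cl.normedSpace (m : ℕ) : NormedSpace ℝ (Cl m) :=
  NormedSpace.induced ℝ (Cl m) (Fin (Module.finrank ℝ (Cl m)) → ℝ) (Cl.coords m)

/-- The Clifford vector `x_1 e_1 + ⋯ + x_m e_m` attached to the point `x` of `ℝ^m`. -/
def vec (m : ℕ) : Eu m →ₗ[ℝ] Cl m where
  toFun x := ∑ j : Fin m, x j • gen m j.succ
  map_add' x y := by simp [add_smul, Finset.sum_add_distrib]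
  map_smul' c x := by simp [mul_smul, Finset.smul_sum]

/-- The defining relations `e_α e_β + e_β e_α = -2 δ_{αβ}`. -/
theorem gen_mul_gen_add (m : ℕ) (i j : Fin (m + 1)) :
    gen m i * gen m j + gen m j * gen m i = if i = j then -2 else 0 := by
  unfold gen
  rw [CliffordAlgebra.ι_mul_ι_add_swap]
  have : QuadraticMap.polar (negQuad m) (Pi.single i 1) (Pi.single j 1)
      = if i = j then (-2 : ℝ) else 0 := by
    simp only [QuadraticMap.polar, negQuad, QuadraticMap.weightedSumSquares_apply, Pi.add_apply,
      ← Finset.sum_sub_distrib, smul_eq_mul]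
    rw [Finset.sum_congr rfl (g := fun l => if l = i then (if i = j then (-2 : ℝ) else 0) else 0)]
    · simp
    · intro l _
      by_cases h1 : l = i <;> by_cases h2 : l = j
      · subst h1; subst h2; simp; norm_num
      · subst h1; simp [h2]
      · subst h2; simp [h1]
      · simp [h1, h2]
  rw [this]
  split_ifs
  · rw [map_neg, map_ofNat]
  · simp

/-! ### Clifford-valued tempered distributions on `ℝ^m` -/

/-- Clifford-valued tempered distributions on `ℝ^m`, acting on scalar test functions. -/
abbrev CDist (m : ℕ) : Type := 𝓢(Eu m, ℝ) →L[ℝ] Cl m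

/-- The function `u` defines a tempered distribution: it is integrable against an inverse
power of `1 + |x|`. -/
def IsTempered {m : ℕ} (u : Eu m → Cl m) : Prop :=
  ∃ n : ℕ, Integrable (fun x => ((1 + ‖x‖) ^ n)⁻¹ • u x)

theorem IsTempered.exists_bound {m : ℕ} {u : Eu m → Cl m} (hu : IsTempered u) :
    (∀ φ : 𝓢(Eu m, ℝ), Integrable (fun x => φ x • u x)) ∧
    ∃ (s : Finset (ℕ × ℕ)) (C : ℝ), 0 ≤ C ∧ ∀ φ : 𝓢(Eu m, ℝ),
      ‖∫ x, φ x • u x‖ ≤ C * s.sup (schwartzSeminormFamily ℝ (Eu m) ℝ) φ := by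
  obtain ⟨n, hn⟩ := hu
  have key : ∀ (φ : 𝓢(Eu m, ℝ)) (x : Eu m), ‖φ x • u x‖ ≤
      (2 ^ n * (Finset.Iic (n, 0)).sup (schwartzSeminormFamily ℝ (Eu m) ℝ) φ) *
        ‖((1 + ‖x‖) ^ n)⁻¹ • u x‖ := by
    intro φ x
    have h := SchwartzMap.one_add_le_sup_seminorm_apply (𝕜 := ℝ) (m := (n, 0)) (k := n) (n := 0)
      le_rfl le_rfl φ x
    rw [norm_iteratedFDeriv_zero] at h
    have hp : 0 < (1 + ‖x‖) ^ n := by positivity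
    rw [norm_smul, norm_smul, norm_inv, Real.norm_of_nonneg hp.le]
    calc ‖φ x‖ * ‖u x‖ = ((1 + ‖x‖) ^ n * ‖φ x‖) * (((1 + ‖x‖) ^ n)⁻¹ * ‖u x‖) := by
          field_simp
      _ ≤ _ := by
          apply mul_le_mul_of_nonneg_right h
          positivity
  have hmeas : AEStronglyMeasurable u := by
    have h2 : AEStronglyMeasurable (fun x : Eu m => (1 + ‖x‖) ^ n • ((1 + ‖x‖) ^ n)⁻¹ • u x) :=
      (show Continuous fun x : Eu m => (1 + ‖x‖) ^ n by fun_prop).aestronglyMeasurable.smul hn.1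
    refine h2.congr (Eventually.of_forall fun x => ?_)
    have hp : (1 + ‖x‖) ^ n ≠ 0 := by positivity
    simp [smul_smul, hp]
  refine ⟨fun φ => ?_, Finset.Iic (n, 0), 2 ^ n * ∫ x, ‖((1 + ‖x‖) ^ n)⁻¹ • u x‖, ?_, fun φ => ?_⟩
  · exact (hn.norm.const_mul _).mono' (φ.continuous.aestronglyMeasurable.smul hmeas)
      (Eventually.of_forall (key φ))
  · exact mul_nonneg (by positivity) (integral_nonneg fun _ => norm_nonneg _)
  · refine (norm_integral_le_of_norm_le (hn.norm.const_mul _)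
      (Eventually.of_forall (key φ))).trans (le_of_eq ?_)
    rw [integral_const_mul]
    ring

/-- The distribution `φ ↦ ∫ φ u` given by a function `u` of tempered growth (and `0` for any
other function; all functions to which it is applied are of tempered growth). -/
def regDist {m : ℕ} (u : Eu m → Cl m) : CDist m :=
  open Classical in
  if hu : IsTempered u then
    SchwartzMap.mkCLMtoNormedSpace (𝕜 := ℝ) (σ := RingHom.id ℝ) (fun φ => ∫ x, φ x • u x)
      (fun φ ψ => by
        simp only [add_apply, add_smul]
        exact integral_add (hu.exists_bound.1 φ) (hu.exists_bound.1 ψ))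
      (fun c φ => by
        simp only [smul_apply, smul_assoc, RingHom.id_apply]
        exact integral_smul c _)
      hu.exists_bound.2
  else 0

theorem regDist_apply {m : ℕ} {u : Eu m → Cl m} (hu : IsTempered u) (φ : 𝓢(Eu m, ℝ)) :
    regDist u φ = ∫ x, φ x • u x := by
  simp [regDist, hu, SchwartzMap.mkCLMtoNormedSpace]

theorem integrable_weight_mul_norm_rpow {m : ℕ} (hm : 1 ≤ m) {s : ℝ} (hs : -(m : ℝ) < s) :
    ∃ n₀ : ℕ, ∀ n ≥ n₀, Integrable (fun x : Eu m => ((1 + ‖x‖) ^ n)⁻¹ * ‖x‖ ^ s) := by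
  have : Nonempty (Fin m) := ⟨⟨0, hm⟩⟩
  obtain ⟨n₀, hn₀⟩ := exists_nat_gt (s + m)
  refine ⟨n₀, fun n hnn => ?_⟩
  have hn : s + m < n := hn₀.trans_le (by exact_mod_cast hnn)
  rw [integrable_fun_norm_addHaar (volume : Measure (Eu m))
    (f := fun y : ℝ => ((1 + y) ^ n)⁻¹ * y ^ s)]
  simp only [finrank_euclideanSpace, Fintype.card_fin, smul_eq_mul]
  have hmeas : Measurable fun y : ℝ => y ^ (m - 1) * (((1 + y) ^ n)⁻¹ * y ^ s) := by fun_prop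
  have hcast : ((m - 1 : ℕ) : ℝ) = (m : ℝ) - 1 := by push_cast [Nat.cast_sub hm]; ring
  have hpow : ∀ y : ℝ, 0 < y → y ^ (m - 1) * y ^ s = y ^ ((m : ℝ) - 1 + s) := by
    intro y hy
    rw [Real.rpow_add hy, ← hcast, Real.rpow_natCast]
  rw [← Ioc_union_Ioi_eq_Ioi (zero_le_one' ℝ)]
  refine IntegrableOn.union ?_ ?_
  · have h1 : IntegrableOn (fun y : ℝ => y ^ ((m : ℝ) - 1 + s)) (Ioc 0 1) :=
      (intervalIntegrable_iff_integrableOn_Ioc_of_le zero_le_one).1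
        (intervalIntegral.intervalIntegrable_rpow' (by linarith))
    refine h1.mono' hmeas.aestronglyMeasurable ?_
    refine (ae_restrict_iff' measurableSet_Ioc).2 (Eventually.of_forall fun y hy => ?_)
    have hy0 : 0 < y := hy.1
    rw [Real.norm_of_nonneg (by positivity), ← hpow y hy0]
    gcongr
    refine mul_le_of_le_one_left (by positivity) (inv_le_one_of_one_le₀ ?_)
    exact one_le_pow₀ (by linarith)
  · have h1 : IntegrableOn (fun y : ℝ => y ^ ((m : ℝ) - 1 + s - n)) (Ioi 1) :=
      integrableOn_Ioi_rpow_of_lt (by linarith) zero_lt_one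
    refine h1.mono' hmeas.aestronglyMeasurable ?_
    refine (ae_restrict_iff' measurableSet_Ioi).2 (Eventually.of_forall fun y hy => ?_)
    have hy0 : 0 < y := lt_trans zero_lt_one hy
    rw [Real.norm_of_nonneg (by positivity), Real.rpow_sub hy0, ← hpow y hy0, Real.rpow_natCast,
      div_eq_mul_inv]
    rw [show y ^ (m - 1) * (((1 + y) ^ n)⁻¹ * y ^ s) = y ^ (m - 1) * y ^ s * ((1 + y) ^ n)⁻¹ by ring]
    gcongr
    linarith

theorem isTempered_of_bound {m : ℕ} (hm : 1 ≤ m) {u : Eu m → Cl m} {s t C : ℝ}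
    (hs : -(m : ℝ) < s) (ht : -(m : ℝ) < t) (hu : AEStronglyMeasurable u)
    (h : ∀ x, x ≠ 0 → ‖u x‖ ≤ C * (‖x‖ ^ s + ‖x‖ ^ t)) :
    IsTempered u := by
  have : Nonempty (Fin m) := ⟨⟨0, hm⟩⟩
  obtain ⟨n₁, hn₁⟩ := integrable_weight_mul_norm_rpow hm hs
  obtain ⟨n₂, hn₂⟩ := integrable_weight_mul_norm_rpow hm ht
  have hn := (hn₁ _ (le_max_left n₁ n₂)).add (hn₂ _ (le_max_right n₁ n₂))
  refine ⟨max n₁ n₂, (hn.const_mul C).mono' ?_ ?_⟩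
  · have hc : Continuous fun x : Eu m => ((1 + ‖x‖) ^ (max n₁ n₂))⁻¹ :=
      Continuous.inv₀ (by fun_prop) fun x => by positivity
    exact hc.aestronglyMeasurable.smul hu
  · have h0 : ∀ᵐ x : Eu m, x ≠ 0 := by
      simp [ae_iff]
    filter_upwards [h0] with x hx
    rw [norm_smul, norm_inv, Real.norm_of_nonneg (by positivity)]
    calc ((1 + ‖x‖) ^ (max n₁ n₂))⁻¹ * ‖u x‖
        ≤ ((1 + ‖x‖) ^ (max n₁ n₂))⁻¹ * (C * (‖x‖ ^ s + ‖x‖ ^ t)) := by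
          gcongr
          exact h x hx
      _ = _ := by
          simp only [Pi.add_apply]
          ring

theorem IsTempered.const_smul {m : ℕ} {u : Eu m → Cl m} (hu : IsTempered u) (c : ℝ) :
    IsTempered (fun x => c • u x) := by
  obtain ⟨n, hn⟩ := hu
  refine ⟨n, (hn.smul c).congr (Eventually.of_forall fun x => ?_)⟩
  simp only [Pi.smul_apply]
  rw [smul_comm]

/-- The Dirac operator `∑ e_j ∂_{x_j}` of `ℝ^m` on Clifford-valued distributions:
`⟨∂T, φ⟩ = - ∑ e_j ⟨T, ∂_{x_j} φ⟩`. -/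
def dirac {m : ℕ} (T : CDist m) : CDist m :=
  -∑ j : Fin m, (LinearMap.mulLeft ℝ (gen m j.succ)).toContinuousLinearMap ∘L T ∘L
    LineDeriv.lineDerivOpCLM ℝ 𝓢(Eu m, ℝ) (EuclideanSpace.single j (1 : ℝ))

/-! ### The boundary distributions -/

/-- The area `2 π^{n/2} / Γ(n/2)` of the unit sphere of `ℝ^n`. -/
def sphereArea (n : ℕ) : ℝ := 2 * Real.pi ^ ((n : ℝ) / 2) / Real.Gamma ((n : ℝ) / 2)

/-- The normalized radial function `T^*_lam = π^{(lam+m)/2} / Γ((lam+m)/2) · r^lam`. It is used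
for `lam > -m` only, where no finite part is needed. -/
def TStar (m : ℕ) (lam : ℝ) (x : Eu m) : Cl m :=
  algebraMap ℝ (Cl m)
    (Real.pi ^ ((lam + m) / 2) / Real.Gamma ((lam + m) / 2) * ‖x‖ ^ lam)

/-- The normalized function `U^*_lam = π^{(lam+m+1)/2} / Γ((lam+m+1)/2) · r^lam ω`, where
`ω = x / |x|`. It is used for `lam > -m` only, where no finite part is needed. -/
def UStar (m : ℕ) (lam : ℝ) (x : Eu m) : Cl m :=
  (Real.pi ^ ((lam + m + 1) / 2) / Real.Gamma ((lam + m + 1) / 2) * ‖x‖ ^ lam) •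
    (‖x‖⁻¹ • vec m x)

/-- The constants `(p_n, q_n)`. -/
def pq (m : ℕ) : ℕ → ℝ × ℝ
  | 0 => (-1 / (2 ^ (m - 1) * Real.pi ^ m), 0)
  | n + 1 =>
    if Even n then
      (-(1 / (2 * Real.pi)) * (pq m n).1,
        -(1 / (2 * Real.pi)) * ((pq m n).2 - 1 / ((m : ℝ) + n) * (pq m n).1))
    else
      (1 / ((n : ℝ) + 1) * (pq m n).1,
        1 / ((n : ℝ) + 1) * ((pq m n).2 - 1 / ((n : ℝ) + 1) * (pq m n).1))

/-- The function `(p_n ln r + q_n) T^*_n` (`n` even), `(p_n ln r + q_n) U^*_n` (`n` odd). It is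
denoted `E_{m+n}` when `m` is even and `F_{m+n}` when `m` is odd. -/
def logKernel (m n : ℕ) (x : Eu m) : Cl m :=
  ((pq m n).1 * Real.log ‖x‖ + (pq m n).2) •
    (if Even n then TStar m n x else UStar m n x)

/-- The boundary values `a_n^+`, `n ≥ 0`, from the upper half-space. With `n = 2k` or `n = 2k - 1`
the last line reads `-2^{-2k-1} Γ((m-2k-1)/2) π^{-(m+2k+1)/2} T^*_{-m+2k+1}`, respectively
`2^{-2k} Γ((m-2k)/2) π^{-(m+2k)/2} T^*_{-m+2k}`; the first line is the exceptional case
`n = m + 2j - 1`, where the value is `E_{m+2j}` (`m` even) or `-F_{m+2j}` (`m` odd). -/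
def aPlus (m n : ℕ) (x : Eu m) : Cl m :=
  if m ≤ n + 1 ∧ Even (n + 1 - m) then
    (-1 : ℝ) ^ m • logKernel m (n + 1 - m) x
  else
    ((-1) ^ (n + 1) * (1 / 2 ^ (n + 1)) *
      (Real.Gamma (((m : ℝ) - n - 1) / 2) / Real.pi ^ (((m : ℝ) + n + 1) / 2))) •
        TStar m (-(m : ℝ) + n + 1) x

/-- The boundary values `b_n^+`, `n ≥ 0`, from the upper half-space. With `n = 2k` or `n = 2k - 1`
the last line reads `2^{-2k-1} Γ((m-2k)/2) π^{-(m+2k+2)/2} U^*_{-m+2k+1}`, respectively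
`-2^{-2k} Γ((m-2k+1)/2) π^{-(m+2k+1)/2} U^*_{-m+2k}`; the first line is the exceptional case
`n = m + 2j`, where the value is `-E_{m+2j+1}` (`m` even) or `F_{m+2j+1}` (`m` odd). -/
def bPlus (m n : ℕ) (x : Eu m) : Cl m :=
  if m ≤ n ∧ Even (n - m) then
    (-1 : ℝ) ^ (m + 1) • logKernel m (n - m + 1) x
  else
    ((-1) ^ n * (1 / 2 ^ (n + 1)) *
      (Real.Gamma (((m : ℝ) - n) / 2) / Real.pi ^ (((m : ℝ) + n + 2) / 2))) •
        UStar m (-(m : ℝ) + n + 1) x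

/-- The boundary values `a_n^-`, `n ≥ 0`, from the lower half-space. -/
def aMinus (m n : ℕ) (x : Eu m) : Cl m :=
  if Even n then aPlus m n x else (-1 : ℝ) ^ m • aPlus m n x

/-- The boundary values `b_n^-`, `n ≥ 0`, from the lower half-space. -/
def bMinus (m n : ℕ) (x : Eu m) : Cl m :=
  if Even n then (-1 : ℝ) ^ m • bPlus m n x else bPlus m n x

theorem isTempered_radial {m : ℕ} (hm : 1 ≤ m) {lam p q : ℝ} (hlam : -(m : ℝ) + 1 ≤ lam)
    {v : Eu m → Cl m} (hv : AEStronglyMeasurable v) {C : ℝ} (hC : ∀ x, ‖v x‖ ≤ C) :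
    IsTempered (fun x => ((p * Real.log ‖x‖ + q) * ‖x‖ ^ lam) • v x) := by
  have hC0 : 0 ≤ C := (norm_nonneg _).trans (hC 0)
  refine isTempered_of_bound hm (s := lam + 1) (t := lam - 1 / 2) (C := (2 * |p| + |q|) * C)
    (by linarith) (by linarith) ?_ ?_
  · refine AEStronglyMeasurable.smul (𝕜 := ℝ) ?_ hv
    exact Measurable.aestronglyMeasurable (by fun_prop)
  · intro x hx
    have hr : 0 < ‖x‖ := norm_pos_iff.2 hx
    set r := ‖x‖ with hrdef
    have hlog : |Real.log r| ≤ 2 * (r ^ (1 : ℝ) + r ^ (-(1 / 2) : ℝ)) := by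
      have h1 : Real.log r ≤ r ^ (1 : ℝ) := by
        rw [Real.rpow_one]; linarith [Real.log_le_sub_one_of_pos hr]
      have h2 : -Real.log r ≤ 2 * r ^ (-(1 / 2) : ℝ) := by
        have := Real.log_le_rpow_div (x := r⁻¹) (ε := 1 / 2) (by positivity) (by norm_num)
        rw [Real.log_inv, Real.inv_rpow hr.le, ← Real.rpow_neg hr.le] at this
        linarith
      have h3 : 0 < r ^ (1 : ℝ) := by positivity
      have h4 : 0 < r ^ (-(1 / 2) : ℝ) := by positivity
      generalize r ^ (1 : ℝ) = X at *
      generalize r ^ (-(1 / 2) : ℝ) = Y at *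
      rw [abs_le]
      constructor <;> linarith
    have hone : 1 ≤ r ^ (1 : ℝ) + r ^ (-(1 / 2) : ℝ) := by
      have h3 : 0 < r ^ (1 : ℝ) := by positivity
      have h4 : 0 < r ^ (-(1 / 2) : ℝ) := by positivity
      rcases le_total 1 r with h | h
      · have := Real.one_le_rpow h zero_le_one
        exact this.trans (le_add_of_nonneg_right h4.le)
      · have := Real.one_le_rpow_of_pos_of_le_one_of_nonpos hr h (by norm_num : (-(1 / 2) : ℝ) ≤ 0)
        exact this.trans (le_add_of_nonneg_left h3.le)
    have hsum : r ^ (lam + 1) + r ^ (lam - 1 / 2)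
        = (r ^ (1 : ℝ) + r ^ (-(1 / 2) : ℝ)) * r ^ lam := by
      rw [add_mul, ← Real.rpow_add hr, ← Real.rpow_add hr]
      ring_nf
    rw [hsum, norm_smul, norm_mul, Real.norm_eq_abs, Real.norm_of_nonneg (by positivity)]
    set A := r ^ (1 : ℝ) + r ^ (-(1 / 2) : ℝ)
    have hpq : |p * Real.log r + q| ≤ (2 * |p| + |q|) * A := by
      calc |p * Real.log r + q| ≤ |p| * |Real.log r| + |q| := by
            rw [← abs_mul]; exact abs_add_le _ _
        _ ≤ |p| * (2 * A) + |q| * A := by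
            gcongr
            exact le_mul_of_one_le_right (abs_nonneg _) hone
        _ = _ := by ring
    have hL : 0 ≤ r ^ lam := by positivity
    calc |p * Real.log r + q| * r ^ lam * ‖v x‖
        ≤ ((2 * |p| + |q|) * A) * r ^ lam * C := by
          gcongr
          exact hC x
      _ = _ := by ring

theorem exists_norm_direction_le (m : ℕ) :
    AEStronglyMeasurable (fun x : Eu m => ‖x‖⁻¹ • vec m x) ∧
      ∃ C, ∀ x : Eu m, ‖‖x‖⁻¹ • vec m x‖ ≤ C := by
  constructor
  · have h1 : Continuous (vec m) := LinearMap.continuous_of_finiteDimensional _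
    refine AEStronglyMeasurable.smul (𝕜 := ℝ) ?_ h1.aestronglyMeasurable
    exact Measurable.aestronglyMeasurable (by fun_prop)
  · refine ⟨‖(vec m).toContinuousLinearMap‖, fun x => ?_⟩
    rw [norm_smul, norm_inv, norm_norm]
    have h := (vec m).toContinuousLinearMap.le_opNorm x
    rcases eq_or_ne x 0 with rfl | hx
    · simp
    · have hr : 0 < ‖x‖ := norm_pos_iff.2 hx
      rw [inv_mul_le_iff₀ hr, mul_comm]
      exact h

theorem isTempered_log_TStar {m : ℕ} (hm : 1 ≤ m) {lam : ℝ} (hlam : -(m : ℝ) + 1 ≤ lam)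
    (p q : ℝ) : IsTempered (fun x => (p * Real.log ‖x‖ + q) • TStar m lam x) := by
  convert (isTempered_radial hm (p := p) (q := q) hlam
    (v := fun _ => algebraMap ℝ (Cl m)
      (Real.pi ^ ((lam + m) / 2) / Real.Gamma ((lam + m) / 2)))
    aestronglyMeasurable_const (fun _ => le_rfl)) using 2
  simp only [TStar, Algebra.smul_def, ← map_mul]
  congr 1
  ring

theorem isTempered_log_UStar {m : ℕ} (hm : 1 ≤ m) {lam : ℝ} (hlam : -(m : ℝ) + 1 ≤ lam)
    (p q : ℝ) : IsTempered (fun x => (p * Real.log ‖x‖ + q) • UStar m lam x) := by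
  obtain ⟨h1, C, hC⟩ := exists_norm_direction_le m
  convert (isTempered_radial hm (p := p) (q := q) hlam h1 hC).const_smul
    (Real.pi ^ ((lam + m + 1) / 2) / Real.Gamma ((lam + m + 1) / 2)) using 2
  simp only [UStar, smul_smul]
  congr 1
  ring

theorem isTempered_logKernel {m : ℕ} (hm : 1 ≤ m) (n : ℕ) : IsTempered (logKernel m n) := by
  have h : -(m : ℝ) + 1 ≤ n := by
    have : (1 : ℝ) ≤ m := by exact_mod_cast hm
    have : (0 : ℝ) ≤ n := n.cast_nonneg
    linarith
  unfold logKernel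
  split_ifs
  · exact isTempered_log_TStar hm h _ _
  · exact isTempered_log_UStar hm h _ _

theorem isTempered_aPlus {m : ℕ} (hm : 1 ≤ m) (n : ℕ) : IsTempered (aPlus m n) := by
  have h : -(m : ℝ) + 1 ≤ -(m : ℝ) + n + 1 := by
    have : (0 : ℝ) ≤ n := n.cast_nonneg
    linarith
  unfold aPlus
  split_ifs
  · exact (isTempered_logKernel hm _).const_smul _
  · simpa using isTempered_log_TStar hm h 0 _

theorem isTempered_bPlus {m : ℕ} (hm : 1 ≤ m) (n : ℕ) : IsTempered (bPlus m n) := by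
  have h : -(m : ℝ) + 1 ≤ -(m : ℝ) + n + 1 := by
    have : (0 : ℝ) ≤ n := n.cast_nonneg
    linarith
  unfold bPlus
  split_ifs
  · exact (isTempered_logKernel hm _).const_smul _
  · simpa using isTempered_log_UStar hm h 0 _

theorem isTempered_aMinus {m : ℕ} (hm : 1 ≤ m) (n : ℕ) : IsTempered (aMinus m n) := by
  unfold aMinus
  split_ifs
  · exact isTempered_aPlus hm n
  · exact (isTempered_aPlus hm n).const_smul _

theorem isTempered_bMinus {m : ℕ} (hm : 1 ≤ m) (n : ℕ) : IsTempered (bMinus m n) := by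
  unfold bMinus
  split_ifs
  · exact (isTempered_bPlus hm n).const_smul _
  · exact isTempered_bPlus hm n

/-! ### The Hilbert transform -/

/-- The density `-(2/σ_{m+1}) ω / r^m` of the Hilbert kernel `H = b_{-1}^+ = b_{-1}^-`. -/
def hilbertDensity (m : ℕ) (z : Eu m) : Cl m :=
  (-(2 / sphereArea (m + 1)) * (‖z‖ ^ m)⁻¹) • (‖z‖⁻¹ • vec m z)

/-- The value of the Hilbert kernel on a function:
`⟨H, ψ⟩ = lim_{ε → 0+} ∫_{|z| > ε} ψ(z) (-(2/σ_{m+1}) ω / |z|^m) dz`. -/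
def hilbertPV {m : ℕ} (ψ : Eu m → ℝ) : Cl m :=
  limUnder (𝓝[>] (0 : ℝ)) fun ε => ∫ z in {z : Eu m | ε < ‖z‖}, ψ z • hilbertDensity m z

/-- The convolution `H ∗ (1_{|y| < R} u)` of the Hilbert kernel with the truncation of `u` to
a ball, applied to the test function `φ`:
`∫_{|y| < R} ⟨H(z), φ(y + z)⟩ u(y) dy` (a Clifford product). -/
def hilbertTrunc {m : ℕ} (u : Eu m → Cl m) (φ : 𝓢(Eu m, ℝ)) (R : ℝ) : Cl m :=
  ∫ y in Metric.ball (0 : Eu m) R, hilbertPV (fun z => φ (y + z)) * u y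

/-- `φ` annihilates all polynomials of degree at most `d` (an empty condition if `d < 0`). -/
def AnnihilatesPoly {m : ℕ} (d : ℤ) (φ : 𝓢(Eu m, ℝ)) : Prop :=
  ∀ P : MvPolynomial (Fin m) ℝ, (P.totalDegree : ℤ) ≤ d →
    ∫ x : Eu m, φ x * MvPolynomial.eval (fun i => x i) P = 0

/-- `H ∗ u = T` modulo polynomials of degree at most `d`: the convolution integral
converges to `T` on all test functions that annihilate these polynomials. -/
def IsHilbertTransformMod {m : ℕ} (d : ℤ) (u : Eu m → Cl m) (T : CDist m) : Prop :=
  ∀ φ : 𝓢(Eu m, ℝ), AnnihilatesPoly d φ → Tendsto (hilbertTrunc u φ) atTop (𝓝 (T φ))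

/-- `H ∗ u = T`: the convolution integral converges to `T` on all test functions. -/
def IsHilbertTransform {m : ℕ} (u : Eu m → Cl m) (T : CDist m) : Prop :=
  ∀ φ : 𝓢(Eu m, ℝ), Tendsto (hilbertTrunc u φ) atTop (𝓝 (T φ))

end

/-! Everything reduces to scalar identities. On the upper side `a_n` is a radial function `aRad` and
`b_n` is a radial factor `bRad` times the vector `x`, both of the form `(p ln r + q) r^λ`. The
recursions for `p` and `q`, together with `Γ(t+1) = tΓ(t)`, say exactly that `b_n = -∇a_{n+1}` and
`div b_{n+1} = a_n` away from the origin. The singularities at the origin are weak enough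
(`integral_lineDeriv_eq_zero`) for these to hold for distributions. As `b_{n+1}` is a gradient, the
Clifford product in `∂b_{n+1}` leaves only minus its divergence (`sum_smul_gen_mul_gen`); this gives
the Dirac relations.

For the Hilbert transform, the kernel is `H = -∂a_0`, where `a_0` is a multiple of `|x|^(1-m)`.
Hence `⟨H(z), φ(y+z)⟩` is a combination of Riesz potentials of the partial derivatives of `φ`
(`SchwartzMap.hilbertPV_eq`), and everything follows from the semigroup property `a_0 ∗ a_k =
a_{k+1}` (`SchwartzMap.integral_aRad_mul_rieszPot`). Indeed `H ∗ a_k = -∂a_{k+1} = b_k`, and moving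
the gradient in `b_k = -∇a_{k+1}` onto the potential gives `H ∗ b_k = -∂b_{k+1} = a_k`.

The semigroup property starts from the composition formula `|x|^(1-m) ∗ |x|^λ = c |x|^(λ+1)` for `-m
< λ < -1`, proved by writing powers as superpositions of heat kernels (`lintegral_riesz`). Larger
exponents are reached by analytic continuation in `λ` (`SchwartzMap.rieszPot_functional_equation`).
If `ψ` has vanishing moments of order below `N`, a multipole expansion shows that its Riesz
potential is `O(|y|^(1-m-N))`, so the pairing with `|y|^λ` is holomorphic for `-m < Re λ < N - 1`.
This is where the annihilation of polynomials enters. At exceptional exponents a factor `1/Γ`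
vanishes, and the derivative of the functional equation in `λ` yields the logarithmic kernels.

In the borderline case `k = m - 1` for `a_k`, the zero-mean condition is removed by parity: only the
odd part of `φ` matters. -/

noncomputable section

/-! ### Integrability against powers of the norm, with and without a logarithm -/

theorem ae_ne_zero {m : ℕ} (hm : 1 ≤ m) : ∀ᵐ x : Eu m, x ≠ 0 := by
  have : Nonempty (Fin m) := ⟨⟨0, hm⟩⟩
  simp [ae_iff]

/-- A function decaying like `(1 + |x|)^(-s)` is integrable against `|x|^σ` for
`-m < σ < s - m`. -/
theorem integrable_norm_rpow_mul {m : ℕ} (hm : 1 ≤ m) {f : Eu m → ℝ}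
    (hf : AEStronglyMeasurable f) {C s σ : ℝ} (hσ : -(m : ℝ) < σ) (hs : σ + m < s)
    (h : ∀ x, |f x| ≤ C * (1 + ‖x‖) ^ (-s)) : Integrable (fun x => ‖x‖ ^ σ * f x) := by
  have : Nonempty (Fin m) := ⟨⟨0, hm⟩⟩
  have key : Integrable (fun x : Eu m => ‖x‖ ^ σ * (1 + ‖x‖) ^ (-s)) := by
    rw [integrable_fun_norm_addHaar (volume : Measure (Eu m))
      (f := fun y : ℝ => y ^ σ * (1 + y) ^ (-s))]
    simp only [finrank_euclideanSpace, Fintype.card_fin, smul_eq_mul]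
    have hmeas : Measurable fun y : ℝ => y ^ (m - 1) * (y ^ σ * (1 + y) ^ (-s)) := by fun_prop
    have hcast : ((m - 1 : ℕ) : ℝ) = (m : ℝ) - 1 := by push_cast [Nat.cast_sub hm]; ring
    have hpow : ∀ y : ℝ, 0 < y → y ^ (m - 1) * y ^ σ = y ^ ((m : ℝ) - 1 + σ) := by
      intro y hy
      rw [Real.rpow_add hy, ← hcast, Real.rpow_natCast]
    rw [← Ioc_union_Ioi_eq_Ioi (zero_le_one' ℝ)]
    refine IntegrableOn.union ?_ ?_
    · have h1 : IntegrableOn (fun y : ℝ => y ^ ((m : ℝ) - 1 + σ)) (Ioc 0 1) :=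
        (intervalIntegrable_iff_integrableOn_Ioc_of_le zero_le_one).1
          (intervalIntegral.intervalIntegrable_rpow' (by linarith))
      refine h1.mono' hmeas.aestronglyMeasurable ?_
      refine (ae_restrict_iff' measurableSet_Ioc).2 (Eventually.of_forall fun y hy => ?_)
      have hy0 : 0 < y := hy.1
      rw [Real.norm_of_nonneg (by positivity), ← mul_assoc, hpow y hy0]
      have hms : (0 : ℝ) < m := by exact_mod_cast hm
      refine mul_le_of_le_one_right (by positivity)
        (Real.rpow_le_one_of_one_le_of_nonpos (by linarith) (by linarith))
    · have h1 : IntegrableOn (fun y : ℝ => y ^ ((m : ℝ) - 1 + σ - s)) (Ioi 1) :=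
        integrableOn_Ioi_rpow_of_lt (by linarith) zero_lt_one
      refine h1.mono' hmeas.aestronglyMeasurable ?_
      refine (ae_restrict_iff' measurableSet_Ioi).2 (Eventually.of_forall fun y hy => ?_)
      have hy0 : 0 < y := lt_trans zero_lt_one hy
      rw [Real.norm_of_nonneg (by positivity), ← mul_assoc, hpow y hy0, sub_eq_add_neg _ s,
        Real.rpow_add hy0 _ (-s)]
      refine mul_le_mul_of_nonneg_left ?_ (by positivity)
      exact Real.rpow_le_rpow_of_nonpos hy0 (by linarith) (by linarith)
  refine (key.const_mul C).mono' ?_ (Eventually.of_forall fun x => ?_)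
  · exact (Measurable.aestronglyMeasurable (by fun_prop)).mul hf
  · have h0 : 0 ≤ ‖x‖ ^ σ := by positivity
    rw [norm_mul, Real.norm_of_nonneg h0, Real.norm_eq_abs]
    calc ‖x‖ ^ σ * |f x| ≤ ‖x‖ ^ σ * (C * (1 + ‖x‖) ^ (-s)) := by gcongr; exact h x
      _ = _ := by ring

theorem abs_log_mul_rpow_le {r σ δ : ℝ} (hr : 0 < r) (hδ : 0 < δ) :
    |Real.log r| * r ^ σ ≤ δ⁻¹ * (r ^ (σ - δ) + r ^ (σ + δ)) := by
  have h1 : Real.log r ≤ r ^ δ / δ := Real.log_le_rpow_div hr.le hδ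
  have h2 : -Real.log r ≤ r ^ (-δ) / δ := by
    have := Real.log_le_rpow_div (x := r⁻¹) (by positivity) hδ
    rwa [Real.log_inv, Real.inv_rpow hr.le, ← Real.rpow_neg hr.le] at this
  have h3 : 0 < r ^ δ / δ := by positivity
  have h4 : 0 < r ^ (-δ) / δ := by positivity
  have h5 : |Real.log r| ≤ δ⁻¹ * (r ^ (-δ) + r ^ δ) := by
    rw [show δ⁻¹ * (r ^ (-δ) + r ^ δ) = r ^ (-δ) / δ + r ^ δ / δ by ring, abs_le]
    constructor <;> linarith
  rw [sub_eq_add_neg, Real.rpow_add hr, Real.rpow_add hr]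
  calc |Real.log r| * r ^ σ ≤ (δ⁻¹ * (r ^ (-δ) + r ^ δ)) * r ^ σ := by gcongr
    _ = _ := by ring

/-- `f` is integrable against `|x|^σ` for all exponents `σ` in the interval `(A, B)`. -/
def PowIntegrable {m : ℕ} (A B : ℝ) (f : Eu m → ℝ) : Prop :=
  ∀ σ ∈ Ioo A B, Integrable (fun x => ‖x‖ ^ σ * f x)

theorem powIntegrable_of_le {m : ℕ} (hm : 1 ≤ m) {f : Eu m → ℝ}
    (hf : AEStronglyMeasurable f) {C s : ℝ} (h : ∀ x, |f x| ≤ C * (1 + ‖x‖) ^ (-s)) :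
    PowIntegrable (-(m : ℝ)) (s - m) f :=
  fun _ hσ => integrable_norm_rpow_mul hm hf hσ.1 (by linarith [hσ.2]) h

theorem PowIntegrable.aestronglyMeasurable {m : ℕ} (hm : 1 ≤ m) {A B : ℝ} (hAB : A < B)
    {f : Eu m → ℝ} (hf : PowIntegrable A B f) : AEStronglyMeasurable f := by
  obtain ⟨σ, hσ⟩ := nonempty_Ioo.2 hAB
  have h2 : AEStronglyMeasurable (fun x : Eu m => ‖x‖ ^ (-σ) * (‖x‖ ^ σ * f x)) :=
    (Measurable.aestronglyMeasurable (by fun_prop)).mul (hf σ hσ).1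
  refine h2.congr ?_
  filter_upwards [ae_ne_zero hm] with x hx
  have : 0 < ‖x‖ := norm_pos_iff.2 hx
  rw [← mul_assoc, ← Real.rpow_add this]
  simp

/-- The interval of exponents is open, so a small margin `δ` on both sides of `σ` absorbs the
logarithm through `abs_log_mul_rpow_le`. -/
theorem PowIntegrable.log_mul {m : ℕ} (hm : 1 ≤ m) {A B : ℝ} {f : Eu m → ℝ}
    (hf : PowIntegrable A B f) {σ : ℝ} (hσ : σ ∈ Ioo A B) :
    Integrable (fun x => (Real.log ‖x‖ * ‖x‖ ^ σ) * f x) := by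
  obtain ⟨δ, hδ, h1, h2⟩ : ∃ δ > 0, A < σ - δ ∧ σ + δ < B := by
    have hσ1 := hσ.1
    have hσ2 := hσ.2
    refine ⟨min (σ - A) (B - σ) / 2, ?_, ?_, ?_⟩
    · have : 0 < min (σ - A) (B - σ) := lt_min (by linarith) (by linarith)
      positivity
    · have := min_le_left (σ - A) (B - σ)
      linarith
    · have := min_le_right (σ - A) (B - σ)
      linarith
  have hmeas := hf.aestronglyMeasurable hm (hσ.1.trans hσ.2)
  have hi := (((hf (σ - δ) ⟨h1, by linarith⟩).norm.add
    (hf (σ + δ) ⟨by linarith, h2⟩).norm).const_mul δ⁻¹)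
  refine hi.mono' ((Measurable.aestronglyMeasurable (by fun_prop)).mul hmeas) ?_
  filter_upwards [ae_ne_zero hm] with x hx
  have hr : 0 < ‖x‖ := norm_pos_iff.2 hx
  have := mul_le_mul_of_nonneg_right (abs_log_mul_rpow_le (σ := σ) hr hδ) (abs_nonneg (f x))
  simp only [Pi.add_apply, norm_mul, Real.norm_eq_abs, Real.abs_rpow_of_nonneg hr.le, abs_norm]
  linarith

theorem PowIntegrable.logpow_mul {m : ℕ} (hm : 1 ≤ m) {A B : ℝ} {f : Eu m → ℝ}
    (hf : PowIntegrable A B f) {σ : ℝ} (hσ : σ ∈ Ioo A B) (p q : ℝ) :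
    Integrable (fun x => ((p * Real.log ‖x‖ + q) * ‖x‖ ^ σ) * f x) := by
  refine (((hf.log_mul hm hσ).const_mul p).add ((hf σ hσ).const_mul q)).congr
    (Eventually.of_forall fun x => ?_)
  simp only [Pi.add_apply]
  ring

/-! ### Integration by parts with a singularity at the origin -/

theorem exists_deriv_smoothTransition_le :
    ∃ M, 0 ≤ M ∧ (∀ t, |deriv Real.smoothTransition t| ≤ M) ∧
      (∀ t < 0, deriv Real.smoothTransition t = 0) ∧
      (∀ t > 1, deriv Real.smoothTransition t = 0) := by
  have h0 : ∀ t < 0, deriv Real.smoothTransition t = 0 := by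
    intro t ht
    have : Real.smoothTransition =ᶠ[𝓝 t] fun _ => 0 := by
      filter_upwards [gt_mem_nhds ht] with s hs
      exact Real.smoothTransition.zero_of_nonpos hs.le
    rw [this.deriv_eq, deriv_const]
  have h1 : ∀ t > 1, deriv Real.smoothTransition t = 0 := by
    intro t ht
    have : Real.smoothTransition =ᶠ[𝓝 t] fun _ => 1 := by
      filter_upwards [lt_mem_nhds ht] with s hs
      exact Real.smoothTransition.one_of_one_le hs.le
    rw [this.deriv_eq, deriv_const]
  have hc : Continuous (deriv Real.smoothTransition) :=
    (Real.smoothTransition.contDiff (n := 1)).continuous_deriv le_rfl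
  obtain ⟨M, hM⟩ := (isCompact_Icc (a := (0 : ℝ)) (b := 1)).exists_bound_of_continuousOn
    hc.continuousOn
  refine ⟨max M 0, le_max_right _ _, fun t => ?_, h0, h1⟩
  by_cases ht0 : t < 0
  · simp [h0 t ht0]
  by_cases ht1 : 1 < t
  · simp [h1 t ht1]
  · exact (hM t ⟨not_lt.1 ht0, not_lt.1 ht1⟩).trans (le_max_left _ _)

theorem hasLineDerivAt_norm_sq {m : ℕ} (x v : Eu m) :
    HasLineDerivAt ℝ (fun x : Eu m => ‖x‖ ^ 2) (2 * inner ℝ x v) x v := by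
  have := (hasStrictFDerivAt_norm_sq x).hasFDerivAt.hasLineDerivAt v
  simpa using this

theorem HasLineDerivAt.fun_mul {m : ℕ} {f g : Eu m → ℝ} {f' g' : ℝ} {x v : Eu m}
    (hf : HasLineDerivAt ℝ f f' x v) (hg : HasLineDerivAt ℝ g g' x v) :
    HasLineDerivAt ℝ (fun x => f x * g x) (f' * g x + f x * g') x v := by
  have := HasDerivAt.mul (c := fun t : ℝ => f (x + t • v)) (d := fun t : ℝ => g (x + t • v)) hf hg
  simp only [zero_smul, add_zero] at this
  exact this

theorem HasDerivAt.comp_hasLineDerivAt {m : ℕ} {f : ℝ → ℝ} {g : Eu m → ℝ} {f' g' : ℝ}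
    {x v : Eu m} (hf : HasDerivAt f f' (g x)) (hg : HasLineDerivAt ℝ g g' x v) :
    HasLineDerivAt ℝ (fun x => f (g x)) (f' * g') x v :=
  HasDerivAt.comp_of_eq (0 : ℝ) hf hg (by simp)

/-- Cutoff functions supported away from the origin and from infinity. -/
theorem exists_cutoff (m : ℕ) (v : Eu m) : ∃ (χ χ' : ℕ → Eu m → ℝ) (C : ℝ),
    (∀ n, Measurable (χ n)) ∧ (∀ n, Measurable (χ' n)) ∧
    (∀ n x, HasLineDerivAt ℝ (χ n) (χ' n x) x v) ∧
    (∀ n, (0 : Eu m) ∉ tsupport (χ n)) ∧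
    (∀ n x, |χ n x| ≤ 1) ∧ (∀ n x, ‖x‖ * |χ n x| ≤ 2 * (n + 1)) ∧
    (∀ n x, ‖x‖ * |χ' n x| ≤ C) ∧
    (∀ x ≠ 0, ∀ᶠ n in atTop, χ n x = 1 ∧ χ' n x = 0) := by
  obtain ⟨M, hM0, hM, hM1, hM2⟩ := exists_deriv_smoothTransition_le
  set S := Real.smoothTransition with hS
  have hSd : ∀ t, HasDerivAt S (deriv S t) t := fun t =>
    ((Real.smoothTransition.contDiff (n := 1)).differentiable (by simp) t).hasDerivAt
  have hSc : Continuous S := Real.smoothTransition.continuous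
  have hS'c : Continuous (deriv S) :=
    (Real.smoothTransition.contDiff (n := 1)).continuous_deriv le_rfl
  have hS1 : ∀ t, |S t| ≤ 1 := fun t => by
    rw [abs_of_nonneg (Real.smoothTransition.nonneg t)]
    exact Real.smoothTransition.le_one t
  -- The cutoff below vanishes for `|x|² ≤ 1/N` and for `|x|² ≥ 2N`, and equals `1` for `2/N ≤ |x|²
  -- ≤ N`. Using `|x|²` keeps it smooth at the origin.
  let N : ℕ → ℝ := fun n => (n + 1) ^ 2
  have hN : ∀ n, 0 < N n := fun n => by positivity
  let χ : ℕ → Eu m → ℝ := fun n x => S (N n * ‖x‖ ^ 2 - 1) * S (2 - (N n)⁻¹ * ‖x‖ ^ 2)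
  let χ' : ℕ → Eu m → ℝ := fun n x =>
    deriv S (N n * ‖x‖ ^ 2 - 1) * (N n * (2 * inner ℝ x v)) * S (2 - (N n)⁻¹ * ‖x‖ ^ 2) +
    S (N n * ‖x‖ ^ 2 - 1) * (deriv S (2 - (N n)⁻¹ * ‖x‖ ^ 2) * -((N n)⁻¹ * (2 * inner ℝ x v)))
  refine ⟨χ, χ', M * (4 * ‖v‖) + M * (4 * ‖v‖), ?_, ?_, ?_, ?_, ?_, ?_, ?_, ?_⟩
  · intro n
    exact Continuous.measurable (by fun_prop)
  · intro n
    exact Continuous.measurable (by fun_prop)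
  · intro n x
    have h := hasLineDerivAt_norm_sq x v
    refine HasLineDerivAt.fun_mul ?_ ?_
    · exact (hSd _).comp_hasLineDerivAt (g := fun x : Eu m => N n * ‖x‖ ^ 2 - 1)
        ((HasDerivAt.const_mul (N n) h).sub_const 1)
    · exact (hSd _).comp_hasLineDerivAt (g := fun x : Eu m => 2 - (N n)⁻¹ * ‖x‖ ^ 2)
        ((HasDerivAt.const_mul (N n)⁻¹ h).const_sub 2)
  · intro n
    rw [notMem_tsupport_iff_eventuallyEq]
    have hc : Continuous fun x : Eu m => N n * ‖x‖ ^ 2 - 1 := by fun_prop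
    have : ∀ᶠ x : Eu m in 𝓝 0, N n * ‖x‖ ^ 2 - 1 < 0 :=
      hc.continuousAt.eventually_lt continuousAt_const (by simp)
    filter_upwards [this] with x hx
    simp [χ, hS, Real.smoothTransition.zero_of_nonpos hx.le]
  · intro n x
    rw [abs_mul]
    exact mul_le_one₀ (hS1 _) (abs_nonneg _) (hS1 _)
  · intro n x
    by_cases hx : 2 - (N n)⁻¹ * ‖x‖ ^ 2 ≤ 0
    · have : χ n x = 0 := by simp [χ, hS, Real.smoothTransition.zero_of_nonpos hx]
      rw [this]
      simp only [abs_zero, mul_zero]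
      positivity
    · have h1 : ‖x‖ ^ 2 ≤ 2 * N n := by
        have : (N n)⁻¹ * ‖x‖ ^ 2 ≤ 2 := by linarith
        rwa [inv_mul_le_iff₀ (hN n), mul_comm] at this
      have h2 : ‖x‖ ≤ 2 * (n + 1) := by
        apply le_of_sq_le_sq _ (by positivity)
        simp only [N] at h1
        nlinarith [sq_nonneg ((n : ℝ) + 1)]
      have h3 : |χ n x| ≤ 1 := by
        rw [abs_mul]
        exact mul_le_one₀ (hS1 _) (abs_nonneg _) (hS1 _)
      calc ‖x‖ * |χ n x| ≤ ‖x‖ * 1 := by gcongr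
        _ ≤ _ := by linarith
  · intro n x
    have hin : |inner ℝ x v| ≤ ‖x‖ * ‖v‖ := abs_real_inner_le_norm x v
    -- Here `a` is `N` or `N⁻¹` and `t` is a value of `S'`. Where `t ≠ 0` one has `a|x|² ≤ 2`, so
    -- the derivative of the cutoff is `O(1/|x|)` uniformly in `n`.
    have key : ∀ a t : ℝ, 0 < a → (t ≠ 0 → a * ‖x‖ ^ 2 ≤ 2) → |t| ≤ M →
        ‖x‖ * (|t| * |a * (2 * inner ℝ x v)|) ≤ M * (4 * ‖v‖) := by
      intro a t ha ht htM
      by_cases h0 : t = 0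
      · rw [h0]
        simp only [abs_zero, zero_mul, mul_zero]
        positivity
      · have h1 := ht h0
        rw [abs_mul, abs_of_pos ha, abs_mul, abs_two]
        calc ‖x‖ * (|t| * (a * (2 * |inner ℝ x v|)))
            ≤ ‖x‖ * (M * (a * (2 * (‖x‖ * ‖v‖)))) := by gcongr
          _ = M * (2 * (a * ‖x‖ ^ 2) * ‖v‖) := by ring
          _ ≤ M * (2 * 2 * ‖v‖) := by gcongr
          _ = _ := by ring
    have k1 := key (N n) (deriv S (N n * ‖x‖ ^ 2 - 1)) (hN n) (fun h => by
      by_contra h2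
      exact h (hM2 _ (by linarith [not_le.1 h2]))) (hM _)
    have k2 := key (N n)⁻¹ (deriv S (2 - (N n)⁻¹ * ‖x‖ ^ 2)) (inv_pos.2 (hN n)) (fun h => by
      by_contra h2
      exact h (hM1 _ (by linarith [not_le.1 h2]))) (hM _)
    have a1 : ∀ t s u : ℝ, |s| ≤ 1 → |t * u * s| ≤ |t| * |u| := fun t s u hs => by
      rw [abs_mul, abs_mul]
      exact mul_le_of_le_one_right (by positivity) hs
    have a2 : ∀ t s u : ℝ, |s| ≤ 1 → |s * (t * -u)| ≤ |t| * |u| := fun t s u hs => by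
      rw [abs_mul, abs_mul, abs_neg]
      exact mul_le_of_le_one_left (by positivity) hs
    calc ‖x‖ * |χ' n x| ≤ ‖x‖ * (|deriv S (N n * ‖x‖ ^ 2 - 1)| * |N n * (2 * inner ℝ x v)|
          + |deriv S (2 - (N n)⁻¹ * ‖x‖ ^ 2)| * |(N n)⁻¹ * (2 * inner ℝ x v)|) := by
          refine mul_le_mul_of_nonneg_left ((abs_add_le _ _).trans ?_) (norm_nonneg _)
          exact add_le_add (a1 _ _ _ (hS1 _)) (a2 _ _ _ (hS1 _))
      _ ≤ _ := by rw [mul_add]; exact add_le_add k1 k2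
  · intro x hx
    have hr : 0 < ‖x‖ ^ 2 := by positivity
    have hNt : Tendsto N atTop atTop :=
      (tendsto_pow_atTop (two_ne_zero)).comp
        (tendsto_atTop_add_const_right _ 1 tendsto_natCast_atTop_atTop)
    have e1 := (hNt.atTop_mul_const hr).eventually_gt_atTop 2
    have e2 := hNt.eventually_gt_atTop (‖x‖ ^ 2)
    filter_upwards [e1, e2] with n h1 h2
    have g1 : 1 < N n * ‖x‖ ^ 2 - 1 := by linarith
    have g2 : 1 < 2 - (N n)⁻¹ * ‖x‖ ^ 2 := by
      have : (N n)⁻¹ * ‖x‖ ^ 2 < 1 := by rw [inv_mul_lt_iff₀ (hN n)]; linarith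
      linarith
    constructor
    · simp [χ, hS, Real.smoothTransition.one_of_one_le g1.le,
        Real.smoothTransition.one_of_one_le g2.le]
    · simp [χ', hM2 _ g1, hM2 _ g2]

/-- The integral of a directional derivative vanishes, for a function differentiable outside
the origin with a singularity of order less than `|x|^(1-m)`. -/
theorem integral_lineDeriv_eq_zero {m : ℕ} (hm : 1 ≤ m) {W W' : Eu m → ℝ} {v : Eu m}
    (hW : ∀ x ≠ 0, HasLineDerivAt ℝ W (W' x) x v) (h1 : Integrable W')
    (h2 : Integrable fun x => ‖x‖⁻¹ * W x) : ∫ x, W' x = 0 := by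
  obtain ⟨χ, χ', C, hχm, hχ'm, hχd, hχ0, hχ1, hχ2, hχ'1, hχlim⟩ := exists_cutoff m v
  have hWm : AEStronglyMeasurable W := by
    have : AEStronglyMeasurable (fun x : Eu m => ‖x‖ * (‖x‖⁻¹ * W x)) :=
      (Measurable.aestronglyMeasurable (by fun_prop)).mul h2.1
    refine this.congr ?_
    filter_upwards [ae_ne_zero hm] with x hx
    have : ‖x‖ ≠ 0 := norm_ne_zero_iff.2 hx
    field_simp
  -- Since `|χ'| ≤ C/|x|`, the integrability of `|x|⁻¹ W` dominates the error term of the cutoff,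
  -- which then tends to `0` because `χ' → 0` pointwise. No boundary integral has to be estimated.
  have hb1 : ∀ n, ∀ᵐ x : Eu m, ‖χ' n x * W x‖ ≤ C * ‖‖x‖⁻¹ * W x‖ := by
    intro n
    filter_upwards [ae_ne_zero hm] with x hx
    have hr : 0 < ‖x‖ := norm_pos_iff.2 hx
    rw [norm_mul, norm_mul, norm_inv, norm_norm, Real.norm_eq_abs]
    calc |χ' n x| * ‖W x‖ = (‖x‖ * |χ' n x|) * (‖x‖⁻¹ * ‖W x‖) := by field_simp
      _ ≤ _ := by gcongr; exact hχ'1 n x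
  have hb2 : ∀ n, ∀ᵐ x : Eu m, ‖χ n x * W' x‖ ≤ ‖W' x‖ := by
    intro n
    refine Eventually.of_forall fun x => ?_
    rw [norm_mul, Real.norm_eq_abs]
    exact mul_le_of_le_one_left (norm_nonneg _) (hχ1 n x)
  have i1 : ∀ n, Integrable fun x => χ' n x * W x := fun n =>
    (h2.norm.const_mul C).mono' ((hχ'm n).aestronglyMeasurable.mul hWm) (hb1 n)
  have i2 : ∀ n, Integrable fun x => χ n x * W' x := fun n =>
    h1.norm.mono' ((hχm n).aestronglyMeasurable.mul h1.1) (hb2 n)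
  have i3 : ∀ n, Integrable fun x => χ n x * W x := fun n => by
    refine (h2.norm.const_mul (2 * (n + 1 : ℝ))).mono' ((hχm n).aestronglyMeasurable.mul hWm) ?_
    filter_upwards [ae_ne_zero hm] with x hx
    have hr : 0 < ‖x‖ := norm_pos_iff.2 hx
    rw [norm_mul, norm_mul, norm_inv, norm_norm, Real.norm_eq_abs]
    calc |χ n x| * ‖W x‖ = (‖x‖ * |χ n x|) * (‖x‖⁻¹ * ‖W x‖) := by field_simp
      _ ≤ _ := mul_le_mul_of_nonneg_right (hχ2 n x) (by positivity)
  have hibp : ∀ n, ∫ x, χ n x * W' x = -∫ x, χ' n x * W x := fun n =>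
    integral_bilinear_hasLineDerivAt_right_eq_neg_left_of_integrable
      (B := ContinuousLinearMap.mul ℝ ℝ) (i1 n) (i2 n) (i3 n) (fun x _ => hχd n x)
      (fun x hx => hW x (by rintro rfl; exact hχ0 n hx))
  have t1 : Tendsto (fun n => ∫ x, χ n x * W' x) atTop (𝓝 (∫ x, W' x)) := by
    refine tendsto_integral_of_dominated_convergence _ (fun n => (i2 n).1) h1.norm hb2 ?_
    filter_upwards [ae_ne_zero hm] with x hx
    refine tendsto_const_nhds.congr' ?_
    filter_upwards [hχlim x hx] with n hn
    simp [hn.1]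
  have t2 : Tendsto (fun n => ∫ x, χ' n x * W x) atTop (𝓝 (∫ x : Eu m, (0 : ℝ))) := by
    refine tendsto_integral_of_dominated_convergence _ (fun n => (i1 n).1)
      (h2.norm.const_mul C) hb1 ?_
    filter_upwards [ae_ne_zero hm] with x hx
    refine tendsto_const_nhds.congr' ?_
    filter_upwards [hχlim x hx] with n hn
    simp [hn.2]
  rw [integral_zero] at t2
  have t3 := t2.neg
  rw [neg_zero] at t3
  exact tendsto_nhds_unique t1 (t3.congr fun n => (hibp n).symm)

/-! ### The composition of Riesz kernels -/

open scoped ENNReal in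
/-- The heat kernel `c^(-m/2) exp(-π|x|²/c)`. -/
def heatKernel (m : ℕ) (c : ℝ) (x : Eu m) : ℝ≥0∞ :=
  ENNReal.ofReal (c ^ (-(m : ℝ) / 2) * Real.exp (-(Real.pi * ‖x‖ ^ 2 * c⁻¹)))

open scoped ENNReal in
/-- The density `c_+^(α-1)`. -/
def powPlus (α c : ℝ) : ℝ≥0∞ := if 0 < c then ENNReal.ofReal (c ^ (α - 1)) else 0

theorem measurable_powPlus (α : ℝ) : Measurable (powPlus α) := by
  unfold powPlus
  exact Measurable.ite measurableSet_Ioi (by fun_prop) measurable_const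

@[fun_prop]
theorem Measurable.powPlus {X : Type*} [MeasurableSpace X] {f : X → ℝ} (hf : Measurable f)
    (α : ℝ) : Measurable fun p => powPlus α (f p) :=
  (measurable_powPlus α).comp hf

@[fun_prop]
theorem Measurable.heatKernel {m : ℕ} {X : Type*} [MeasurableSpace X] {f : X → ℝ} {g : X → Eu m}
    (hf : Measurable f) (hg : Measurable g) : Measurable fun p => heatKernel m (f p) (g p) := by
  unfold _root_.heatKernel
  fun_prop

/-- Subordination: up to a constant, `|x|^(2α-m)` is a superposition of heat kernels. The
substitution `a ↦ a⁻¹` turns the integral into Euler's integral for `Γ`. Working in the extended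
nonnegative reals lets later integrals be interchanged by Tonelli, with measurability alone. -/
theorem lintegral_powPlus_mul_heatKernel {m : ℕ} {α : ℝ} (hα : α < m / 2) {x : Eu m}
    (hx : x ≠ 0) : ∫⁻ a, powPlus α a * heatKernel m a x =
      ENNReal.ofReal (Real.Gamma (m / 2 - α) * Real.pi ^ (α - m / 2) * ‖x‖ ^ (2 * α - m)) := by
  have hr : 0 < ‖x‖ := norm_pos_iff.2 hx
  have hR : 0 < Real.pi * ‖x‖ ^ 2 := by positivity
  have hδ : 0 < m / 2 - α := by linarith
  have h1 := Real.integral_rpow_mul_exp_neg_mul_Ioi hδ hR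
  have h2 := integral_comp_rpow_Ioi (fun t : ℝ => t ^ (m / 2 - α - 1) *
    Real.exp (-(Real.pi * ‖x‖ ^ 2 * t))) (p := -1) (by norm_num)
  rw [h1] at h2
  have h3 : ∫ a in Ioi (0 : ℝ), a ^ (α - 1) * (a ^ (-(m : ℝ) / 2) *
      Real.exp (-(Real.pi * ‖x‖ ^ 2 * a⁻¹))) =
      Real.Gamma (m / 2 - α) * Real.pi ^ (α - m / 2) * ‖x‖ ^ (2 * α - m) := by
    trans (1 / (Real.pi * ‖x‖ ^ 2)) ^ ((m : ℝ) / 2 - α) * Real.Gamma (m / 2 - α)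
    · rw [← h2]
      refine setIntegral_congr_fun measurableSet_Ioi fun a ha => ?_
      have ha : 0 < a := ha
      simp only [smul_eq_mul, abs_neg, abs_one, one_mul]
      rw [Real.rpow_neg_one, Real.inv_rpow ha.le, ← Real.rpow_neg ha.le, ← mul_assoc, ← mul_assoc,
        ← Real.rpow_add ha, ← Real.rpow_add ha]
      congr 2
      ring
    · rw [one_div, Real.inv_rpow hR.le, ← Real.rpow_neg hR.le, Real.mul_rpow Real.pi_pos.le
        (by positivity), ← Real.rpow_natCast, ← Real.rpow_mul hr.le]
      push_cast
      rw [show -((m : ℝ) / 2 - α) = α - m / 2 by ring,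
        show 2 * (α - (m : ℝ) / 2) = 2 * α - m by ring]
      ring
  rw [← h3, ofReal_integral_eq_lintegral_ofReal]
  · rw [← lintegral_indicator measurableSet_Ioi]
    refine lintegral_congr fun a => ?_
    by_cases ha : 0 < a
    · simp only [powPlus, ha, if_true, heatKernel]
      rw [indicator_of_mem (mem_Ioi.2 ha), ← ENNReal.ofReal_mul (by positivity)]
    · simp [powPlus, ha]
  -- A non-integrable function has integral `0` by convention, whereas the value just computed is
  -- positive; so integrability needs no separate estimate.
  · by_contra hn
    rw [integral_undef hn] at h3
    have : 0 < Real.Gamma (m / 2 - α) * Real.pi ^ (α - m / 2) * ‖x‖ ^ (2 * α - m) := by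
      have := Real.Gamma_pos_of_pos hδ
      positivity
    linarith
  · refine (ae_restrict_iff' measurableSet_Ioi).2 (Eventually.of_forall fun a ha => ?_)
    have ha : 0 < a := ha
    positivity

/-- Euler's Beta integral: the functions `c_+^(α-1) / Γ(α)` form a convolution semigroup in `α`. -/
theorem lintegral_powPlus_conv {α β : ℝ} (hα : 0 < α) (hβ : 0 < β) (c : ℝ) :
    ∫⁻ a, powPlus α a * powPlus β (c - a) =
      ENNReal.ofReal (Real.Gamma α * Real.Gamma β / Real.Gamma (α + β)) * powPlus (α + β) c := by
  by_cases hc : 0 < c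
  · have h1 := Complex.betaIntegral_scaled α β hc
    have h2 := Complex.Gamma_mul_Gamma_eq_betaIntegral (s := α) (t := β) (by simpa) (by simpa)
    have hG := Real.Gamma_pos_of_pos (add_pos hα hβ)
    have h3 : ∫ a in Ioc 0 c, a ^ (α - 1) * (c - a) ^ (β - 1) =
        Real.Gamma α * Real.Gamma β / Real.Gamma (α + β) * c ^ (α + β - 1) := by
      apply Complex.ofReal_injective
      rw [← integral_complex_ofReal]
      rw [intervalIntegral.integral_of_le hc.le] at h1
      have hB : Complex.betaIntegral α β =
          ((Real.Gamma α * Real.Gamma β / Real.Gamma (α + β) : ℝ) : ℂ) := by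
        push_cast
        rw [Complex.Gamma_ofReal, Complex.Gamma_ofReal, ← Complex.ofReal_add,
          Complex.Gamma_ofReal] at h2
        rw [h2, mul_div_cancel_left₀]
        exact_mod_cast hG.ne'
      rw [hB] at h1
      calc _ = ∫ a in Ioc 0 c, (a : ℂ) ^ ((α : ℂ) - 1) * ((c : ℂ) - a) ^ ((β : ℂ) - 1) := by
            refine setIntegral_congr_fun measurableSet_Ioc fun a ha => ?_
            rw [Complex.ofReal_mul, Complex.ofReal_cpow ha.1.le,
              Complex.ofReal_cpow (sub_nonneg.2 ha.2)]
            push_cast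
            rfl
        _ = _ := by
            rw [h1, mul_comm, Complex.ofReal_mul, Complex.ofReal_cpow hc.le]
            push_cast
            rfl
    have hpos : 0 < Real.Gamma α * Real.Gamma β / Real.Gamma (α + β) := by
      have := Real.Gamma_pos_of_pos hα
      have := Real.Gamma_pos_of_pos hβ
      positivity
    rw [powPlus, if_pos hc, ← ENNReal.ofReal_mul hpos.le, ← h3,
      ofReal_integral_eq_lintegral_ofReal]
    · rw [← lintegral_indicator measurableSet_Ioc]
      refine lintegral_congr_ae ?_
      filter_upwards [(by simp [ae_iff] : ∀ᵐ a : ℝ, a ≠ c)] with a hac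
      by_cases ha : 0 < a
      · by_cases hca : a < c
        · have h4 : 0 < c - a := sub_pos.2 hca
          rw [indicator_of_mem (show a ∈ Ioc 0 c from ⟨ha, hca.le⟩)]
          simp only [powPlus, ha, if_true, h4]
          rw [← ENNReal.ofReal_mul (by positivity)]
        · have h4 : ¬ 0 < c - a := by linarith
          have h5 : a ∉ Ioc 0 c := fun h => hca (lt_of_le_of_ne h.2 hac)
          simp [powPlus, h4, h5]
      · have h5 : a ∉ Ioc 0 c := fun h => ha h.1
        simp [powPlus, ha, h5]
    · by_contra hn
      rw [integral_undef hn] at h3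
      have : 0 < c ^ (α + β - 1) := by positivity
      have := mul_pos hpos this
      linarith
    · refine (ae_restrict_iff' measurableSet_Ioc).2 (Eventually.of_forall fun a ha => ?_)
      have ha1 : 0 < a := ha.1
      have ha2 : 0 ≤ c - a := sub_nonneg.2 ha.2
      positivity
  · have : ∀ a, powPlus α a * powPlus β (c - a) = 0 := by
      intro a
      by_cases ha : 0 < a
      · have : ¬ 0 < c - a := by linarith
        simp [powPlus, this]
      · simp [powPlus, ha]
    rw [lintegral_congr this, powPlus, if_neg hc]
    simp

theorem lintegral_heatKernel_conv {m : ℕ} {a b : ℝ} (ha : 0 < a) (hb : 0 < b) (x : Eu m) :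
    ∫⁻ y, heatKernel m a (x - y) * heatKernel m b y = heatKernel m (a + b) x := by
  have hab : 0 < a + b := add_pos ha hb
  have hc : 0 < Real.pi * (a⁻¹ + b⁻¹) := by positivity
  -- Completing the square in `y` at the point `(b / (a + b)) x`.
  have hsq : ∀ y : Eu m, Real.pi * ‖x - y‖ ^ 2 * a⁻¹ + Real.pi * ‖y‖ ^ 2 * b⁻¹ =
      Real.pi * ‖x‖ ^ 2 * (a + b)⁻¹ +
        Real.pi * (a⁻¹ + b⁻¹) * ‖y - (b / (a + b)) • x‖ ^ 2 := by
    intro y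
    rw [norm_sub_sq_real, norm_sub_sq_real, norm_smul, mul_pow, inner_smul_right,
      real_inner_comm y x, Real.norm_eq_abs, sq_abs]
    field_simp
    ring
  have hI := GaussianFourier.integral_rexp_neg_mul_sq_norm (V := Eu m) hc
  have hpos : 0 < (Real.pi / (Real.pi * (a⁻¹ + b⁻¹))) ^
      ((Module.finrank ℝ (Eu m) : ℝ) / 2) := by positivity
  have hL : ∫⁻ y : Eu m, ENNReal.ofReal (Real.exp (-(Real.pi * (a⁻¹ + b⁻¹)) * ‖y‖ ^ 2)) =
      ENNReal.ofReal ((a * b / (a + b)) ^ ((m : ℝ) / 2)) := by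
    rw [← ofReal_integral_eq_lintegral_ofReal, hI]
    · simp only [finrank_euclideanSpace, Fintype.card_fin]
      congr 2
      field_simp
      ring
    · by_contra hn
      rw [integral_undef hn] at hI
      linarith
    · exact Eventually.of_forall fun y => (Real.exp_pos _).le
  calc ∫⁻ y, heatKernel m a (x - y) * heatKernel m b y
      = ∫⁻ y, ENNReal.ofReal (a ^ (-(m : ℝ) / 2) * b ^ (-(m : ℝ) / 2) *
          Real.exp (-(Real.pi * ‖x‖ ^ 2 * (a + b)⁻¹))) *
          ENNReal.ofReal (Real.exp (-(Real.pi * (a⁻¹ + b⁻¹)) * ‖y - (b / (a + b)) • x‖ ^ 2)) := by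
        refine lintegral_congr fun y => ?_
        unfold heatKernel
        rw [← ENNReal.ofReal_mul (by positivity), ← ENNReal.ofReal_mul (by positivity)]
        congr 1
        rw [mul_mul_mul_comm, ← Real.exp_add, mul_assoc (_ * _), ← Real.exp_add]
        congr 2
        linarith [hsq y]
    _ = ENNReal.ofReal (a ^ (-(m : ℝ) / 2) * b ^ (-(m : ℝ) / 2) *
          Real.exp (-(Real.pi * ‖x‖ ^ 2 * (a + b)⁻¹))) *
          ENNReal.ofReal ((a * b / (a + b)) ^ ((m : ℝ) / 2)) := by
        rw [lintegral_const_mul _ (by fun_prop), ← hL]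
        congr 1
        exact lintegral_sub_right_eq_self (fun y : Eu m => ENNReal.ofReal
          (Real.exp (-(Real.pi * (a⁻¹ + b⁻¹)) * ‖y‖ ^ 2))) _
    _ = _ := by
        rw [← ENNReal.ofReal_mul (by positivity)]
        unfold heatKernel
        congr 1
        have e : a ^ (-(m : ℝ) / 2) * b ^ (-(m : ℝ) / 2) * (a * b / (a + b)) ^ ((m : ℝ) / 2) =
            (a + b) ^ (-(m : ℝ) / 2) := by
          rw [Real.div_rpow (by positivity) hab.le, Real.mul_rpow ha.le hb.le, neg_div,
            Real.rpow_neg ha.le, Real.rpow_neg hb.le, Real.rpow_neg hab.le]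
          have h1 : a ^ ((m : ℝ) / 2) ≠ 0 := by positivity
          have h2 : b ^ ((m : ℝ) / 2) ≠ 0 := by positivity
          field_simp
        rw [← e]
        ring

/-- Both factors are superpositions of heat kernels. Tonelli's theorem brings the `y`-integral
inside, the heat semigroup merges the times `a` and `b` into `c = a + b`, and
`lintegral_powPlus_conv` integrates over the ways of splitting `c`. -/
theorem lintegral_riesz_conv {m : ℕ} {α β : ℝ} (hα : 0 < α) (hβ : 0 < β) (x : Eu m) :
    ∫⁻ y, (∫⁻ a, powPlus α a * heatKernel m a (x - y)) * (∫⁻ b, powPlus β b * heatKernel m b y) =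
      ENNReal.ofReal (Real.Gamma α * Real.Gamma β / Real.Gamma (α + β)) *
        ∫⁻ c, powPlus (α + β) c * heatKernel m c x := by
  calc _ = ∫⁻ y : Eu m, ∫⁻ a, ∫⁻ b, powPlus α a * powPlus β b *
        (heatKernel m a (x - y) * heatKernel m b y) := by
        refine lintegral_congr fun y => ?_
        rw [← lintegral_mul_const _ (by fun_prop)]
        refine lintegral_congr fun a => ?_
        rw [← lintegral_const_mul _ (by fun_prop)]
        refine lintegral_congr fun b => ?_
        ring
    _ = ∫⁻ a, ∫⁻ y : Eu m, ∫⁻ b, powPlus α a * powPlus β b *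
        (heatKernel m a (x - y) * heatKernel m b y) := by
        refine lintegral_lintegral_swap (Measurable.aemeasurable ?_)
        refine Measurable.lintegral_prod_right' (f := fun p : (Eu m × ℝ) × ℝ =>
          powPlus α p.1.2 * powPlus β p.2 * (heatKernel m p.1.2 (x - p.1.1) *
            heatKernel m p.2 p.1.1)) ?_
        fun_prop
    _ = ∫⁻ a, ∫⁻ b, powPlus α a * powPlus β b * heatKernel m (a + b) x := by
        refine lintegral_congr fun a => ?_
        rw [lintegral_lintegral_swap]
        · refine lintegral_congr fun b => ?_
          rw [lintegral_const_mul _ (by fun_prop)]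
          by_cases ha : 0 < a
          · by_cases hb : 0 < b
            · rw [lintegral_heatKernel_conv ha hb]
            · simp [powPlus, hb]
          · simp [powPlus, ha]
        · exact Measurable.aemeasurable (by fun_prop)
    _ = ∫⁻ a, ∫⁻ c, powPlus α a * powPlus β (c - a) * heatKernel m c x := by
        refine lintegral_congr fun a => ?_
        rw [← lintegral_sub_right_eq_self _ a]
        simp only [add_sub_cancel]
    _ = ∫⁻ c, ∫⁻ a, powPlus α a * powPlus β (c - a) * heatKernel m c x := by
        exact lintegral_lintegral_swap (Measurable.aemeasurable (by fun_prop))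
    _ = _ := by
        rw [← lintegral_const_mul _ (by fun_prop)]
        refine lintegral_congr fun c => ?_
        rw [lintegral_mul_const _ (by fun_prop),
          lintegral_powPlus_conv hα hβ, mul_assoc]

/-- The constant in the composition of the Riesz kernels `|x|^(1-m)` and `|x|^lam`. -/
def rieszConst (m : ℕ) (lam : ℝ) : ℝ :=
  Real.pi ^ ((m : ℝ) / 2) * √Real.pi *
    (Real.Gamma ((lam + m) / 2) * Real.Gamma (-(lam + 1) / 2)) /
    (Real.Gamma (((m : ℝ) - 1) / 2) * Real.Gamma (-lam / 2) * Real.Gamma ((lam + m + 1) / 2))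

/-- This is `lintegral_riesz_conv` with `α = 1/2` and `β = (lam+m)/2`. The two bounds on `lam` say
that `β > 0` and `α + β < m/2`, that is, convergence at the origin and at infinity. -/
theorem lintegral_riesz {m : ℕ} (hm : 2 ≤ m) {lam : ℝ} (h1 : -(m : ℝ) < lam) (h2 : lam < -1)
    {x : Eu m} (hx : x ≠ 0) :
    ∫⁻ y, ENNReal.ofReal (‖x - y‖ ^ (1 - m : ℝ) * ‖y‖ ^ lam) =
      ENNReal.ofReal (rieszConst m lam * ‖x‖ ^ (lam + 1)) := by
  have hm2 : (2 : ℝ) ≤ m := by exact_mod_cast hm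
  have hβ : 0 < (lam + m) / 2 := by linarith
  have hαβ : 1 / 2 + (lam + m) / 2 < m / 2 := by linarith
  have key := lintegral_riesz_conv (by norm_num : (0 : ℝ) < 1 / 2) hβ x
  rw [lintegral_powPlus_mul_heatKernel hαβ hx] at key
  set A := Real.Gamma (m / 2 - 1 / 2) * Real.pi ^ (1 / 2 - (m : ℝ) / 2) with hA
  set B := Real.Gamma (m / 2 - (lam + m) / 2) * Real.pi ^ ((lam + m) / 2 - (m : ℝ) / 2) with hB
  have hApos : 0 < A := mul_pos (Real.Gamma_pos_of_pos (by linarith)) (by positivity)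
  have hBpos : 0 < B := mul_pos (Real.Gamma_pos_of_pos (by linarith)) (by positivity)
  have hAB : ∫⁻ y, (∫⁻ a, powPlus (1 / 2) a * heatKernel m a (x - y)) *
      (∫⁻ b, powPlus ((lam + m) / 2) b * heatKernel m b y) =
      ENNReal.ofReal (A * B) * ∫⁻ y, ENNReal.ofReal (‖x - y‖ ^ (1 - m : ℝ) * ‖y‖ ^ lam) := by
    rw [← lintegral_const_mul _ (by fun_prop)]
    refine lintegral_congr_ae ?_
    have : Nonempty (Fin m) := ⟨⟨0, by omega⟩⟩
    filter_upwards [ae_ne_zero (by omega : 1 ≤ m), (by simp [ae_iff] : ∀ᵐ y : Eu m, y ≠ x)]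
      with y hy hyx
    have hxy : x - y ≠ 0 := sub_ne_zero.2 hyx.symm
    rw [lintegral_powPlus_mul_heatKernel (by linarith) hxy,
      lintegral_powPlus_mul_heatKernel (by linarith) hy, ← ENNReal.ofReal_mul (by positivity),
      ← ENNReal.ofReal_mul (by positivity)]
    congr 1
    rw [hA, hB, show 2 * (1 / 2 : ℝ) - m = 1 - m by ring, show 2 * ((lam + m) / 2) - m = lam by ring]
    ring
  rw [hAB] at key
  have hne : ENNReal.ofReal (A * B) ≠ 0 := by simpa using mul_pos hApos hBpos
  refine (ENNReal.mul_right_inj hne ENNReal.ofReal_ne_top).1 (key.trans ?_)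
  have g1 := Real.Gamma_pos_of_pos (show (0 : ℝ) < 1 / 2 by norm_num)
  have g2 := Real.Gamma_pos_of_pos hβ
  have g3 := Real.Gamma_pos_of_pos (add_pos (show (0 : ℝ) < 1 / 2 by norm_num) hβ)
  rw [← ENNReal.ofReal_mul (by positivity), ← ENNReal.ofReal_mul (by positivity)]
  congr 1
  have g4 := Real.Gamma_pos_of_pos (show (0 : ℝ) < ((m : ℝ) - 1) / 2 by linarith)
  have g5 := Real.Gamma_pos_of_pos (show (0 : ℝ) < -lam / 2 by linarith)
  rw [hA, hB, rieszConst, show (m : ℝ) / 2 - 1 / 2 = ((m : ℝ) - 1) / 2 by ring,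
    show (m : ℝ) / 2 - (lam + m) / 2 = -lam / 2 by ring,
    show 1 / 2 + (lam + m) / 2 = (lam + m + 1) / 2 by ring,
    show (m : ℝ) / 2 - (lam + m + 1) / 2 = -(lam + 1) / 2 by ring,
    show 2 * ((lam + m + 1) / 2) - (m : ℝ) = lam + 1 by ring, Real.Gamma_one_half_eq]
  rw [show 1 / 2 + (lam + m) / 2 = (lam + m + 1) / 2 by ring] at g3
  have hp : Real.pi ^ ((lam + m + 1) / 2 - (m : ℝ) / 2) =
      Real.pi ^ (1 / 2 - (m : ℝ) / 2) * Real.pi ^ ((lam + m) / 2 - (m : ℝ) / 2) *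
        Real.pi ^ ((m : ℝ) / 2) := by
    rw [← Real.rpow_add Real.pi_pos, ← Real.rpow_add Real.pi_pos]
    ring_nf
  rw [hp]
  generalize Real.Gamma (-(lam + 1) / 2) = c
  generalize Real.Gamma (-lam / 2) = d at g5 ⊢
  field_simp

theorem rieszConst_pos {m : ℕ} (hm : 2 ≤ m) {lam : ℝ} (h1 : -(m : ℝ) < lam) (h2 : lam < -1) :
    0 < rieszConst m lam := by
  have hm2 : (2 : ℝ) ≤ m := by exact_mod_cast hm
  have g1 := Real.Gamma_pos_of_pos (show (0 : ℝ) < (lam + m) / 2 by linarith)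
  have g2 := Real.Gamma_pos_of_pos (show (0 : ℝ) < -(lam + 1) / 2 by linarith)
  have g3 := Real.Gamma_pos_of_pos (show (0 : ℝ) < ((m : ℝ) - 1) / 2 by linarith)
  have g4 := Real.Gamma_pos_of_pos (show (0 : ℝ) < -lam / 2 by linarith)
  have g5 := Real.Gamma_pos_of_pos (show (0 : ℝ) < (lam + m + 1) / 2 by linarith)
  unfold rieszConst
  positivity

/-! ### Riesz potentials of Schwartz functions -/

theorem SchwartzMap.exists_abs_le_rpow {m : ℕ} (φ : 𝓢(Eu m, ℝ)) (s : ℝ) :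
    ∃ C, 0 ≤ C ∧ ∀ x, |φ x| ≤ C * (1 + ‖x‖) ^ (-s) := by
  obtain ⟨n, hn⟩ := exists_nat_ge s
  refine ⟨2 ^ n * (Finset.Iic (n, 0)).sup (schwartzSeminormFamily ℝ (Eu m) ℝ) φ, by positivity,
    fun x => ?_⟩
  have h := SchwartzMap.one_add_le_sup_seminorm_apply (𝕜 := ℝ) (m := (n, 0)) (k := n) (n := 0)
      le_rfl le_rfl φ x
  rw [norm_iteratedFDeriv_zero, Real.norm_eq_abs] at h
  have h1 : (1 : ℝ) ≤ 1 + ‖x‖ := by linarith [norm_nonneg x]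
  have hp : 0 < (1 + ‖x‖) ^ n := by positivity
  calc |φ x| = ((1 + ‖x‖) ^ n * |φ x|) * ((1 + ‖x‖) ^ n)⁻¹ := by field_simp
    _ ≤ _ := by
      refine mul_le_mul h ?_ (by positivity) (by positivity)
      rw [← Real.rpow_natCast, ← Real.rpow_neg (by positivity)]
      exact Real.rpow_le_rpow_of_exponent_le h1 (by linarith)

theorem SchwartzMap.powIntegrable {m : ℕ} (hm : 1 ≤ m) (φ : 𝓢(Eu m, ℝ)) (B : ℝ) :
    PowIntegrable (-(m : ℝ)) B φ := by
  obtain ⟨C, _, hC⟩ := φ.exists_abs_le_rpow (B + m)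
  have := powIntegrable_of_le hm φ.continuous.aestronglyMeasurable hC
  rwa [add_sub_cancel_right] at this

theorem SchwartzMap.powIntegrable_mul {m : ℕ} (hm : 1 ≤ m) (φ : 𝓢(Eu m, ℝ)) {f : Eu m → ℝ}
    (hf : AEStronglyMeasurable f) {C : ℝ} {k : ℕ} (h : ∀ x, |f x| ≤ C * (1 + ‖x‖) ^ k) (B : ℝ) :
    PowIntegrable (-(m : ℝ)) B fun x => φ x * f x := by
  obtain ⟨D, hD0, hD⟩ := φ.exists_abs_le_rpow (B + m + k)
  have : ∀ x, |φ x * f x| ≤ (D * C) * (1 + ‖x‖) ^ (-(B + m)) := by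
    intro x
    rw [abs_mul]
    calc |φ x| * |f x| ≤ (D * (1 + ‖x‖) ^ (-(B + m + k))) * (C * (1 + ‖x‖) ^ k) := by
          gcongr
          · exact hD x
          · exact h x
      _ = (D * C) * ((1 + ‖x‖) ^ (-(B + m + k)) * (1 + ‖x‖) ^ (k : ℝ)) := by
          rw [Real.rpow_natCast]; ring
      _ = _ := by
          rw [← Real.rpow_add (by positivity)]
          ring_nf
  have := powIntegrable_of_le hm (φ.continuous.aestronglyMeasurable.mul hf) this
  rwa [add_sub_cancel_right] at this

/-- Peetre's inequality: decay in `y + z` becomes decay in `z`, at the price of a power of `1 +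
|y|`. -/
theorem one_add_norm_add_rpow_le {m : ℕ} (y z : Eu m) {s : ℝ} (hs : 0 ≤ s) :
    (1 + ‖y + z‖) ^ (-s) ≤ (1 + ‖y‖) ^ s * (1 + ‖z‖) ^ (-s) := by
  have h1 : 1 + ‖z‖ ≤ (1 + ‖y‖) * (1 + ‖y + z‖) := by
    have : ‖z‖ ≤ ‖y‖ + ‖y + z‖ := by
      have := norm_sub_le (y + z) y
      rw [add_sub_cancel_left] at this
      linarith
    nlinarith [norm_nonneg y, norm_nonneg (y + z)]
  have h2 := Real.rpow_le_rpow (by positivity) h1 hs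
  rw [Real.mul_rpow (by positivity) (by positivity)] at h2
  rw [Real.rpow_neg (by positivity), Real.rpow_neg (by positivity)]
  have h3 : 0 < (1 + ‖z‖) ^ s := by positivity
  have h4 : 0 < (1 + ‖y + z‖) ^ s := by positivity
  field_simp
  rwa [mul_comm]

/-- The Riesz potential `y ↦ ∫ |z|^(1-m) ψ(y + z) dz`. -/
def rieszPot {m : ℕ} (ψ : Eu m → ℝ) (y : Eu m) : ℝ :=
  ∫ z, ‖z‖ ^ (1 - m : ℝ) * ψ (y + z)

theorem rieszPot_eq_integral_sub {m : ℕ} (ψ : Eu m → ℝ) (y : Eu m) :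
    rieszPot ψ y = ∫ x, ‖x - y‖ ^ (1 - m : ℝ) * ψ x := by
  rw [rieszPot, ← integral_sub_right_eq_self _ y]
  simp

theorem rieszPot_neg {m : ℕ} (ψ : Eu m → ℝ) (y : Eu m) :
    rieszPot ψ (-y) = rieszPot (fun x => ψ (-x)) y := by
  rw [rieszPot, ← integral_neg_eq_self]
  refine integral_congr_ae (Eventually.of_forall fun z => ?_)
  simp only [norm_neg, neg_add]

/-- The majorant for Riesz potentials of Schwartz functions. Any exponent of the weight below `-1`
would serve as well as `-2`. -/
theorem integrable_rieszKernel_weight {m : ℕ} (hm : 1 ≤ m) :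
    Integrable fun z : Eu m => ‖z‖ ^ (1 - m : ℝ) * (1 + ‖z‖) ^ (-2 : ℝ) := by
  refine integrable_norm_rpow_mul hm (C := 1) (s := 2)
    (Measurable.aestronglyMeasurable (by fun_prop)) (by linarith) (by linarith) fun x => ?_
  rw [abs_of_nonneg (by positivity), one_mul]

/-- A bound for the integrand of the Riesz potential, uniform for `y` in a ball. -/
theorem SchwartzMap.exists_rieszPot_bound {m : ℕ} (ψ : 𝓢(Eu m, ℝ)) (R : ℝ) :
    ∃ C, ∀ y : Eu m, ‖y‖ ≤ R → ∀ z,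
      ‖‖z‖ ^ (1 - m : ℝ) * ψ (y + z)‖ ≤ C * (‖z‖ ^ (1 - m : ℝ) * (1 + ‖z‖) ^ (-2 : ℝ)) := by
  obtain ⟨C, hC0, hC⟩ := ψ.exists_abs_le_rpow 2
  refine ⟨C * (1 + R) ^ (2 : ℝ), fun y hy z => ?_⟩
  have h1 := hC (y + z)
  have h2 := one_add_norm_add_rpow_le y z (s := 2) (by norm_num)
  have h3 : (1 + ‖y‖) ^ (2 : ℝ) ≤ (1 + R) ^ (2 : ℝ) :=
    Real.rpow_le_rpow (by positivity) (by linarith) (by norm_num)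
  rw [norm_mul, Real.norm_of_nonneg (by positivity), Real.norm_eq_abs]
  calc ‖z‖ ^ (1 - m : ℝ) * |ψ (y + z)|
      ≤ ‖z‖ ^ (1 - m : ℝ) * (C * ((1 + R) ^ (2 : ℝ) * (1 + ‖z‖) ^ (-2 : ℝ))) := by
        refine mul_le_mul_of_nonneg_left (h1.trans ?_) (by positivity)
        refine mul_le_mul_of_nonneg_left (h2.trans ?_) hC0
        exact mul_le_mul_of_nonneg_right h3 (by positivity)
    _ = _ := by ring

theorem SchwartzMap.aestronglyMeasurable_rieszKernel {m : ℕ} (ψ : 𝓢(Eu m, ℝ)) (y : Eu m) :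
    AEStronglyMeasurable fun z => ‖z‖ ^ (1 - m : ℝ) * ψ (y + z) := by
  have := ψ.continuous
  exact (Measurable.aestronglyMeasurable (by fun_prop)).mul
    (Continuous.aestronglyMeasurable (by fun_prop))

theorem SchwartzMap.integrable_rieszKernel {m : ℕ} (hm : 1 ≤ m) (ψ : 𝓢(Eu m, ℝ)) (y : Eu m) :
    Integrable fun z => ‖z‖ ^ (1 - m : ℝ) * ψ (y + z) := by
  obtain ⟨C, hC⟩ := ψ.exists_rieszPot_bound ‖y‖
  exact ((integrable_rieszKernel_weight hm).const_mul C).mono'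
    (ψ.aestronglyMeasurable_rieszKernel y) (Eventually.of_forall (hC y le_rfl))

theorem SchwartzMap.continuous_rieszPot {m : ℕ} (hm : 1 ≤ m) (ψ : 𝓢(Eu m, ℝ)) :
    Continuous (rieszPot ψ) := by
  refine continuous_iff_continuousAt.2 fun y₀ => ?_
  obtain ⟨C, hC⟩ := ψ.exists_rieszPot_bound (‖y₀‖ + 1)
  refine continuousAt_of_dominated (Eventually.of_forall ψ.aestronglyMeasurable_rieszKernel)
    ?_ ((integrable_rieszKernel_weight hm).const_mul C) (Eventually.of_forall fun z => ?_)
  · filter_upwards [Metric.ball_mem_nhds y₀ one_pos] with y hy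
    refine Eventually.of_forall (hC y ?_)
    have := norm_le_norm_add_norm_sub' y y₀
    rw [mem_ball_iff_norm] at hy
    linarith
  · have := ψ.continuous
    exact Continuous.continuousAt (by fun_prop)

theorem SchwartzMap.hasLineDerivAt {m : ℕ} (ψ : 𝓢(Eu m, ℝ)) (x v : Eu m) :
    HasLineDerivAt ℝ ψ ((∂_{v} ψ : 𝓢(Eu m, ℝ)) x) x v := by
  have h := (ψ.hasFDerivAt x).hasLineDerivAt v
  rwa [← SchwartzMap.lineDerivOp_apply_eq_fderiv] at h

/-- Differentiation under the integral sign: with the argument written as `ψ (y + z)`, the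
derivative falls on `ψ` and never on the singular kernel. -/
theorem SchwartzMap.hasLineDerivAt_rieszPot {m : ℕ} (hm : 1 ≤ m) (ψ : 𝓢(Eu m, ℝ)) (y v : Eu m) :
    HasLineDerivAt ℝ (rieszPot ψ) (rieszPot (∂_{v} ψ : 𝓢(Eu m, ℝ)) y) y v := by
  obtain ⟨C, hC⟩ := (∂_{v} ψ : 𝓢(Eu m, ℝ)).exists_rieszPot_bound (‖y‖ + ‖v‖)
  have h := hasDerivAt_integral_of_dominated_loc_of_deriv_le (μ := volume)
    (F := fun (t : ℝ) (z : Eu m) => ‖z‖ ^ (1 - m : ℝ) * ψ (y + t • v + z))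
    (F' := fun (t : ℝ) (z : Eu m) =>
      ‖z‖ ^ (1 - m : ℝ) * (∂_{v} ψ : 𝓢(Eu m, ℝ)) (y + t • v + z))
    (x₀ := 0) (s := Metric.ball 0 1) (Metric.ball_mem_nhds 0 one_pos)
    (Eventually.of_forall fun t => ψ.aestronglyMeasurable_rieszKernel _)
    (ψ.integrable_rieszKernel hm _)
    ((∂_{v} ψ : 𝓢(Eu m, ℝ)).aestronglyMeasurable_rieszKernel _)
    (Eventually.of_forall fun z t ht => hC (y + t • v) ?_ z)
    ((integrable_rieszKernel_weight hm).const_mul C)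
    (Eventually.of_forall fun z t _ => ?_)
  · have := h.2
    simp only [zero_smul, add_zero] at this
    exact this
  · rw [mem_ball_zero_iff] at ht
    calc ‖y + t • v‖ ≤ ‖y‖ + ‖t‖ * ‖v‖ := (norm_add_le _ _).trans (by rw [norm_smul])
      _ ≤ ‖y‖ + 1 * ‖v‖ := by gcongr
      _ = _ := by ring
  · refine HasDerivAt.const_mul _ ?_
    have h1 := ψ.hasLineDerivAt (y + t • v + z) v
    have h2 : HasDerivAt (fun t' : ℝ => t' - t) 1 t := (hasDerivAt_id t).sub_const t
    have h3 := HasDerivAt.comp_of_eq t h1 h2 (by simp)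
    simp only [mul_one] at h3
    refine h3.congr_of_eventuallyEq (Eventually.of_forall fun t' => ?_)
    simp only [Function.comp_apply, sub_smul]
    congr 1
    abel

/-- The integrals `∫ |x|^M |ψ(x)| |x - y|^(1-m) dx` are finite and bounded. -/
theorem SchwartzMap.exists_integral_rieszKernel_le {m : ℕ} (hm : 1 ≤ m) (ψ : 𝓢(Eu m, ℝ)) (M : ℕ) :
    ∃ B, ∀ y : Eu m, Integrable (fun x => ‖x - y‖ ^ (1 - m : ℝ) * (‖x‖ ^ M * |ψ x|)) ∧
      ∫ x, ‖x - y‖ ^ (1 - m : ℝ) * (‖x‖ ^ M * |ψ x|) ≤ B := by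
  have hm1 : (1 : ℝ) ≤ m := by exact_mod_cast hm
  have hψ := ψ.continuous
  have hfc : Continuous fun x : Eu m => ‖x‖ ^ M * |ψ x| := by fun_prop
  have hf : Integrable fun x : Eu m => ‖x‖ ^ M * |ψ x| := by
    have := (ψ.powIntegrable hm (M + 1) M ⟨by have := M.cast_nonneg (α := ℝ); linarith,
      by linarith⟩).norm
    refine this.congr (Eventually.of_forall fun x => ?_)
    simp
  obtain ⟨C, hC0, hC⟩ := ψ.exists_abs_le_rpow M
  have hfC : ∀ x : Eu m, ‖x‖ ^ M * |ψ x| ≤ C := by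
    intro x
    have h1 : ‖x‖ ^ M ≤ (1 + ‖x‖) ^ M := by gcongr; linarith
    calc ‖x‖ ^ M * |ψ x| ≤ (1 + ‖x‖) ^ M * (C * (1 + ‖x‖) ^ (-M : ℝ)) := by
          gcongr; exact hC x
      _ = C := by
          rw [Real.rpow_neg (by positivity), Real.rpow_natCast]
          field_simp
  have hw := integrable_rieszKernel_weight hm
  refine ⟨(∫ x, ‖x‖ ^ M * |ψ x|) +
    ∫ z : Eu m, (C * 4) * (‖z‖ ^ (1 - m : ℝ) * (1 + ‖z‖) ^ (-2 : ℝ)), fun y => ?_⟩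
  -- For `|x - y| ≥ 1` the kernel is at most `1`; for `|x - y| ≤ 1` the weight `4 (1 + |x -
  -- y|)^(-2)` is at least `1`.
  have hb : ∀ x : Eu m, ‖‖x - y‖ ^ (1 - m : ℝ) * (‖x‖ ^ M * |ψ x|)‖ ≤ ‖x‖ ^ M * |ψ x| +
      (C * 4) * (‖x - y‖ ^ (1 - m : ℝ) * (1 + ‖x - y‖) ^ (-2 : ℝ)) := by
    intro x
    have h0 : 0 ≤ ‖x‖ ^ M * |ψ x| := by positivity
    have h3 : 0 ≤ ‖x - y‖ ^ (1 - m : ℝ) := by positivity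
    rw [Real.norm_of_nonneg (by positivity)]
    rcases le_total 1 ‖x - y‖ with h | h
    · have h1 : ‖x - y‖ ^ (1 - m : ℝ) ≤ 1 :=
        Real.rpow_le_one_of_one_le_of_nonpos h (by linarith)
      have h2 : 0 ≤ (C * 4) * (‖x - y‖ ^ (1 - m : ℝ) * (1 + ‖x - y‖) ^ (-2 : ℝ)) := by positivity
      have := mul_le_mul_of_nonneg_right h1 h0
      linarith
    · have h1 : 1 ≤ 4 * (1 + ‖x - y‖) ^ (-2 : ℝ) := by
        rw [Real.rpow_neg (by positivity), ← div_eq_mul_inv, le_div_iff₀ (by positivity)]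
        norm_num
        nlinarith [norm_nonneg (x - y)]
      calc ‖x - y‖ ^ (1 - m : ℝ) * (‖x‖ ^ M * |ψ x|)
          ≤ ‖x - y‖ ^ (1 - m : ℝ) * (C * (4 * (1 + ‖x - y‖) ^ (-2 : ℝ))) := by
            refine mul_le_mul_of_nonneg_left ((hfC x).trans ?_) h3
            exact le_mul_of_one_le_right hC0 h1
        _ = (C * 4) * (‖x - y‖ ^ (1 - m : ℝ) * (1 + ‖x - y‖) ^ (-2 : ℝ)) := by ring
        _ ≤ _ := by linarith
  have hi := hf.add ((hw.comp_sub_right y).const_mul (C * 4))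
  have hint : Integrable (fun x => ‖x - y‖ ^ (1 - m : ℝ) * (‖x‖ ^ M * |ψ x|)) :=
    hi.mono' ((Measurable.aestronglyMeasurable (by fun_prop)).mul hfc.aestronglyMeasurable)
      (Eventually.of_forall hb)
  refine ⟨hint, ?_⟩
  have h1 := integral_mono hint hi (fun x => (le_abs_self _).trans (hb x))
  refine h1.trans (le_of_eq ?_)
  rw [integral_add' hf ((hw.comp_sub_right y).const_mul (C * 4))]
  congr 1
  exact integral_sub_right_eq_self
    (fun z : Eu m => (C * 4) * (‖z‖ ^ (1 - m : ℝ) * (1 + ‖z‖) ^ (-2 : ℝ))) y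

/-! ### Moments and the decay of Riesz potentials -/

/-- The Taylor expansion of `(1 + q)^μ` at `q = a + b`, where `|a| ≤ t²` and `|b| ≤ 2t`, truncated
at order `N` in `t`. -/
theorem exists_taylor_rpow (μ : ℝ) (N : ℕ) : ∃ (d : ℕ → ℕ → ℝ) (δ C : ℝ), 0 < δ ∧ 0 ≤ C ∧
    ∀ t a b : ℝ, 0 ≤ t → |a| ≤ t ^ 2 → |b| ≤ 2 * t →
      (t ≤ δ → |(1 + (a + b)) ^ μ - ∑ l ∈ Finset.range N, ∑ i ∈ Finset.range (l + 1),
        if l + i < N then d l i * (a ^ i * b ^ (l - i)) else 0| ≤ C * t ^ N) ∧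
      (δ ≤ t → |∑ l ∈ Finset.range N, ∑ i ∈ Finset.range (l + 1),
        if l + i < N then d l i * (a ^ i * b ^ (l - i)) else 0| ≤ C * t ^ N) := by
  obtain ⟨c, ε, C₀, hε, hC₀, hT⟩ : ∃ (c : ℕ → ℝ) (ε C₀ : ℝ), 0 < ε ∧ 0 ≤ C₀ ∧ ∀ q : ℝ, |q| ≤ ε →
      |(1 + q) ^ μ - ∑ l ∈ Finset.range N, c l * q ^ l| ≤ C₀ * |q| ^ N := by
    have h := (Real.one_add_rpow_hasFPowerSeriesAt_zero (a := μ)).isBigO_sub_partialSum_pow N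
    obtain ⟨C₀, hC₀, h⟩ := h.exists_nonneg
    rw [Asymptotics.isBigOWith_iff] at h
    obtain ⟨ε, hε, h⟩ := Metric.eventually_nhds_iff.1 h
    refine ⟨fun l => (binomialSeries ℝ μ).coeff l, ε / 2, C₀, by positivity, hC₀, fun q hq => ?_⟩
    have := @h q (by rw [Real.dist_eq, sub_zero]; linarith)
    simp only [zero_add, FormalMultilinearSeries.partialSum, Real.norm_eq_abs, abs_pow,
      abs_abs] at this
    refine le_trans (le_of_eq ?_) this
    congr 2
    refine Finset.sum_congr rfl fun l _ => ?_
    rw [FormalMultilinearSeries.apply_eq_pow_smul_coeff, smul_eq_mul, mul_comm]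
  -- The coefficient of `a^i b^(l-i)` in `c l (a + b)^l`. As `a = O(t²)` and `b = O(t)`, this
  -- monomial has order `l + i` in `t`, which explains the cut at `l + i < N`.
  let d : ℕ → ℕ → ℝ := fun l i => c l * (l.choose i)
  let T : ℝ → ℝ → ℕ → ℕ → ℝ := fun a b l i => d l i * (a ^ i * b ^ (l - i))
  set K := ∑ l ∈ Finset.range N, ∑ i ∈ Finset.range (l + 1), |d l i| * 2 ^ (l - i) with hK
  have hK0 : 0 ≤ K := by positivity
  -- Chosen so that `t ≤ δ` gives `|a + b| ≤ t² + 2t ≤ 3t ≤ ε`.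
  set δ := min 1 (ε / 3) with hδ
  have hδ0 : 0 < δ := lt_min one_pos (by positivity)
  have hδ1 : δ ≤ 1 := min_le_left _ _
  have hTb : ∀ t a b : ℝ, 0 ≤ t → |a| ≤ t ^ 2 → |b| ≤ 2 * t → ∀ l, ∀ i ∈ Finset.range (l + 1),
      |T a b l i| ≤ |d l i| * 2 ^ (l - i) * t ^ (l + i) := by
    intro t a b ht ha hb l i hi
    have hil : i ≤ l := Nat.lt_succ_iff.1 (Finset.mem_range.1 hi)
    simp only [T, abs_mul, abs_pow]
    calc |d l i| * (|a| ^ i * |b| ^ (l - i)) ≤ |d l i| * ((t ^ 2) ^ i * (2 * t) ^ (l - i)) := by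
          gcongr
      _ = |d l i| * 2 ^ (l - i) * t ^ (2 * i + (l - i)) := by
          rw [mul_pow, ← pow_mul, pow_add]; ring
      _ = _ := by
          congr 2
          omega
  refine ⟨d, δ, C₀ * 3 ^ N + K + K * (δ⁻¹) ^ N, hδ0, by positivity, fun t a b ht ha hb =>
    ⟨fun htδ => ?_, fun htδ => ?_⟩⟩
  · have ht1 : t ≤ 1 := htδ.trans hδ1
    have hq : |a + b| ≤ 3 * t := by
      have := abs_add_le a b
      nlinarith
    have hqε : |a + b| ≤ ε := by
      have : t ≤ ε / 3 := htδ.trans (min_le_right _ _)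
      linarith
    have h1 := hT (a + b) hqε
    have hexp : ∑ l ∈ Finset.range N, c l * (a + b) ^ l =
        ∑ l ∈ Finset.range N, ∑ i ∈ Finset.range (l + 1), T a b l i := by
      refine Finset.sum_congr rfl fun l _ => ?_
      rw [add_pow, Finset.mul_sum]
      refine Finset.sum_congr rfl fun i _ => ?_
      simp only [T, d]
      ring
    rw [hexp] at h1
    have h2 : |(∑ l ∈ Finset.range N, ∑ i ∈ Finset.range (l + 1), T a b l i) -
        ∑ l ∈ Finset.range N, ∑ i ∈ Finset.range (l + 1),
          if l + i < N then T a b l i else 0| ≤ K * t ^ N := by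
      rw [← Finset.sum_sub_distrib, hK, Finset.sum_mul]
      refine (Finset.abs_sum_le_sum_abs _ _).trans (Finset.sum_le_sum fun l _ => ?_)
      rw [← Finset.sum_sub_distrib, Finset.sum_mul]
      refine (Finset.abs_sum_le_sum_abs _ _).trans (Finset.sum_le_sum fun i hi => ?_)
      split_ifs with h
      · simp only [sub_self, abs_zero]
        positivity
      · rw [sub_zero]
        refine (hTb t a b ht ha hb l i hi).trans ?_
        exact mul_le_mul_of_nonneg_left (pow_le_pow_of_le_one ht ht1 (not_lt.1 h)) (by positivity)
    have h3 : C₀ * |a + b| ^ N ≤ C₀ * 3 ^ N * t ^ N := by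
      rw [mul_assoc, ← mul_pow]
      gcongr
    have h4 : 0 ≤ K * (δ⁻¹) ^ N * t ^ N := by positivity
    have h5 := abs_sub_le ((1 + (a + b)) ^ μ)
      (∑ l ∈ Finset.range N, ∑ i ∈ Finset.range (l + 1), T a b l i)
      (∑ l ∈ Finset.range N, ∑ i ∈ Finset.range (l + 1), if l + i < N then T a b l i else 0)
    simp only [T] at h5 h2 h1
    linarith
  -- For `t ≥ δ` there is no expansion to compare with: each retained monomial has order below `N`,
  -- hence is at most a constant times `(t/δ)^N`.
  · have h0 : 0 ≤ C₀ * 3 ^ N * t ^ N := by positivity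
    have h0' : 0 ≤ K * t ^ N := by positivity
    have h2 : |∑ l ∈ Finset.range N, ∑ i ∈ Finset.range (l + 1),
        if l + i < N then T a b l i else 0| ≤ K * ((δ⁻¹) ^ N * t ^ N) := by
      rw [hK, Finset.sum_mul]
      refine (Finset.abs_sum_le_sum_abs _ _).trans (Finset.sum_le_sum fun l _ => ?_)
      rw [Finset.sum_mul]
      refine (Finset.abs_sum_le_sum_abs _ _).trans (Finset.sum_le_sum fun i hi => ?_)
      split_ifs with h
      · refine (hTb t a b ht ha hb l i hi).trans ?_
        refine mul_le_mul_of_nonneg_left ?_ (by positivity)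
        have h1 : 1 ≤ δ⁻¹ * t := by rw [inv_mul_eq_div, le_div_iff₀ hδ0]; linarith
        have h3 : 1 ≤ δ⁻¹ := (one_le_inv₀ hδ0).2 hδ1
        calc t ^ (l + i) ≤ (δ⁻¹ * t) ^ (l + i) := by
              refine pow_le_pow_left₀ ht ?_ _
              exact le_mul_of_one_le_left ht h3
          _ ≤ (δ⁻¹ * t) ^ N := pow_le_pow_right₀ h1 h.le
          _ = _ := mul_pow _ _ _
      · simp only [abs_zero]
        positivity
    simp only [T] at h2
    linarith

/-- The moments of `ψ` of order less than `N`, in the form needed for radial expansions. -/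
def VanishingMoments {m : ℕ} (N : ℕ) (ψ : Eu m → ℝ) : Prop :=
  ∀ i l : ℕ, 2 * i + l < N → ∀ y : Eu m, ∫ x, ψ x * (‖x‖ ^ (2 * i) * inner ℝ x y ^ l) = 0

theorem SchwartzMap.integrable_mul_norm_pow_mul_inner_pow {m : ℕ} (hm : 1 ≤ m) (ψ : 𝓢(Eu m, ℝ))
    (i l : ℕ) (y : Eu m) : Integrable fun x => ψ x * (‖x‖ ^ i * inner ℝ x y ^ l) := by
  have h := ψ.powIntegrable_mul hm (f := fun x : Eu m => ‖x‖ ^ i * inner ℝ x y ^ l)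
    (C := ‖y‖ ^ l) (k := i + l) (Continuous.aestronglyMeasurable (by fun_prop)) (fun x => ?_) 1 0
    ⟨by simpa using (show 0 < m by omega), one_pos⟩
  · simpa using h
  · have h1 : |inner ℝ x y| ≤ ‖x‖ * ‖y‖ := abs_real_inner_le_norm x y
    rw [abs_mul, abs_pow, abs_pow, abs_norm]
    calc ‖x‖ ^ i * |inner ℝ x y| ^ l ≤ (1 + ‖x‖) ^ i * ((1 + ‖x‖) * ‖y‖) ^ l := by
          have h2 : ‖x‖ ≤ 1 + ‖x‖ := by linarith
          gcongr
          exact h1.trans (by gcongr)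
      _ = _ := by rw [mul_pow, pow_add]; ring

theorem exists_abs_le_one_add_rpow {m : ℕ} {f : Eu m → ℝ} {s B E : ℝ} (hs : 0 ≤ s)
    (hB : 0 ≤ B) (hE : 0 ≤ E) (h1 : ∀ y, |f y| ≤ B)
    (h2 : ∀ y, 1 ≤ ‖y‖ → |f y| ≤ E * ‖y‖ ^ (-s)) :
    ∃ C, ∀ y, |f y| ≤ C * (1 + ‖y‖) ^ (-s) := by
  refine ⟨(B + E) * 2 ^ s, fun y => ?_⟩
  have h1y : 0 < 1 + ‖y‖ := by positivity
  have hp : 0 < (1 + ‖y‖) ^ (-s) := by positivity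
  rw [mul_assoc]
  rcases le_total 1 ‖y‖ with h | h
  · have h3 : ‖y‖ ^ (-s) ≤ 2 ^ s * (1 + ‖y‖) ^ (-s) := by
      have hy0 : 0 < ‖y‖ := by linarith
      rw [Real.rpow_neg hy0.le, Real.rpow_neg h1y.le, ← div_eq_mul_inv, inv_eq_one_div,
        div_le_div_iff₀ (by positivity) (by positivity), one_mul, ← Real.mul_rpow (by norm_num)
        hy0.le]
      exact Real.rpow_le_rpow h1y.le (by linarith) hs
    calc |f y| ≤ E * ‖y‖ ^ (-s) := h2 y h
      _ ≤ E * (2 ^ s * (1 + ‖y‖) ^ (-s)) := mul_le_mul_of_nonneg_left h3 hE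
      _ ≤ (B + E) * (2 ^ s * (1 + ‖y‖) ^ (-s)) :=
          mul_le_mul_of_nonneg_right (by linarith) (by positivity)
  · have h3 : 1 ≤ 2 ^ s * (1 + ‖y‖) ^ (-s) := by
      rw [Real.rpow_neg h1y.le, ← div_eq_mul_inv, le_div_iff₀ (by positivity), one_mul]
      exact Real.rpow_le_rpow h1y.le (by linarith) hs
    calc |f y| ≤ B := h1 y
      _ ≤ B + E := by linarith
      _ ≤ (B + E) * (2 ^ s * (1 + ‖y‖) ^ (-s)) := le_mul_of_one_le_right (by positivity) h3

/-- Multipole expansion. With `ρ = |y|`, the kernel `|x - y|^(1-m)` is `ρ^(1-m)` times `(1 + a +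
b)^((1-m)/2)`, where `a = |x|²/ρ²` and `b = -2⟨x, y⟩/ρ²`. The Taylor terms of order below `N` in
`|x|/ρ` are moments of `ψ` and integrate to zero; the remainder gains `ρ^(-N)`. -/
theorem SchwartzMap.exists_abs_rieszPot_le {m : ℕ} (hm : 1 ≤ m) (ψ : 𝓢(Eu m, ℝ)) {N : ℕ}
    (hψ : VanishingMoments N ψ) :
    ∃ C, ∀ y, |rieszPot ψ y| ≤ C * (1 + ‖y‖) ^ (-((m : ℝ) - 1 + N)) := by
  have hm1 : (1 : ℝ) ≤ m := by exact_mod_cast hm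
  have hN0 : (0 : ℝ) ≤ N := N.cast_nonneg
  obtain ⟨d, δ, C, hδ, hC, hT⟩ := exists_taylor_rpow ((1 - m) / 2) N
  obtain ⟨B, hB⟩ := ψ.exists_integral_rieszKernel_le hm 0
  obtain ⟨B', hB'⟩ := ψ.exists_integral_rieszKernel_le hm (N + (m - 1))
  simp only [pow_zero, one_mul] at hB
  have hψc := ψ.continuous
  have hB0 : 0 ≤ B := (integral_nonneg fun x => by positivity).trans (hB 0).2
  have hB'0 : 0 ≤ B' := (integral_nonneg fun x => by positivity).trans (hB' 0).2
  have hJi : Integrable fun x : Eu m => ‖x‖ ^ N * |ψ x| := by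
    have := (ψ.integrable_mul_norm_pow_mul_inner_pow hm N 0 0).norm
    refine this.congr (Eventually.of_forall fun x => ?_)
    simp [mul_comm]
  set J := ∫ x, ‖x‖ ^ N * |ψ x| with hJ
  have hJ0 : 0 ≤ J := integral_nonneg fun x => by positivity
  set s : ℝ := (m : ℝ) - 1 + N with hs
  have hs0 : 0 ≤ s := by linarith
  set D : ℝ := (δ⁻¹) ^ (N + (m - 1)) with hD
  have hbound : ∀ y : Eu m, |rieszPot ψ y| ≤ B := by
    intro y
    rw [rieszPot_eq_integral_sub]
    refine (abs_integral_le_integral_abs.trans (le_of_eq ?_)).trans (hB y).2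
    refine integral_congr_ae (Eventually.of_forall fun x => ?_)
    simp only [abs_mul]
    rw [abs_of_nonneg (a := ‖x - y‖ ^ (1 - m : ℝ)) (by positivity)]
  have hlarge : ∀ y : Eu m, 1 ≤ ‖y‖ → |rieszPot ψ y| ≤ (C * J + D * B') * ‖y‖ ^ (-s) := by
    intro y hy
    have hρ : 0 < ‖y‖ := by linarith
    set ρ := ‖y‖ with hρdef
    let a : Eu m → ℝ := fun x => ‖x‖ ^ 2 / ρ ^ 2
    let b : Eu m → ℝ := fun x => -2 * inner ℝ x y / ρ ^ 2
    let P : Eu m → ℝ := fun x => ∑ l ∈ Finset.range N, ∑ i ∈ Finset.range (l + 1),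
        if l + i < N then d l i * (a x ^ i * b x ^ (l - i)) else 0
    have hab : ∀ x, 1 + (a x + b x) = (‖x - y‖ / ρ) ^ 2 := by
      intro x
      rw [div_pow, norm_sub_sq_real]
      simp only [a, b]
      field_simp
      ring
    have hker : ∀ x, (1 + (a x + b x)) ^ ((1 - m : ℝ) / 2) =
        ρ ^ (m - 1 : ℝ) * ‖x - y‖ ^ (1 - m : ℝ) := by
      intro x
      rw [hab, ← Real.rpow_natCast, ← Real.rpow_mul (by positivity),
        Real.div_rpow (by positivity) hρ.le, div_eq_mul_inv, ← Real.rpow_neg hρ.le]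
      push_cast
      rw [show (2 : ℝ) * ((1 - m) / 2) = 1 - m by ring, show -(1 - m : ℝ) = m - 1 by ring, mul_comm]
    have hterm : ∀ (l i : ℕ) x, ψ x * (d l i * (a x ^ i * b x ^ (l - i))) =
        (d l i * ((ρ ^ 2)⁻¹ ^ i * (-2 / ρ ^ 2) ^ (l - i))) *
          (ψ x * (‖x‖ ^ (2 * i) * inner ℝ x y ^ (l - i))) := by
      intro l i x
      simp only [a, b]
      rw [div_eq_mul_inv, mul_pow, show -2 * inner ℝ x y / ρ ^ 2 = (-2 / ρ ^ 2) * inner ℝ x y by ring,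
        mul_pow, ← pow_mul]
      ring
    have hPi : Integrable fun x => ψ x * P x := by
      simp only [P, Finset.mul_sum]
      refine integrable_finsetSum _ fun l _ => integrable_finsetSum _ fun i _ => ?_
      split_ifs with h
      · simp only [hterm]
        exact (ψ.integrable_mul_norm_pow_mul_inner_pow hm _ _ _).const_mul _
      · simp
    have hP0 : ∫ x, ψ x * P x = 0 := by
      simp only [P, Finset.mul_sum]
      have hi : ∀ l i : ℕ, Integrable fun x => ψ x *
          (if l + i < N then d l i * (a x ^ i * b x ^ (l - i)) else 0) := by
        intro l i
        split_ifs with h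
        · simp only [hterm]
          exact (ψ.integrable_mul_norm_pow_mul_inner_pow hm _ _ _).const_mul _
        · simp
      rw [integral_finsetSum _ fun l _ => integrable_finsetSum _ fun i _ => hi l i]
      refine Finset.sum_eq_zero fun l _ => ?_
      rw [integral_finsetSum _ fun i _ => hi l i]
      refine Finset.sum_eq_zero fun i hil => ?_
      have hil : i ≤ l := Nat.lt_succ_iff.1 (Finset.mem_range.1 hil)
      split_ifs with h
      · simp only [hterm]
        rw [integral_const_mul, hψ i (l - i) (by omega) y, mul_zero]
      · simp
    have hKi : Integrable fun x => ‖x - y‖ ^ (1 - m : ℝ) * ψ x := by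
      refine (hB y).1.mono' ((Measurable.aestronglyMeasurable (by fun_prop)).mul
        hψc.aestronglyMeasurable) (Eventually.of_forall fun x => ?_)
      rw [norm_mul, Real.norm_of_nonneg (by positivity), Real.norm_eq_abs]
    have hpos : 0 < ρ ^ (m - 1 : ℝ) := by positivity
    have heq : ρ ^ (m - 1 : ℝ) * rieszPot ψ y =
        ∫ x, ψ x * ((1 + (a x + b x)) ^ ((1 - m : ℝ) / 2) - P x) := by
      rw [rieszPot_eq_integral_sub, ← integral_const_mul]
      rw [← sub_zero (∫ x, ρ ^ (m - 1 : ℝ) * _), ← hP0, ← integral_sub (hKi.const_mul _) hPi]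
      refine integral_congr_ae (Eventually.of_forall fun x => ?_)
      simp only [hker]
      ring
    have hdiff : ∀ x, ‖ψ x * ((1 + (a x + b x)) ^ ((1 - m : ℝ) / 2) - P x)‖ ≤
        ρ ^ (-N : ℝ) * (C * (‖x‖ ^ N * |ψ x|) +
          D * (‖x - y‖ ^ (1 - m : ℝ) * (‖x‖ ^ (N + (m - 1)) * |ψ x|))) := by
      intro x
      have ht : 0 ≤ ‖x‖ / ρ := by positivity
      have ha : |a x| ≤ (‖x‖ / ρ) ^ 2 := by
        rw [abs_of_nonneg (by positivity), div_pow]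
      have hb : |b x| ≤ 2 * (‖x‖ / ρ) := by
        have h1 : |inner ℝ x y| ≤ ‖x‖ * ρ := abs_real_inner_le_norm x y
        simp only [b]
        rw [abs_div, abs_mul, abs_neg, abs_two, abs_of_pos (by positivity : 0 < ρ ^ 2),
          div_le_iff₀ (by positivity)]
        calc 2 * |inner ℝ x y| ≤ 2 * (‖x‖ * ρ) := by gcongr
          _ = _ := by field_simp
      obtain ⟨h1, h2⟩ := hT (‖x‖ / ρ) (a x) (b x) ht ha hb
      have hN : C * (‖x‖ / ρ) ^ N = ρ ^ (-N : ℝ) * (C * ‖x‖ ^ N) := by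
        rw [div_pow, Real.rpow_neg hρ.le, Real.rpow_natCast]
        ring
      have hk0 : 0 ≤ ‖x - y‖ ^ (1 - m : ℝ) := by positivity
      -- For `|x| ≤ δρ` this is the Taylor remainder. For `|x| ≥ δρ` the kernel and the polynomial
      -- are bounded separately: there `ρ ≤ |x|/δ`, so the missing powers of `ρ` are bought with
      -- powers of `|x|`, which `ψ` absorbs.
      have hmain : |(1 + (a x + b x)) ^ ((1 - m : ℝ) / 2) - P x| ≤
          ρ ^ (-N : ℝ) * (C * ‖x‖ ^ N + D * (‖x - y‖ ^ (1 - m : ℝ) * ‖x‖ ^ (N + (m - 1)))) := by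
        rcases le_total (‖x‖ / ρ) δ with h | h
        · refine (h1 h).trans ?_
          rw [hN]
          refine mul_le_mul_of_nonneg_left ?_ (by positivity)
          have : 0 ≤ D * (‖x - y‖ ^ (1 - m : ℝ) * ‖x‖ ^ (N + (m - 1))) := by positivity
          linarith
        · have h3 := h2 h
          rw [hN] at h3
          have h4 : ρ ^ (m - 1 : ℝ) ≤ ρ ^ (-N : ℝ) * (D * ‖x‖ ^ (N + (m - 1))) := by
            have h5 : ρ ≤ δ⁻¹ * ‖x‖ := by
              rw [le_div_iff₀ hρ] at h
              rw [inv_mul_eq_div, le_div_iff₀ hδ]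
              linarith
            have h6 : ρ ^ (m - 1 : ℝ) = ρ ^ (-N : ℝ) * ρ ^ (N + (m - 1)) := by
              rw [← Real.rpow_natCast ρ (N + (m - 1)), ← Real.rpow_add hρ]
              push_cast [Nat.cast_sub hm]
              ring_nf
            rw [h6, hD, ← mul_pow]
            gcongr
          have h7 := mul_le_mul_of_nonneg_right h4 hk0
          refine (abs_sub _ _).trans ?_
          rw [hker, abs_of_nonneg (a := ρ ^ (m - 1 : ℝ) * ‖x - y‖ ^ (1 - m : ℝ)) (by positivity)]
          calc _ ≤ _ := add_le_add h7 h3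
            _ = _ := by ring
      rw [norm_mul, Real.norm_eq_abs, Real.norm_eq_abs]
      calc |ψ x| * _ ≤ |ψ x| * _ := mul_le_mul_of_nonneg_left hmain (abs_nonneg _)
        _ = _ := by ring
    have hnorm := norm_integral_le_of_norm_le
      (((hJi.const_mul C).add ((hB' y).1.const_mul D)).const_mul (ρ ^ (-N : ℝ)))
      (Eventually.of_forall hdiff)
    rw [← heq, integral_const_mul, integral_add' (hJi.const_mul C) ((hB' y).1.const_mul D),
      integral_const_mul, integral_const_mul, Real.norm_eq_abs, abs_mul, abs_of_pos hpos] at hnorm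
    have hfin : ρ ^ (m - 1 : ℝ) * |rieszPot ψ y| ≤ ρ ^ (-N : ℝ) * (C * J + D * B') := by
      refine hnorm.trans ?_
      have hD0 : 0 ≤ D := by positivity
      gcongr
      exact (hB' y).2
    have hsplit : ρ ^ (-s) = ρ ^ (-N : ℝ) * (ρ ^ (m - 1 : ℝ))⁻¹ := by
      rw [← Real.rpow_neg hρ.le, ← Real.rpow_add hρ, hs]
      ring_nf
    rw [hsplit]
    calc |rieszPot ψ y| = (ρ ^ (m - 1 : ℝ) * |rieszPot ψ y|) * (ρ ^ (m - 1 : ℝ))⁻¹ := by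
          field_simp
      _ ≤ (ρ ^ (-N : ℝ) * (C * J + D * B')) * (ρ ^ (m - 1 : ℝ))⁻¹ := by gcongr
      _ = _ := by ring
  have hE0 : 0 ≤ C * J + D * B' := by positivity
  exact exists_abs_le_one_add_rpow hs0 hB0 hE0 hbound hlarge

/-- Each further order of vanishing moments widens the strip of convergence of the radial Mellin
transform by one. This is what permits continuation beyond `σ = -1`. -/
theorem SchwartzMap.powIntegrable_rieszPot {m : ℕ} (hm : 1 ≤ m) (ψ : 𝓢(Eu m, ℝ)) {N : ℕ}
    (hψ : VanishingMoments N ψ) : PowIntegrable (-(m : ℝ)) (N - 1) (rieszPot ψ) := by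
  obtain ⟨C, hC⟩ := ψ.exists_abs_rieszPot_le hm hψ
  have := powIntegrable_of_le hm (ψ.continuous_rieszPot hm).aestronglyMeasurable hC
  rwa [show (m : ℝ) - 1 + N - m = N - 1 by ring] at this

/-! ### Orthogonality to polynomials, and its gain under differentiation -/

theorem AnnihilatesPoly.integral_eq_zero {m : ℕ} {d : ℤ} {φ : 𝓢(Eu m, ℝ)}
    (h : AnnihilatesPoly d φ) (i l : ℕ) (hd : 2 * (i : ℤ) + l ≤ d) (y : Eu m) :
    ∫ x, φ x * (‖x‖ ^ (2 * i) * inner ℝ x y ^ l) = 0 := by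
  let L : Eu m → MvPolynomial (Fin m) ℝ := fun w =>
    ∑ j, MvPolynomial.C (w j) * MvPolynomial.X j
  have hL : ∀ w, (L w).totalDegree ≤ 1 := fun w =>
    MvPolynomial.totalDegree_finsetSum_le fun j _ =>
      (MvPolynomial.totalDegree_mul _ _).trans (by simp)
  let Q : MvPolynomial (Fin m) ℝ := ∑ j, MvPolynomial.X j ^ 2
  have hQ : Q.totalDegree ≤ 2 := MvPolynomial.totalDegree_finsetSum_le fun j _ => by simp
  have hLe : ∀ w x : Eu m, MvPolynomial.eval (fun i => x i) (L w) = inner ℝ x w := by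
    intro w x
    simp [L, PiLp.inner_apply, mul_comm]
  have hQe : ∀ x : Eu m, MvPolynomial.eval (fun i => x i) Q = ‖x‖ ^ 2 := by
    intro x
    simp [Q, EuclideanSpace.norm_sq_eq]
  have hdeg : (Q ^ i * L y ^ l).totalDegree ≤ 2 * i + l := by
    refine (MvPolynomial.totalDegree_mul _ _).trans (add_le_add ?_ ?_)
    · refine (MvPolynomial.totalDegree_pow _ _).trans ?_
      rw [mul_comm]
      exact Nat.mul_le_mul_right _ hQ
    · refine (MvPolynomial.totalDegree_pow _ _).trans ?_
      simpa using Nat.mul_le_mul_left l (hL y)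
  have := h (Q ^ i * L y ^ l) (le_trans (by exact_mod_cast hdeg) hd)
  simpa [hLe, hQe, ← pow_mul] using this

theorem AnnihilatesPoly.vanishingMoments {m : ℕ} {d : ℤ} {φ : 𝓢(Eu m, ℝ)}
    (h : AnnihilatesPoly d φ) {N : ℕ} (hN : (N : ℤ) ≤ d + 1) : VanishingMoments N φ := by
  intro i l hil y
  exact h.integral_eq_zero i l (by omega) y

theorem annihilatesPoly_of_neg {m : ℕ} {d : ℤ} (hd : d < 0) (φ : 𝓢(Eu m, ℝ)) :
    AnnihilatesPoly d φ := fun P hP => by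
  have : (0 : ℤ) ≤ P.totalDegree := Int.natCast_nonneg _
  omega

theorem hasLineDerivAt_eval {m : ℕ} (P : MvPolynomial (Fin m) ℝ) (j : Fin m) (x : Eu m) :
    HasLineDerivAt ℝ (fun x : Eu m => MvPolynomial.eval (fun i => x i) P)
      (MvPolynomial.eval (fun i => x i) (MvPolynomial.pderiv j P)) x
      (EuclideanSpace.single j 1) := by
  induction P using MvPolynomial.induction_on with
  | C a =>
    simp only [MvPolynomial.eval_C, MvPolynomial.pderiv_C, map_zero]
    exact hasDerivAt_const _ _
  | add P Q hP hQ =>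
    simp only [map_add]
    exact HasDerivAt.add hP hQ
  | mul_X P i hP =>
    have hX : HasLineDerivAt ℝ (fun x : Eu m => x i) (if i = j then 1 else 0) x
        (EuclideanSpace.single j 1) := by
      have h1 := ((hasDerivAt_id (0 : ℝ)).mul_const (if i = j then (1 : ℝ) else 0)).const_add (x i)
      simp only [one_mul] at h1
      refine h1.congr_of_eventuallyEq (Eventually.of_forall fun t => ?_)
      simp
    have := hP.fun_mul hX
    simp only [map_mul, MvPolynomial.eval_X, Derivation.leibniz, MvPolynomial.pderiv_X,
      smul_eq_mul, map_add]
    convert this using 1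
    rw [add_comm, mul_comm (x i)]
    congr 2
    by_cases h : i = j
    · subst h; simp
    · simp [h]

theorem exists_abs_eval_le {m : ℕ} (P : MvPolynomial (Fin m) ℝ) : ∃ (C : ℝ) (k : ℕ), 0 ≤ C ∧
    ∀ x : Eu m, |MvPolynomial.eval (fun i => x i) P| ≤ C * (1 + ‖x‖) ^ k := by
  induction P using MvPolynomial.induction_on with
  | C a => exact ⟨|a|, 0, abs_nonneg _, by simp⟩
  | add P Q hP hQ =>
    obtain ⟨C, k, hC, h1⟩ := hP
    obtain ⟨D, l, hD, h2⟩ := hQ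
    refine ⟨C + D, max k l, by positivity, fun x => ?_⟩
    have hx : (1 : ℝ) ≤ 1 + ‖x‖ := by linarith [norm_nonneg x]
    rw [map_add, add_mul]
    refine (abs_add_le _ _).trans (add_le_add ((h1 x).trans ?_) ((h2 x).trans ?_))
    · exact mul_le_mul_of_nonneg_left (pow_le_pow_right₀ hx (le_max_left _ _)) hC
    · exact mul_le_mul_of_nonneg_left (pow_le_pow_right₀ hx (le_max_right _ _)) hD
  | mul_X P i hP =>
    obtain ⟨C, k, hC, h1⟩ := hP
    refine ⟨C, k + 1, hC, fun x => ?_⟩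
    have hx : |x i| ≤ 1 + ‖x‖ := (PiLp.norm_apply_le x i).trans (by linarith)
    rw [map_mul, MvPolynomial.eval_X, abs_mul, pow_succ, ← mul_assoc]
    exact mul_le_mul (h1 x) hx (abs_nonneg _) (by positivity)

theorem totalDegree_pderiv_le {m : ℕ} (P : MvPolynomial (Fin m) ℝ) (j : Fin m) :
    (MvPolynomial.pderiv j P).totalDegree ≤ P.totalDegree - 1 := by
  conv_lhs => rw [P.as_sum, map_sum]
  refine MvPolynomial.totalDegree_finsetSum_le fun s hs => ?_
  rw [MvPolynomial.pderiv_monomial]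
  by_cases h : s j = 0
  · simp [h]
  · refine (MvPolynomial.totalDegree_monomial_le _ _).trans ?_
    have h1 := MvPolynomial.le_totalDegree hs
    have h2 : s = (s - Finsupp.single j 1) + Finsupp.single j 1 := by
      rw [tsub_add_cancel_of_le]
      rw [Finsupp.single_le_iff]
      omega
    rw [h2, Finsupp.sum_add_index' (by simp) (by simp)] at h1
    simp only [Finsupp.sum_single_index] at h1
    exact Nat.le_sub_of_add_le h1

/-- Integration by parts replaces `P` by `∂_j P`, whose degree is one less. -/
theorem AnnihilatesPoly.lineDeriv {m : ℕ} (hm : 2 ≤ m) {d : ℤ} {φ : 𝓢(Eu m, ℝ)}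
    (h : AnnihilatesPoly d φ) (j : Fin m) :
    AnnihilatesPoly (d + 1) (∂_{EuclideanSpace.single j (1 : ℝ)} φ : 𝓢(Eu m, ℝ)) := by
  intro P hP
  have hm2 : (2 : ℝ) ≤ m := by exact_mod_cast hm
  have hint : ∀ (ψ : 𝓢(Eu m, ℝ)) (P : MvPolynomial (Fin m) ℝ),
      PowIntegrable (-(m : ℝ)) 1 fun x => ψ x * MvPolynomial.eval (fun i => x i) P := by
    intro ψ P
    obtain ⟨C, k, _, hC⟩ := exists_abs_eval_le P
    have : Continuous fun x : Eu m => MvPolynomial.eval (fun i => x i) P :=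
      (MvPolynomial.continuous_eval P).comp (by fun_prop)
    exact ψ.powIntegrable_mul (by omega) this.aestronglyMeasurable hC 1
  have hint0 : ∀ (ψ : 𝓢(Eu m, ℝ)) (P : MvPolynomial (Fin m) ℝ),
      Integrable fun x => ψ x * MvPolynomial.eval (fun i => x i) P := by
    intro ψ P
    simpa using hint ψ P 0 ⟨by linarith, one_pos⟩
  have i1 := hint0 (∂_{EuclideanSpace.single j (1 : ℝ)} φ : 𝓢(Eu m, ℝ)) P
  have i2 := hint0 φ (MvPolynomial.pderiv j P)
  have hz := integral_lineDeriv_eq_zero (by omega : 1 ≤ m)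
    (W := fun x => φ x * MvPolynomial.eval (fun i => x i) P) (v := EuclideanSpace.single j (1 : ℝ))
    (fun x _ => (φ.hasLineDerivAt x _).fun_mul (hasLineDerivAt_eval P j x)) (i1.add i2) ?_
  · rw [integral_add i1 i2] at hz
    suffices h0 : ∫ x, φ x * MvPolynomial.eval (fun i => x i) (MvPolynomial.pderiv j P) = 0 by
      rwa [h0, add_zero] at hz
    -- Constants are treated apart: their derivative is zero, but its total degree counts as `0`,
    -- not `-1`. This matters for `d = -1`, where the assumption on `φ` is empty.
    by_cases hP0 : P.totalDegree = 0
    · rw [MvPolynomial.totalDegree_eq_zero_iff_eq_C] at hP0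
      rw [hP0]
      simp
    · refine h _ ?_
      have := totalDegree_pderiv_le P j
      omega
  · have := hint φ P (-1) ⟨by linarith, by norm_num⟩
    simpa [Real.rpow_neg_one] using this

/-! ### Analytic continuation in the exponent -/

theorem rpow_le_add_rpow {r a p q : ℝ} (hr : 0 < r) (hp : p ≤ a) (hq : a ≤ q) :
    r ^ a ≤ r ^ p + r ^ q := by
  have h1 : 0 < r ^ p := by positivity
  have h2 : 0 < r ^ q := by positivity
  rcases le_total 1 r with h | h
  · linarith [Real.rpow_le_rpow_of_exponent_le h hq]
  · linarith [Real.rpow_le_rpow_of_exponent_ge hr h hp]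

/-- Radial Mellin transforms are holomorphic on their open strip of convergence. -/
theorem PowIntegrable.hasDerivAt_cpow {m : ℕ} (hm : 1 ≤ m) {A B : ℝ} {f : Eu m → ℝ}
    (hf : PowIntegrable A B f) {s : ℂ} (hs : s.re ∈ Ioo A B) :
    HasDerivAt (fun s : ℂ => ∫ x, (‖x‖ : ℂ) ^ s * f x)
      (∫ x, (‖x‖ : ℂ) ^ s * Real.log ‖x‖ * f x) s := by
  -- The margin is `2δ`: one `δ` for the ball around `s`, the other for the logarithm produced by
  -- differentiation.
  obtain ⟨δ, hδ, h1, h2⟩ : ∃ δ > 0, A < s.re - 2 * δ ∧ s.re + 2 * δ < B := by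
    have hσ1 := hs.1
    have hσ2 := hs.2
    refine ⟨min (s.re - A) (B - s.re) / 4, ?_, ?_, ?_⟩
    · have : 0 < min (s.re - A) (B - s.re) := lt_min (by linarith) (by linarith)
      positivity
    · have := min_le_left (s.re - A) (B - s.re)
      linarith
    · have := min_le_right (s.re - A) (B - s.re)
      linarith
  have hmeas := hf.aestronglyMeasurable hm (hs.1.trans hs.2)
  have hfc : AEStronglyMeasurable fun x => (f x : ℂ) :=
    Complex.continuous_ofReal.comp_aestronglyMeasurable hmeas
  have hF : ∀ s : ℂ, AEStronglyMeasurable fun x : Eu m => (‖x‖ : ℂ) ^ s * f x := fun s =>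
    (Measurable.aestronglyMeasurable (by fun_prop)).mul hfc
  have hi1 := hf (s.re - 2 * δ) ⟨h1, by linarith⟩
  have hi2 := hf (s.re + 2 * δ) ⟨by linarith, h2⟩
  have hi := (hi1.norm.add hi2.norm).const_mul (2 * δ⁻¹)
  refine (hasDerivAt_integral_of_dominated_loc_of_deriv_le (s := Metric.ball s δ)
    (F' := fun (s : ℂ) (x : Eu m) => (‖x‖ : ℂ) ^ s * Real.log ‖x‖ * f x)
    (Metric.ball_mem_nhds s hδ) (Eventually.of_forall hF) ?_ ?_ ?_ hi ?_).2
  · refine (hf _ hs).norm.mono' (hF s) ?_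
    filter_upwards [ae_ne_zero hm] with x hx
    rw [norm_mul, Complex.norm_cpow_eq_rpow_re_of_pos (norm_pos_iff.2 hx), norm_mul,
      Complex.norm_real, Real.norm_of_nonneg (by positivity : 0 ≤ ‖x‖ ^ s.re)]
  · exact (Measurable.aestronglyMeasurable (by fun_prop)).mul hfc
  · filter_upwards [ae_ne_zero hm] with x hx w hw
    have hr : 0 < ‖x‖ := norm_pos_iff.2 hx
    have hws : |w.re - s.re| < δ := by
      rw [mem_ball_iff_norm] at hw
      exact (Complex.abs_re_le_norm (w - s)).trans_lt hw
    rw [abs_lt] at hws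
    rw [norm_mul, norm_mul, Complex.norm_cpow_eq_rpow_re_of_pos hr, Complex.norm_real,
      Complex.norm_real, Real.norm_eq_abs, Real.norm_eq_abs]
    have k1 := abs_log_mul_rpow_le (σ := w.re) hr hδ
    have k2 := rpow_le_add_rpow hr (show s.re - 2 * δ ≤ w.re - δ by linarith)
      (show w.re - δ ≤ s.re + 2 * δ by linarith)
    have k3 := rpow_le_add_rpow hr (show s.re - 2 * δ ≤ w.re + δ by linarith)
      (show w.re + δ ≤ s.re + 2 * δ by linarith)
    have k4 : ‖x‖ ^ w.re * |Real.log ‖x‖| ≤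
        2 * δ⁻¹ * (‖x‖ ^ (s.re - 2 * δ) + ‖x‖ ^ (s.re + 2 * δ)) := by
      rw [mul_comm]
      refine k1.trans ?_
      rw [mul_comm 2, mul_assoc]
      refine mul_le_mul_of_nonneg_left ?_ (by positivity)
      linarith
    have k5 := mul_le_mul_of_nonneg_right k4 (abs_nonneg (f x))
    simp only [Pi.add_apply, norm_mul, Real.norm_eq_abs, Real.abs_rpow_of_nonneg hr.le, abs_norm]
    linarith
  · filter_upwards [ae_ne_zero hm] with x hx w _
    have hr : (‖x‖ : ℂ) ≠ 0 := by exact_mod_cast norm_ne_zero_iff.2 hx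
    have := (Complex.hasStrictDerivAt_const_cpow (x := (‖x‖ : ℂ)) (y := w) (Or.inl hr)).hasDerivAt
    rw [← Complex.ofReal_log (norm_nonneg x)] at this
    exact this.mul_const _

theorem integral_cpow_ofReal {m : ℕ} (f : Eu m → ℝ) (σ : ℝ) :
    ∫ x, (‖x‖ : ℂ) ^ (σ : ℂ) * f x = ((∫ x, ‖x‖ ^ σ * f x : ℝ) : ℂ) := by
  rw [← integral_complex_ofReal]
  refine integral_congr_ae (Eventually.of_forall fun x => ?_)
  simp only [Complex.ofReal_mul, Complex.ofReal_cpow (norm_nonneg x)]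

theorem PowIntegrable.hasDerivAt_rpow {m : ℕ} (hm : 1 ≤ m) {A B : ℝ} {f : Eu m → ℝ}
    (hf : PowIntegrable A B f) {σ : ℝ} (hσ : σ ∈ Ioo A B) :
    HasDerivAt (fun σ : ℝ => ∫ x, ‖x‖ ^ σ * f x)
      (∫ x, (Real.log ‖x‖ * ‖x‖ ^ σ) * f x) σ := by
  have h := (hf.hasDerivAt_cpow hm (s := σ) hσ).real_of_complex
  have e : ∫ x, (‖x‖ : ℂ) ^ (σ : ℂ) * Real.log ‖x‖ * f x =
      ((∫ x, (Real.log ‖x‖ * ‖x‖ ^ σ) * f x : ℝ) : ℂ) := by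
    rw [← integral_complex_ofReal]
    refine integral_congr_ae (Eventually.of_forall fun x => ?_)
    simp only [Complex.ofReal_mul, Complex.ofReal_cpow (norm_nonneg x)]
    ring
  rw [e, Complex.ofReal_re] at h
  refine h.congr_of_eventuallyEq (Eventually.of_forall fun t => ?_)
  simp only [integral_cpow_ofReal, Complex.ofReal_re]

theorem integrable_riesz {m : ℕ} (hm : 2 ≤ m) {lam : ℝ} (h1 : -(m : ℝ) < lam) (h2 : lam < -1)
    {x : Eu m} (hx : x ≠ 0) :
    Integrable (fun y => ‖x - y‖ ^ (1 - m : ℝ) * ‖y‖ ^ lam) ∧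
      ∫ y, ‖x - y‖ ^ (1 - m : ℝ) * ‖y‖ ^ lam = rieszConst m lam * ‖x‖ ^ (lam + 1) := by
  have h := lintegral_riesz hm h1 h2 hx
  have hm' : AEStronglyMeasurable (fun y : Eu m => ‖x - y‖ ^ (1 - m : ℝ) * ‖y‖ ^ lam) :=
    Measurable.aestronglyMeasurable (by fun_prop)
  have hnn : 0 ≤ᵐ[volume] fun y : Eu m => ‖x - y‖ ^ (1 - m : ℝ) * ‖y‖ ^ lam :=
    Eventually.of_forall fun y => by positivity
  have := rieszConst_pos hm h1 h2
  refine ⟨⟨hm', ?_⟩, ?_⟩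
  · rw [hasFiniteIntegral_iff_ofReal hnn, h]
    exact ENNReal.ofReal_lt_top
  · rw [integral_eq_lintegral_of_nonneg_ae hnn hm', h, ENNReal.toReal_ofReal (by positivity)]

/-- Fubini's theorem and the composition formula, absolutely convergent for `-m < lam < -1`. This is
the range from which the identity is continued. -/
theorem SchwartzMap.integral_rpow_mul_rieszPot {m : ℕ} (hm : 2 ≤ m) (ψ : 𝓢(Eu m, ℝ)) {lam : ℝ}
    (h1 : -(m : ℝ) < lam) (h2 : lam < -1) :
    ∫ y, ‖y‖ ^ lam * rieszPot ψ y = rieszConst m lam * ∫ x, ‖x‖ ^ (lam + 1) * ψ x := by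
  have hm1 : 1 ≤ m := by omega
  have hψ := ψ.continuous
  have hI : Integrable (fun p : Eu m × Eu m =>
      (‖p.2 - p.1‖ ^ (1 - m : ℝ) * ‖p.1‖ ^ lam) * ψ p.2) (volume.prod volume) := by
    rw [integrable_prod_iff']
    · constructor
      · filter_upwards [ae_ne_zero hm1] with x hx
        exact (integrable_riesz hm h1 h2 hx).1.mul_const _
      · refine ((ψ.powIntegrable hm1 0 (lam + 1) ⟨by linarith, by linarith⟩).norm.const_mul
          (rieszConst m lam)).congr ?_
        filter_upwards [ae_ne_zero hm1] with x hx
        simp only [norm_mul, Real.norm_eq_abs]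
        rw [integral_mul_const]
        simp only [abs_of_nonneg (Real.rpow_nonneg (norm_nonneg _) _)]
        rw [(integrable_riesz hm h1 h2 hx).2]
        ring
    · exact (Measurable.aestronglyMeasurable (by fun_prop)).mul
        (Continuous.aestronglyMeasurable (by fun_prop))
  calc ∫ y, ‖y‖ ^ lam * rieszPot ψ y
      = ∫ y, ∫ x, (‖x - y‖ ^ (1 - m : ℝ) * ‖y‖ ^ lam) * ψ x := by
        refine integral_congr_ae (Eventually.of_forall fun y => ?_)
        simp only
        rw [rieszPot_eq_integral_sub, ← integral_const_mul]
        refine integral_congr_ae (Eventually.of_forall fun x => ?_)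
        simp only
        ring
    _ = ∫ x, ∫ y, (‖x - y‖ ^ (1 - m : ℝ) * ‖y‖ ^ lam) * ψ x := integral_integral_swap hI
    _ = _ := by
        rw [← integral_const_mul]
        refine integral_congr_ae ?_
        filter_upwards [ae_ne_zero hm1] with x hx
        rw [integral_mul_const, (integrable_riesz hm h1 h2 hx).2]
        ring

/-- The reciprocal of the Gamma function. -/
def rGamma (t : ℝ) : ℝ := (Real.Gamma t)⁻¹

theorem rGamma_eq (t : ℝ) : rGamma t = t * rGamma (t + 1) := by
  have := Complex.one_div_Gamma_eq_self_mul_one_div_Gamma_add_one t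
  unfold rGamma
  apply Complex.ofReal_injective
  push_cast
  rw [← Complex.Gamma_ofReal, ← Complex.Gamma_ofReal, this]
  push_cast
  rfl

theorem differentiable_rGamma : Differentiable ℝ rGamma := by
  intro t
  have h := (Complex.differentiable_one_div_Gamma t).hasDerivAt.real_of_complex
  refine (h.congr_of_eventuallyEq (Eventually.of_forall fun s => ?_)).differentiableAt
  simp only [Complex.Gamma_ofReal, ← Complex.ofReal_inv, Complex.ofReal_re, rGamma]

theorem rGamma_neg_nat (n : ℕ) : rGamma (-n) = 0 := by
  simp [rGamma, Real.Gamma_neg_nat_eq_zero]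

/-- Differentiate `1/Γ(t) = t/Γ(t+1)` and induct: at a negative integer the term without the factor
`t` vanishes. These values become the constants of the logarithmic kernels. -/
theorem hasDerivAt_rGamma_neg_nat (n : ℕ) : HasDerivAt rGamma ((-1) ^ n * n.factorial) (-n) := by
  have key : ∀ t : ℝ, HasDerivAt rGamma (rGamma (t + 1) + t * deriv rGamma (t + 1)) t := by
    intro t
    have h1 := (differentiable_rGamma (t + 1)).hasDerivAt.comp_add_const t 1
    have h2 := (hasDerivAt_id t).mul h1
    simp only [one_mul, id] at h2
    exact h2.congr_of_eventuallyEq (Eventually.of_forall rGamma_eq)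
  induction n with
  | zero =>
    have := key 0
    simpa [rGamma] using this
  | succ n ih =>
    have h := key (-((n + 1 : ℕ) : ℝ))
    rw [show -((n + 1 : ℕ) : ℝ) + 1 = -n by push_cast; ring, ih.deriv, rGamma_neg_nat] at h
    convert h using 1
    rw [Nat.factorial_succ]
    push_cast
    ring

theorem rGamma_pos {t : ℝ} (ht : 0 < t) : 0 < rGamma t := inv_pos.2 (Real.Gamma_pos_of_pos ht)

/-- The relation between the radial Mellin transforms of `rieszPot ψ` and of `ψ`, at every
exponent for which both converge. -/
theorem SchwartzMap.rieszPot_functional_equation {m : ℕ} (hm : 2 ≤ m) (ψ : 𝓢(Eu m, ℝ)) {N : ℕ}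
    (hN : 1 ≤ N) (hψ : VanishingMoments N ψ) {σ : ℝ} (hσ : σ ∈ Ioo (-(m : ℝ)) (N - 1)) :
    (∫ y, ‖y‖ ^ σ * rieszPot ψ y) *
      (rGamma (-(σ + 1) / 2) * rGamma ((σ + m) / 2) * Real.Gamma (((m : ℝ) - 1) / 2)) =
    (∫ x, ‖x‖ ^ (σ + 1) * ψ x) *
      (Real.pi ^ ((m : ℝ) / 2) * √Real.pi * rGamma (-σ / 2) * rGamma ((σ + m + 1) / 2)) := by
  have hm1 : 1 ≤ m := by omega
  have hm2 : (2 : ℝ) ≤ m := by exact_mod_cast hm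
  have hN1 : (1 : ℝ) ≤ N := by exact_mod_cast hN
  have hG := ψ.powIntegrable_rieszPot hm1 hψ
  have hψi := ψ.powIntegrable hm1 (N : ℝ)
  -- The Gamma factors are arranged as reciprocals, which are entire; so `L` and `R` are holomorphic
  -- on the whole strip, with no poles at the exceptional exponents.
  let L : ℂ → ℂ := fun s => (∫ y, (‖y‖ : ℂ) ^ s * rieszPot ψ y) *
    ((Complex.Gamma (-(s + 1) / 2))⁻¹ * (Complex.Gamma ((s + m) / 2))⁻¹ *
      Real.Gamma (((m : ℝ) - 1) / 2))
  let R : ℂ → ℂ := fun s => (∫ x, (‖x‖ : ℂ) ^ (s + 1) * ψ x) *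
    ((Real.pi ^ ((m : ℝ) / 2) * √Real.pi : ℝ) * (Complex.Gamma (-s / 2))⁻¹ *
      (Complex.Gamma ((s + m + 1) / 2))⁻¹)
  let U : Set ℂ := Complex.re ⁻¹' Ioo (-(m : ℝ)) (N - 1)
  have hU : IsOpen U := isOpen_Ioo.preimage Complex.continuous_re
  have hUc : IsPreconnected U :=
    ((convex_Ioo (-(m : ℝ)) (N - 1)).linear_preimage Complex.reLm).isPreconnected
  have hL : AnalyticOnNhd ℂ L U := by
    refine DifferentiableOn.analyticOnNhd (fun s hs => ?_) hU
    refine DifferentiableAt.differentiableWithinAt ?_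
    have d1 := (hG.hasDerivAt_cpow hm1 (s := s) hs).differentiableAt
    have d2 : DifferentiableAt ℂ (fun s => (Complex.Gamma (-(s + 1) / 2))⁻¹) s :=
      (Complex.differentiable_one_div_Gamma _).comp s (f := fun s : ℂ => -(s + 1) / 2)
        (by fun_prop)
    have d3 : DifferentiableAt ℂ (fun s => (Complex.Gamma ((s + m) / 2))⁻¹) s :=
      (Complex.differentiable_one_div_Gamma _).comp s (f := fun s : ℂ => (s + m) / 2)
        (by fun_prop)
    exact d1.mul ((d2.mul d3).mul_const _)
  have hR : AnalyticOnNhd ℂ R U := by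
    refine DifferentiableOn.analyticOnNhd (fun s hs => ?_) hU
    refine DifferentiableAt.differentiableWithinAt ?_
    have d1 : DifferentiableAt ℂ (fun s => ∫ x, (‖x‖ : ℂ) ^ (s + 1) * ψ x) s := by
      refine (hψi.hasDerivAt_cpow hm1 (s := s + 1) ?_).differentiableAt.comp s
        (f := fun s : ℂ => s + 1) (by fun_prop)
      rw [Complex.add_re, Complex.one_re]
      exact ⟨by linarith [hs.1], by linarith [hs.2]⟩
    have d2 : DifferentiableAt ℂ (fun s => (Complex.Gamma (-s / 2))⁻¹) s :=
      (Complex.differentiable_one_div_Gamma _).comp s (f := fun s : ℂ => -s / 2) (by fun_prop)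
    have d3 : DifferentiableAt ℂ (fun s => (Complex.Gamma ((s + m + 1) / 2))⁻¹) s :=
      (Complex.differentiable_one_div_Gamma _).comp s (f := fun s : ℂ => (s + m + 1) / 2)
        (by fun_prop)
    exact d1.mul ((d2.const_mul _).mul d3)
  have hLr : ∀ t : ℝ, L t = (((∫ y, ‖y‖ ^ t * rieszPot ψ y) *
      (rGamma (-(t + 1) / 2) * rGamma ((t + m) / 2) * Real.Gamma (((m : ℝ) - 1) / 2)) : ℝ) : ℂ) := by
    intro t
    simp only [L, integral_cpow_ofReal, rGamma]
    push_cast [← Complex.Gamma_ofReal]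
    rfl
  have hRr : ∀ t : ℝ, R t = (((∫ x, ‖x‖ ^ (t + 1) * ψ x) *
      (Real.pi ^ ((m : ℝ) / 2) * √Real.pi * rGamma (-t / 2) * rGamma ((t + m + 1) / 2)) : ℝ) : ℂ) := by
    intro t
    have := integral_cpow_ofReal ψ (t + 1)
    push_cast at this
    simp only [R, this, rGamma]
    push_cast [← Complex.Gamma_ofReal]
    ring
  have heq : ∀ t : ℝ, -(m : ℝ) < t → t < -1 → L t = R t := by
    intro t h1 h2
    rw [hLr, hRr, ψ.integral_rpow_mul_rieszPot hm h1 h2, rieszConst]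
    congr 1
    have g1 := Real.Gamma_pos_of_pos (show (0 : ℝ) < (t + m) / 2 by linarith)
    have g2 := Real.Gamma_pos_of_pos (show (0 : ℝ) < -(t + 1) / 2 by linarith)
    have g3 := Real.Gamma_pos_of_pos (show (0 : ℝ) < ((m : ℝ) - 1) / 2 by linarith)
    have g4 := Real.Gamma_pos_of_pos (show (0 : ℝ) < -t / 2 by linarith)
    have g5 := Real.Gamma_pos_of_pos (show (0 : ℝ) < (t + m + 1) / 2 by linarith)
    simp only [rGamma]
    generalize Real.Gamma ((t + m) / 2) = c1 at *
    generalize Real.Gamma (-(t + 1) / 2) = c2 at *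
    generalize Real.Gamma (((m : ℝ) - 1) / 2) = c3 at *
    generalize Real.Gamma (-t / 2) = c4 at *
    generalize Real.Gamma ((t + m + 1) / 2) = c5 at *
    field_simp
  -- The point `-3/2` lies in `(-m, -1)` because `m ≥ 2`. On the real axis near it `L = R` is the
  -- composition formula, and the identity theorem extends the equality to the strip.
  have hfreq : ∃ᶠ z in 𝓝[≠] ((-3 / 2 : ℝ) : ℂ), L z = R z := by
    have ht : Tendsto (fun t : ℝ => (t : ℂ)) (𝓝[≠] (-3 / 2 : ℝ)) (𝓝[≠] ((-3 / 2 : ℝ) : ℂ)) :=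
      tendsto_nhdsWithin_iff.2 ⟨(Complex.continuous_ofReal.tendsto _).mono_left nhdsWithin_le_nhds,
        by filter_upwards [self_mem_nhdsWithin] with t ht using fun h => ht
            (Complex.ofReal_injective h)⟩
    refine ht.frequently (Eventually.frequently ?_)
    filter_upwards [mem_nhdsWithin_of_mem_nhds (Ioo_mem_nhds (a := -(m : ℝ)) (b := -1)
      (by linarith : -(m : ℝ) < -3 / 2) (by norm_num))] with t ht
    exact heq t ht.1 ht.2
  have hfin := hL.eqOn_of_preconnected_of_frequently_eq hR hUc
    (show ((-3 / 2 : ℝ) : ℂ) ∈ U by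
      refine ⟨?_, ?_⟩ <;> rw [Complex.ofReal_re] <;> linarith) hfreq
    (show (σ : ℂ) ∈ U from hσ)
  rw [hLr, hRr] at hfin
  exact Complex.ofReal_injective hfin

/-! ### The radial coefficients of the boundary distributions -/

/-- The normalizing factor `π^(k/2) / Γ(k/2)`. -/
def gammaFactor (k : ℝ) : ℝ := Real.pi ^ (k / 2) * rGamma (k / 2)

/-- The coefficient of `r^(n+1-m) ln r` in `a_n^+`. -/
def aLog (m n : ℕ) : ℝ :=
  if m ≤ n + 1 ∧ Even (n + 1 - m) then (-1) ^ m * ((pq m (n + 1 - m)).1 * gammaFactor (n + 1))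
  else 0

/-- The coefficient of `r^(n+1-m)` in `a_n^+`. -/
def aReg (m n : ℕ) : ℝ :=
  if m ≤ n + 1 ∧ Even (n + 1 - m) then (-1) ^ m * ((pq m (n + 1 - m)).2 * gammaFactor (n + 1))
  else ((-1) ^ (n + 1) * (1 / 2 ^ (n + 1)) *
      (Real.Gamma (((m : ℝ) - n - 1) / 2) / Real.pi ^ (((m : ℝ) + n + 1) / 2))) *
    gammaFactor (n + 1)

/-- The coefficient of `r^(n-m) ln r` in the radial factor of `b_n^+`. -/
def bLog (m n : ℕ) : ℝ :=
  if m ≤ n ∧ Even (n - m) then (-1) ^ (m + 1) * ((pq m (n - m + 1)).1 * gammaFactor (n + 2))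
  else 0

/-- The coefficient of `r^(n-m)` in the radial factor of `b_n^+`. -/
def bReg (m n : ℕ) : ℝ :=
  if m ≤ n ∧ Even (n - m) then (-1) ^ (m + 1) * ((pq m (n - m + 1)).2 * gammaFactor (n + 2))
  else ((-1) ^ n * (1 / 2 ^ (n + 1)) *
      (Real.Gamma (((m : ℝ) - n) / 2) / Real.pi ^ (((m : ℝ) + n + 2) / 2))) *
    gammaFactor (n + 2)

/-- The real-valued function `a_n^+`. -/
def aRad (m n : ℕ) (x : Eu m) : ℝ :=
  (aLog m n * Real.log ‖x‖ + aReg m n) * ‖x‖ ^ ((n : ℝ) + 1 - m)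

/-- The radial factor of the vector-valued function `b_n^+`. -/
def bRad (m n : ℕ) (x : Eu m) : ℝ :=
  (bLog m n * Real.log ‖x‖ + bReg m n) * ‖x‖ ^ ((n : ℝ) - m)

theorem aPlus_eq (m n : ℕ) (x : Eu m) : aPlus m n x = algebraMap ℝ (Cl m) (aRad m n x) := by
  unfold aPlus aRad aLog aReg gammaFactor rGamma
  split_ifs with h
  · have hc : ((n + 1 - m : ℕ) : ℝ) = (n : ℝ) + 1 - m := by push_cast [Nat.cast_sub h.1]; ring
    rw [logKernel, if_pos h.2, TStar, hc, Algebra.smul_def, Algebra.smul_def, ← map_mul, ← map_mul]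
    congr 1
    rw [show (n : ℝ) + 1 - m + m = n + 1 by ring]
    ring
  · rw [TStar, Algebra.smul_def, ← map_mul]
    congr 1
    rw [show -(m : ℝ) + n + 1 + m = n + 1 by ring, show -(m : ℝ) + n + 1 = n + 1 - m by ring]
    ring

theorem norm_rpow_smul_direction {m : ℕ} (lam : ℝ) (x : Eu m) :
    ‖x‖ ^ lam • ‖x‖⁻¹ • vec m x = ‖x‖ ^ (lam - 1) • vec m x := by
  rcases eq_or_ne x 0 with rfl | hx
  · simp
  · rw [smul_smul, Real.rpow_sub_one (norm_ne_zero_iff.2 hx), div_eq_mul_inv]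

theorem bPlus_eq (m n : ℕ) (x : Eu m) : bPlus m n x = bRad m n x • vec m x := by
  unfold bPlus bRad bLog bReg gammaFactor rGamma
  split_ifs with h
  · have hc : ((n - m + 1 : ℕ) : ℝ) = (n : ℝ) - m + 1 := by push_cast [Nat.cast_sub h.1]; ring
    have ho : ¬ Even (n - m + 1) := by
      rw [Nat.not_even_iff_odd]
      exact h.2.add_one
    rw [logKernel, if_neg ho, UStar, hc, mul_smul, norm_rpow_smul_direction, smul_smul, smul_smul,
      smul_smul, add_sub_cancel_right, show (n : ℝ) - m + 1 + m + 1 = n + 2 by ring]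
    congr 1
    ring
  · rw [UStar, mul_smul (_ / Real.Gamma _) (‖x‖ ^ (_ : ℝ)), norm_rpow_smul_direction, smul_smul,
      smul_smul, show -(m : ℝ) + n + 1 + m + 1 = n + 2 by ring, show -(m : ℝ) + n + 1 - 1 = n - m by ring]
    congr 1
    ring

theorem pq_succ_of_even {m n : ℕ} (h : Even n) : pq m (n + 1) =
    (-(1 / (2 * Real.pi)) * (pq m n).1,
      -(1 / (2 * Real.pi)) * ((pq m n).2 - 1 / ((m : ℝ) + n) * (pq m n).1)) := by
  rw [pq, if_pos h]

theorem pq_succ_of_not_even {m n : ℕ} (h : ¬ Even n) : pq m (n + 1) =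
    (1 / ((n : ℝ) + 1) * (pq m n).1,
      1 / ((n : ℝ) + 1) * ((pq m n).2 - 1 / ((n : ℝ) + 1) * (pq m n).1)) := by
  rw [pq, if_neg h]

theorem gammaFactor_add_two (k : ℝ) :
    k * gammaFactor (k + 2) = 2 * Real.pi * gammaFactor k := by
  unfold gammaFactor
  rw [show (k + 2) / 2 = k / 2 + 1 by ring, Real.rpow_add_one Real.pi_pos.ne', rGamma_eq (k / 2)]
  ring

theorem Real_Gamma_half_int_ne_zero {a : ℤ} (ha : Odd a) : Real.Gamma ((a : ℝ) / 2) ≠ 0 := by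
  refine Real.Gamma_ne_zero fun n hn => ?_
  have : (a : ℝ) = ((-2 * n : ℤ) : ℝ) := by push_cast; linarith
  have := Int.cast_injective this
  obtain ⟨b, hb⟩ := ha
  omega

/-- `bLog_eq` and `bReg_eq` express `b_n = -∇a_{n+1}` through coefficients: the gradient of `(p ln r
+ q) r^λ` is `(p + λ (p ln r + q)) r^(λ-2) x`, here with `λ = n + 2 - m`. -/
theorem bLog_eq (m n : ℕ) : bLog m n = -((n : ℝ) + 2 - m) * aLog m (n + 1) := by
  unfold bLog aLog
  by_cases h : m ≤ n ∧ Even (n - m)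
  · obtain ⟨h1, j, hj⟩ := h
    have h2 : m ≤ n + 1 + 1 ∧ Even (n + 1 + 1 - m) := ⟨by omega, j + 1, by omega⟩
    rw [if_pos ⟨h1, j, hj⟩, if_pos h2, show n + 1 + 1 - m = (n - m + 1) + 1 by omega]
    have hne : ¬ Even (n - m + 1) := by
      rw [Nat.not_even_iff_odd]
      exact ⟨j, by omega⟩
    rw [pq_succ_of_not_even hne]
    push_cast [Nat.cast_sub h1]
    have : (n : ℝ) - m + 1 + 1 ≠ 0 := by
      have : (m : ℝ) ≤ n := by exact_mod_cast h1
      linarith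
    rw [show (n : ℝ) + 2 - m = n - m + 1 + 1 by ring, show (n : ℝ) + 1 + 1 = n + 2 by ring]
    field_simp
    ring
  · rw [if_neg h]
    split_ifs with h2
    -- The threshold: `a_{m-1}` is logarithmic and `b_{m-2}` is not. The factor `n + 2 - m = 0`
    -- removes the logarithm.
    · have : n + 2 = m := by
        by_contra hne
        refine h ⟨?_, ?_⟩
        · rcases h2 with ⟨h3, j, hj⟩
          omega
        · rcases h2 with ⟨h3, j, hj⟩
          exact ⟨j - 1, by omega⟩
      subst this
      push_cast
      ring
    · simp

theorem bReg_eq {m : ℕ} (hm : 2 ≤ m) (n : ℕ) :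
    bReg m n = -(aLog m (n + 1) + ((n : ℝ) + 2 - m) * aReg m (n + 1)) := by
  unfold bReg aLog aReg
  by_cases h : m ≤ n ∧ Even (n - m)
  · obtain ⟨h1, j, hj⟩ := h
    have h2 : m ≤ n + 1 + 1 ∧ Even (n + 1 + 1 - m) := ⟨by omega, j + 1, by omega⟩
    rw [if_pos ⟨h1, j, hj⟩, if_pos h2, if_pos h2, show n + 1 + 1 - m = (n - m + 1) + 1 by omega]
    have hne : ¬ Even (n - m + 1) := by
      rw [Nat.not_even_iff_odd]
      exact ⟨j, by omega⟩
    rw [pq_succ_of_not_even hne]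
    push_cast [Nat.cast_sub h1]
    have : (n : ℝ) - m + 1 + 1 ≠ 0 := by
      have : (m : ℝ) ≤ n := by exact_mod_cast h1
      linarith
    rw [show (n : ℝ) + 2 - m = n - m + 1 + 1 by ring, show (n : ℝ) + 1 + 1 = n + 2 by ring]
    field_simp
    ring
  · rw [if_neg h]
    split_ifs with h2
    -- At the threshold the gradient of the logarithm in `a_{m-1}` must agree with the generic
    -- formula for `b_{m-2}`; the value of `p_0` is exactly the one that achieves this.
    · have : n + 2 = m := by
        by_contra hne
        refine h ⟨?_, ?_⟩
        · rcases h2 with ⟨h3, j, hj⟩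
          omega
        · rcases h2 with ⟨h3, j, hj⟩
          exact ⟨j - 1, by omega⟩
      subst this
      rw [show n + 1 + 1 - (n + 2) = 0 by omega, pq]
      push_cast
      rw [show ((n : ℝ) + 2 - n) / 2 = 1 by ring, Real.Gamma_one,
        show ((n : ℝ) + 2 + n + 2) / 2 = n + 2 by ring, show (n : ℝ) + 2 = ((n + 2 : ℕ) : ℝ) by
          push_cast; ring, Real.rpow_natCast,
        show (n : ℝ) + 1 + 1 = ((n + 2 : ℕ) : ℝ) by push_cast; ring]
      have : (Real.pi : ℝ) ≠ 0 := Real.pi_pos.ne'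
      field_simp
      ring
    · have hne : ((m : ℝ) - n - 2) / 2 ≠ 0 := by
        intro h0
        have h3 : (m : ℝ) = ((n + 2 : ℕ) : ℝ) := by push_cast; linarith
        have h4 : m = n + 2 := by exact_mod_cast h3
        exact h2 ⟨by omega, 0, by omega⟩
      have hG := Real.Gamma_add_one hne
      rw [show ((m : ℝ) - n - 2) / 2 + 1 = (m - n) / 2 by ring] at hG
      push_cast
      rw [hG, show (m : ℝ) - (n + 1) - 1 = m - n - 2 by ring,
        show (m : ℝ) + (n + 1) + 1 = m + n + 2 by ring, show (n : ℝ) + 1 + 1 = n + 2 by ring,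
        pow_succ (-1 : ℝ) (n + 1), pow_succ (-1 : ℝ) n, pow_succ (2 : ℝ) (n + 1)]
      field_simp
      ring

/-- `aLog_eq` and `aReg_eq` express `div b_{n+1} = a_n` through coefficients: the divergence of `(p
ln r + q) r^λ x` is `(p + (m + λ)(p ln r + q)) r^λ`, here with `m + λ = n + 1`. -/
theorem aLog_eq (m n : ℕ) : aLog m n = ((n : ℝ) + 1) * bLog m (n + 1) := by
  unfold bLog aLog
  split_ifs with h
  · have hg := gammaFactor_add_two ((n : ℝ) + 1)
    rw [pq_succ_of_even h.2]
    push_cast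
    have hpi : Real.pi ≠ 0 := Real.pi_pos.ne'
    have e : ((n : ℝ) + 1) * ((-1) ^ (m + 1) * (-(1 / (2 * Real.pi)) * (pq m (n + 1 - m)).1 *
        gammaFactor (n + 1 + 2))) = (-1) ^ (m + 1) * (-(1 / (2 * Real.pi)) * (pq m (n + 1 - m)).1) *
        (((n : ℝ) + 1) * gammaFactor (n + 1 + 2)) := by ring
    rw [e, hg]
    field_simp
    ring
  · simp

theorem aReg_eq (m n : ℕ) :
    aReg m n = bLog m (n + 1) + ((n : ℝ) + 1) * bReg m (n + 1) := by
  unfold bLog aReg bReg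
  have hn : (0 : ℝ) < n + 1 := by positivity
  have hg := gammaFactor_add_two ((n : ℝ) + 1)
  have hpi : Real.pi ≠ 0 := Real.pi_pos.ne'
  have hg' : gammaFactor (n + 1 + 2) = 2 * Real.pi * gammaFactor (n + 1) / (n + 1) := by
    rw [← hg]; field_simp
  split_ifs with h
  · rw [pq_succ_of_even h.2]
    push_cast [Nat.cast_sub h.1]
    rw [hg', show (m : ℝ) + (n + 1 - m) = n + 1 by ring]
    field_simp
    ring
  · push_cast
    rw [hg', show (m : ℝ) - (n + 1) = m - n - 1 by ring,
      show ((m : ℝ) + (n + 1) + 2) / 2 = (m + n + 1) / 2 + 1 by ring,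
      Real.rpow_add_one Real.pi_pos.ne', pow_succ (2 : ℝ) (n + 1)]
    field_simp
    ring

/-- The factor `(-1)^j / j!` will meet the derivative `(-1)^j j!` of `1/Γ` at `-j`. No closed form
of `q_{2j}` is needed: in the semigroup property it multiplies an integral that vanishes. -/
theorem pq_even_fst (m j : ℕ) : (pq m (2 * j)).1 =
    -1 / (2 ^ (m - 1) * Real.pi ^ m) * ((-1) ^ j / ((4 * Real.pi) ^ j * j.factorial)) := by
  induction j with
  | zero => simp [pq]
  | succ j ih =>
    have h1 : ¬ Even (2 * j + 1) := by
      rw [Nat.not_even_iff_odd]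
      exact ⟨j, rfl⟩
    rw [show 2 * (j + 1) = 2 * j + 1 + 1 by ring, pq_succ_of_not_even h1,
      pq_succ_of_even (even_two_mul j), ih]
    have hpi : Real.pi ≠ 0 := Real.pi_pos.ne'
    rw [Nat.factorial_succ]
    push_cast
    have : (2 * (j : ℝ) + 1 + 1) ≠ 0 := by positivity
    have : ((j : ℝ) + 1) ≠ 0 := by positivity
    field_simp
    ring

/-- The regular coefficient, away from the exceptional indices. -/
theorem aReg_of_not {m n : ℕ} (h : ¬ (m ≤ n + 1 ∧ Even (n + 1 - m))) :
    aReg m n = (-1) ^ (n + 1) / 2 ^ (n + 1) * (Real.pi ^ ((m : ℝ) / 2))⁻¹ *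
      Real.Gamma (((m : ℝ) - n - 1) / 2) * rGamma (((n : ℝ) + 1) / 2) := by
  rw [aReg, if_neg h, gammaFactor, show ((m : ℝ) + n + 1) / 2 = m / 2 + (n + 1) / 2 by ring,
    Real.rpow_add Real.pi_pos]
  have h1 : Real.pi ^ ((m : ℝ) / 2) ≠ 0 := by positivity
  have h2 : Real.pi ^ (((n : ℝ) + 1) / 2) ≠ 0 := by positivity
  field_simp

theorem aLog_of_not {m n : ℕ} (h : ¬ (m ≤ n + 1 ∧ Even (n + 1 - m))) : aLog m n = 0 :=
  if_neg h

theorem aReg_zero {m : ℕ} (hm : 2 ≤ m) : aReg m 0 = -(1 / 2) * (Real.pi ^ ((m : ℝ) / 2))⁻¹ *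
    Real.Gamma (((m : ℝ) - 1) / 2) * (√Real.pi)⁻¹ := by
  rw [aReg_of_not (by omega), rGamma]
  simp only [Nat.cast_zero, zero_add, sub_zero, Real.Gamma_one_half_eq]
  norm_num

/-! ### The semigroup property of the functions `a_n^+` -/

theorem hasDerivAt_rGamma_comp_neg_half {t : ℝ} (j : ℕ) (ht : t = 2 * j) :
    HasDerivAt (fun t : ℝ => rGamma (-t / 2)) (-(1 / 2) * ((-1) ^ j * j.factorial)) t := by
  have h1 : HasDerivAt (fun t : ℝ => -t / 2) (-1 / 2) t := ((hasDerivAt_id t).neg).div_const 2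
  have h2 := (hasDerivAt_rGamma_neg_nat j).comp_of_eq t h1 (by rw [ht]; ring)
  exact h2.congr_deriv (by ring)

/-- Zeros and derivatives of the functional equation at the even exponents `σ = 2j`. -/
theorem SchwartzMap.rieszPot_equation_even {m : ℕ} (hm : 2 ≤ m) (ψ : 𝓢(Eu m, ℝ)) {N : ℕ}
    (hN : 1 ≤ N) (hψ : VanishingMoments N ψ) {σ : ℝ} (hσ : σ ∈ Ioo (-(m : ℝ)) (N - 1)) {j : ℕ}
    (hj : σ = 2 * j) :
    ∫ y, ‖y‖ ^ σ * rieszPot ψ y = 0 ∧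
    (∫ y, (Real.log ‖y‖ * ‖y‖ ^ σ) * rieszPot ψ y) *
      (rGamma (-(σ + 1) / 2) * rGamma ((σ + m) / 2) * Real.Gamma (((m : ℝ) - 1) / 2)) =
    (∫ x, ‖x‖ ^ (σ + 1) * ψ x) * (Real.pi ^ ((m : ℝ) / 2) * √Real.pi *
      (-(1 / 2) * ((-1) ^ j * j.factorial)) * rGamma ((σ + m + 1) / 2)) := by
  have hm1 : 1 ≤ m := by omega
  have hm2 : (2 : ℝ) ≤ m := by exact_mod_cast hm
  have hG := ψ.powIntegrable_rieszPot hm1 hψ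
  have hψi := ψ.powIntegrable hm1 (N : ℝ)
  have hσ' : σ + 1 ∈ Ioo (-(m : ℝ)) N := ⟨by linarith [hσ.1], by linarith [hσ.2]⟩
  have hj0 : (0 : ℝ) ≤ j := j.cast_nonneg
  -- At `σ = 2j` the right side of the functional equation is zero while the Gamma factors on the
  -- left are not, so the integral on the left vanishes. Once the equation is differentiated, the
  -- only surviving terms are those whose derivative hits a vanishing factor.
  have hrz : rGamma (-σ / 2) = 0 := by
    rw [show -σ / 2 = -j by rw [hj]; ring, rGamma_neg_nat]
  have h0 := ψ.rieszPot_functional_equation hm hN hψ hσ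
  have hne : rGamma (-(σ + 1) / 2) * rGamma ((σ + m) / 2) * Real.Gamma (((m : ℝ) - 1) / 2) ≠ 0 := by
    refine mul_ne_zero (mul_ne_zero ?_ ?_) (Real.Gamma_pos_of_pos (by linarith)).ne'
    · refine inv_ne_zero ?_
      have := Real_Gamma_half_int_ne_zero (a := -(2 * j + 1)) (by
        rw [Int.odd_iff]; omega)
      push_cast at this
      rwa [hj]
    · exact (rGamma_pos (by linarith)).ne'
  have hI : ∫ y, ‖y‖ ^ σ * rieszPot ψ y = 0 := by
    rw [hrz] at h0
    simp only [mul_zero, zero_mul] at h0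
    exact (mul_eq_zero.1 h0).resolve_right hne
  refine ⟨hI, ?_⟩
  have d1 := hG.hasDerivAt_rpow hm1 hσ
  have d2 : HasDerivAt (fun σ : ℝ => ∫ x, ‖x‖ ^ (σ + 1) * ψ x) _ σ :=
    (hψi.hasDerivAt_rpow hm1 hσ').comp_add_const σ 1
  have d3 : DifferentiableAt ℝ (fun σ : ℝ => rGamma (-(σ + 1) / 2) * rGamma ((σ + m) / 2) *
      Real.Gamma (((m : ℝ) - 1) / 2)) σ := by
    have := differentiable_rGamma
    fun_prop
  have d4 : DifferentiableAt ℝ (fun σ : ℝ => rGamma ((σ + m + 1) / 2)) σ := by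
    have := differentiable_rGamma
    fun_prop
  have d5 := hasDerivAt_rGamma_comp_neg_half j hj
  have e1 := d1.mul d3.hasDerivAt
  have e2 := d2.mul ((d5.const_mul (Real.pi ^ ((m : ℝ) / 2) * √Real.pi)).mul d4.hasDerivAt)
  have hev : (fun σ : ℝ => (∫ y, ‖y‖ ^ σ * rieszPot ψ y) *
      (rGamma (-(σ + 1) / 2) * rGamma ((σ + m) / 2) * Real.Gamma (((m : ℝ) - 1) / 2))) =ᶠ[𝓝 σ]
      fun σ : ℝ => (∫ x, ‖x‖ ^ (σ + 1) * ψ x) *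
      (Real.pi ^ ((m : ℝ) / 2) * √Real.pi * rGamma (-σ / 2) * rGamma ((σ + m + 1) / 2)) := by
    filter_upwards [Ioo_mem_nhds hσ.1 hσ.2] with t ht
    exact ψ.rieszPot_functional_equation hm hN hψ ht
  have := e1.unique (e2.congr_of_eventuallyEq hev)
  simp only [Pi.mul_apply, hI, hrz, zero_mul, mul_zero, add_zero, zero_add] at this
  exact this

/-- Zeros and derivatives of the functional equation at the odd exponents `σ = 2j - 1`. -/
theorem SchwartzMap.rieszPot_equation_odd {m : ℕ} (hm : 2 ≤ m) (ψ : 𝓢(Eu m, ℝ)) {N : ℕ}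
    (hN : 1 ≤ N) (hψ : VanishingMoments N ψ) {σ : ℝ} (hσ : σ ∈ Ioo (-(m : ℝ)) (N - 1)) {j : ℕ}
    (hj : σ + 1 = 2 * j) :
    ∫ x, ‖x‖ ^ (σ + 1) * ψ x = 0 ∧
    (∫ y, ‖y‖ ^ σ * rieszPot ψ y) *
      (-(1 / 2) * ((-1) ^ j * j.factorial) * rGamma ((σ + m) / 2) *
        Real.Gamma (((m : ℝ) - 1) / 2)) =
    (∫ x, (Real.log ‖x‖ * ‖x‖ ^ (σ + 1)) * ψ x) * (Real.pi ^ ((m : ℝ) / 2) * √Real.pi *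
      rGamma (-σ / 2) * rGamma ((σ + m + 1) / 2)) := by
  have hm1 : 1 ≤ m := by omega
  have hm2 : (2 : ℝ) ≤ m := by exact_mod_cast hm
  have hG := ψ.powIntegrable_rieszPot hm1 hψ
  have hψi := ψ.powIntegrable hm1 (N : ℝ)
  have hσ' : σ + 1 ∈ Ioo (-(m : ℝ)) N := ⟨by linarith [hσ.1], by linarith [hσ.2]⟩
  have hj0 : (0 : ℝ) ≤ j := j.cast_nonneg
  -- The sides exchange roles: now a Gamma factor on the left is zero, which forces the integral on
  -- the right to vanish.
  have hrz : rGamma (-(σ + 1) / 2) = 0 := by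
    rw [show -(σ + 1) / 2 = -j by rw [hj]; ring, rGamma_neg_nat]
  have h0 := ψ.rieszPot_functional_equation hm hN hψ hσ
  have hne : Real.pi ^ ((m : ℝ) / 2) * √Real.pi * rGamma (-σ / 2) *
      rGamma ((σ + m + 1) / 2) ≠ 0 := by
    refine mul_ne_zero (mul_ne_zero (by positivity) ?_) (rGamma_pos (by linarith)).ne'
    refine inv_ne_zero ?_
    have := Real_Gamma_half_int_ne_zero (a := 1 - 2 * j) (by rw [Int.odd_iff]; omega)
    push_cast at this
    rwa [show -σ = 1 - 2 * (j : ℝ) by linarith]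
  have hI : ∫ x, ‖x‖ ^ (σ + 1) * ψ x = 0 := by
    rw [hrz] at h0
    simp only [mul_zero, zero_mul] at h0
    exact (mul_eq_zero.1 h0.symm).resolve_right hne
  refine ⟨hI, ?_⟩
  have d1 := hG.hasDerivAt_rpow hm1 hσ
  have d2 : HasDerivAt (fun σ : ℝ => ∫ x, ‖x‖ ^ (σ + 1) * ψ x) _ σ :=
    (hψi.hasDerivAt_rpow hm1 hσ').comp_add_const σ 1
  have d3 : DifferentiableAt ℝ (fun σ : ℝ => rGamma ((σ + m) / 2)) σ := by
    have := differentiable_rGamma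
    fun_prop
  have d4 : DifferentiableAt ℝ (fun σ : ℝ => Real.pi ^ ((m : ℝ) / 2) * √Real.pi *
      rGamma (-σ / 2) * rGamma ((σ + m + 1) / 2)) σ := by
    have := differentiable_rGamma
    fun_prop
  have d5 := (hasDerivAt_rGamma_comp_neg_half j hj).comp_add_const σ 1
  have e1 := d1.mul ((d5.mul d3.hasDerivAt).mul_const (Real.Gamma (((m : ℝ) - 1) / 2)))
  have e2 := d2.mul d4.hasDerivAt
  have hev : (fun σ : ℝ => (∫ y, ‖y‖ ^ σ * rieszPot ψ y) *
      (rGamma (-(σ + 1) / 2) * rGamma ((σ + m) / 2) * Real.Gamma (((m : ℝ) - 1) / 2))) =ᶠ[𝓝 σ]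
      fun σ : ℝ => (∫ x, ‖x‖ ^ (σ + 1) * ψ x) *
      (Real.pi ^ ((m : ℝ) / 2) * √Real.pi * rGamma (-σ / 2) * rGamma ((σ + m + 1) / 2)) := by
    filter_upwards [Ioo_mem_nhds hσ.1 hσ.2] with t ht
    exact ψ.rieszPot_functional_equation hm hN hψ ht
  have := e1.unique (e2.congr_of_eventuallyEq hev)
  simp only [Pi.mul_apply, hI, hrz, zero_mul, mul_zero, add_zero, zero_add] at this
  exact this

theorem PowIntegrable.integral_log {m : ℕ} (hm : 1 ≤ m) {A B : ℝ} {f : Eu m → ℝ}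
    (hf : PowIntegrable A B f) {σ : ℝ} (hσ : σ ∈ Ioo A B) (p q : ℝ) :
    ∫ x, ((p * Real.log ‖x‖ + q) * ‖x‖ ^ σ) * f x =
      p * (∫ x, (Real.log ‖x‖ * ‖x‖ ^ σ) * f x) + q * ∫ x, ‖x‖ ^ σ * f x := by
  rw [← integral_const_mul, ← integral_const_mul,
    ← integral_add ((hf.log_mul hm hσ).const_mul p) ((hf σ hσ).const_mul q)]
  refine integral_congr_ae (Eventually.of_forall fun x => ?_)
  simp only
  ring

/-- The kernels `a_n^+` satisfy `a_0 ∗ a_k = a_{k+1}`, tested on functions with enough vanishing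
moments. -/
theorem SchwartzMap.integral_aRad_mul_rieszPot {m : ℕ} (hm : 2 ≤ m) (ψ : 𝓢(Eu m, ℝ)) {N : ℕ}
    (hN : 1 ≤ N) (hψ : VanishingMoments N ψ) {k : ℕ} (hkN : k + 3 ≤ N + m) :
    aReg m 0 * ∫ y, aRad m k y * rieszPot ψ y = ∫ x, aRad m (k + 1) x * ψ x := by
  have hm1 : 1 ≤ m := by omega
  have hm2 : (2 : ℝ) ≤ m := by exact_mod_cast hm
  have hG := ψ.powIntegrable_rieszPot hm1 hψ
  have hψi := ψ.powIntegrable hm1 (N : ℝ)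
  have hk0 : (0 : ℝ) ≤ k := k.cast_nonneg
  have hkN' : (k : ℝ) + 3 ≤ N + m := by exact_mod_cast hkN
  set σ : ℝ := (k : ℝ) + 1 - m with hσdef
  have hσ : σ ∈ Ioo (-(m : ℝ)) (N - 1) := ⟨by linarith, by linarith⟩
  have hσ' : σ + 1 ∈ Ioo (-(m : ℝ)) N := ⟨by linarith [hσ.1], by linarith [hσ.2]⟩
  unfold aRad
  rw [show ((k + 1 : ℕ) : ℝ) + 1 - m = σ + 1 by rw [hσdef]; push_cast; ring,
    hG.integral_log hm1 hσ, hψi.integral_log hm1 hσ', aReg_zero hm]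
  have hg : 0 < Real.Gamma (((m : ℝ) - 1) / 2) := Real.Gamma_pos_of_pos (by linarith)
  have hs : 0 < √Real.pi := by positivity
  have hp : 0 < Real.pi ^ ((m : ℝ) / 2) := by positivity
  have eK : (σ + m) / 2 = ((k : ℝ) + 1) / 2 := by rw [hσdef]; ring
  have eK' : (σ + m + 1) / 2 = (((k + 1 : ℕ) : ℝ) + 1) / 2 := by rw [hσdef]; push_cast; ring
  have eA : -σ / 2 = ((m : ℝ) - k - 1) / 2 := by rw [hσdef]; ring
  have eA' : -(σ + 1) / 2 = ((m : ℝ) - ((k + 1 : ℕ) : ℝ) - 1) / 2 := by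
    rw [hσdef]; push_cast; ring
  -- Three cases: neither kernel is logarithmic, only `a_{k+1}` is, or only `a_k` is. By parity two
  -- consecutive kernels are never both logarithmic.
  by_cases hc1 : k + 2 < m
  · have h := ψ.rieszPot_functional_equation hm hN hψ hσ
    have hkm : (k : ℝ) + 2 < m := by exact_mod_cast hc1
    rw [aLog_of_not (by omega), aLog_of_not (by omega), aReg_of_not (by omega),
      aReg_of_not (by omega), ← eK, ← eK', ← eA, ← eA', zero_mul, zero_mul, zero_add, zero_add]
    have g1 := Real.Gamma_pos_of_pos (show (0 : ℝ) < -σ / 2 by linarith)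
    have g2 := Real.Gamma_pos_of_pos (show (0 : ℝ) < -(σ + 1) / 2 by linarith)
    unfold rGamma at h ⊢
    generalize Real.Gamma (-σ / 2) = a1 at *
    generalize Real.Gamma (-(σ + 1) / 2) = a2 at *
    generalize Real.Gamma (((m : ℝ) - 1) / 2) = a3 at *
    generalize (Real.Gamma ((σ + m) / 2))⁻¹ = a4 at *
    generalize (Real.Gamma ((σ + m + 1) / 2))⁻¹ = a5 at *
    generalize (∫ y, ‖y‖ ^ σ * rieszPot ψ y) = I1 at *
    generalize (∫ x, ‖x‖ ^ (σ + 1) * ψ x) = I2 at *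
    field_simp at h ⊢
    rw [pow_succ (-1 : ℝ) (k + 1), pow_succ (2 : ℝ) (k + 1)]
    linear_combination (-1) ^ k * 2 ^ k * 4 * h
  rw [not_lt] at hc1
  by_cases hev : Even (k + 2 - m)
  · obtain ⟨j, hj⟩ := hev
    have hkj : k + 2 = m + 2 * j := by omega
    have hkj' : (k : ℝ) + 2 = m + 2 * j := by exact_mod_cast hkj
    -- Here `σ + 1 = 2j` and `|x|^(σ+1)` integrates to zero against `ψ`. The constant `q_{2j}` in
    -- `a_{k+1}` therefore drops out, and the differentiated equation accounts for the logarithmic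
    -- part.
    obtain ⟨hz, h⟩ := ψ.rieszPot_equation_odd hm hN hψ hσ (j := j) (by rw [hσdef]; linarith)
    have hodd : ¬ (m ≤ k + 1 ∧ Even (k + 1 - m)) := by
      rintro ⟨h1, i, hi⟩
      omega
    have hG1 : Real.Gamma (-σ / 2) ≠ 0 := by
      have := Real_Gamma_half_int_ne_zero (a := 1 - 2 * j) (by rw [Int.odd_iff]; omega)
      push_cast at this
      rwa [show -σ = 1 - 2 * (j : ℝ) by rw [hσdef]; linarith]
    rw [hz, aLog_of_not hodd, aReg_of_not hodd, ← eK, ← eA, zero_mul, zero_add, mul_zero, add_zero,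
      aLog, if_pos ⟨by omega, j, by omega⟩, show k + 1 + 1 - m = 2 * j by omega, pq_even_fst,
      gammaFactor, ← eK']
    have hpi := Real.pi_pos
    have ep : Real.pi ^ ((σ + m + 1) / 2) = Real.pi ^ ((m : ℝ) / 2) * Real.pi ^ j := by
      rw [← Real.rpow_natCast Real.pi j, ← Real.rpow_add hpi]
      congr 1
      rw [hσdef]
      linarith
    have ep2 : Real.pi ^ m = Real.pi ^ ((m : ℝ) / 2) * Real.pi ^ ((m : ℝ) / 2) := by
      rw [← Real.rpow_add hpi, ← Real.rpow_natCast]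
      congr 1
      ring
    have e1 : (-1 : ℝ) ^ (k + 1) = -(-1) ^ m := by
      have : (-1 : ℝ) ^ (k + 2) = (-1) ^ m := by rw [hkj, pow_add, pow_mul]; simp
      rw [pow_succ] at this
      linarith
    have e2 : (2 : ℝ) ^ (k + 1) = 2 ^ (m - 1) * 4 ^ j := by
      rw [show k + 1 = m - 1 + 2 * j by omega, pow_add, pow_mul]
      norm_num
    have e3 : (-1 : ℝ) ^ j * (-1) ^ j = 1 := by
      rw [← pow_add, ← two_mul, pow_mul]; simp
    rw [ep, ep2, e1, e2, mul_pow]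
    unfold rGamma at h ⊢
    have hf : (0 : ℝ) < j.factorial := by positivity
    generalize Real.Gamma (-σ / 2) = a1 at *
    generalize Real.Gamma (((m : ℝ) - 1) / 2) = a3 at *
    generalize (Real.Gamma ((σ + m) / 2))⁻¹ = a4 at *
    generalize (Real.Gamma ((σ + m + 1) / 2))⁻¹ = a5 at *
    generalize (∫ y, ‖y‖ ^ σ * rieszPot ψ y) = I1 at *
    generalize (∫ x, (Real.log ‖x‖ * ‖x‖ ^ (σ + 1)) * ψ x) = I2 at *
    generalize Real.pi ^ ((m : ℝ) / 2) = P at *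
    generalize (j.factorial : ℝ) = F at *
    generalize hJ : (-1 : ℝ) ^ j = J at *
    have hJ0 : J ≠ 0 := fun h0 => by simp [h0] at e3
    have hX : I1 * a4 * a3 = -2 * I2 * P * √Real.pi * a5 * J / (a1 * F) := by
      rw [eq_div_iff (by positivity)]
      have h' : (I1 * a4 * a3) * (J * F) * a1 = -2 * I2 * P * √Real.pi * a5 := by
        field_simp at h
        linear_combination -h
      linear_combination J * h' - (I1 * a4 * a3) * F * a1 * e3
    calc _ = (1 / 2) * (P⁻¹ * P⁻¹) * (√Real.pi)⁻¹ * ((-1) ^ m / (2 ^ (m - 1) * 4 ^ j)) * a1 *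
          (I1 * a4 * a3) := by ring
      _ = _ := by
          rw [hX]
          field_simp
  · have hkj : ∃ j, k + 1 = m + 2 * j := by
      obtain ⟨i, hi⟩ := Nat.not_even_iff_odd.1 hev
      exact ⟨i, by omega⟩
    obtain ⟨j, hkj⟩ := hkj
    have hkj' : (k : ℝ) + 1 = m + 2 * j := by exact_mod_cast hkj
    -- Here `σ = 2j`, and it is the non-logarithmic part of `a_k` that integrates to zero against
    -- the Riesz potential.
    obtain ⟨hz, h⟩ := ψ.rieszPot_equation_even hm hN hψ hσ (j := j) (by rw [hσdef]; linarith)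
    have hodd : ¬ (m ≤ k + 1 + 1 ∧ Even (k + 1 + 1 - m)) := by
      rintro ⟨h1, i, hi⟩
      omega
    have hG1 : Real.Gamma (-(σ + 1) / 2) ≠ 0 := by
      have := Real_Gamma_half_int_ne_zero (a := -(2 * j + 1)) (by rw [Int.odd_iff]; omega)
      push_cast at this
      rwa [show σ = 2 * (j : ℝ) by rw [hσdef]; linarith]
    rw [hz, aLog_of_not hodd, aReg_of_not hodd, ← eK', ← eA', zero_mul, zero_add, mul_zero,
      add_zero, aLog, if_pos ⟨by omega, j, by omega⟩, show k + 1 - m = 2 * j by omega,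
      pq_even_fst, gammaFactor, ← eK]
    have hpi := Real.pi_pos
    have ep : Real.pi ^ ((σ + m) / 2) = Real.pi ^ ((m : ℝ) / 2) * Real.pi ^ j := by
      rw [← Real.rpow_natCast Real.pi j, ← Real.rpow_add hpi]
      congr 1
      rw [hσdef]
      linarith
    have ep2 : Real.pi ^ m = Real.pi ^ ((m : ℝ) / 2) * Real.pi ^ ((m : ℝ) / 2) := by
      rw [← Real.rpow_add hpi, ← Real.rpow_natCast]
      congr 1
      ring
    have e1 : (-1 : ℝ) ^ (k + 1 + 1) = -(-1) ^ m := by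
      rw [pow_succ, hkj, pow_add, pow_mul]; simp
    have e2 : (2 : ℝ) ^ (k + 1 + 1) = 2 ^ (m - 1) * 4 * 4 ^ j := by
      rw [show k + 1 + 1 = m - 1 + 2 + 2 * j by omega, pow_add, pow_mul, pow_add]
      norm_num
    have e3 : (-1 : ℝ) ^ j * (-1) ^ j = 1 := by
      rw [← pow_add, ← two_mul, pow_mul]; simp
    rw [ep, ep2, e1, e2, mul_pow]
    unfold rGamma at h ⊢
    have hf : (0 : ℝ) < j.factorial := by positivity
    generalize Real.Gamma (-(σ + 1) / 2) = a2 at *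
    generalize Real.Gamma (((m : ℝ) - 1) / 2) = a3 at *
    generalize (Real.Gamma ((σ + m) / 2))⁻¹ = a4 at *
    generalize (Real.Gamma ((σ + m + 1) / 2))⁻¹ = a5 at *
    generalize (∫ y, (Real.log ‖y‖ * ‖y‖ ^ σ) * rieszPot ψ y) = I1 at *
    generalize (∫ x, ‖x‖ ^ (σ + 1) * ψ x) = I2 at *
    generalize Real.pi ^ ((m : ℝ) / 2) = P at *
    generalize (j.factorial : ℝ) = F at *
    generalize hJ : (-1 : ℝ) ^ j = J at *
    have hX : I1 * a4 * a3 = -(1 / 2) * I2 * P * √Real.pi * a5 * a2 * J * F := by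
      field_simp at h
      linear_combination h / 2
    calc _ = (1 / 2) * (P⁻¹ * P⁻¹) * (√Real.pi)⁻¹ * ((-1) ^ m / (2 ^ (m - 1) * 4 ^ j)) * J / F *
          (Real.pi ^ j / Real.pi ^ j) * (P / P) * (I1 * a4 * a3) := by ring
      _ = (J * J) * (-(1 / 4) * P⁻¹ * ((-1) ^ m / (2 ^ (m - 1) * 4 ^ j)) * a2 * a5 * I2) := by
          rw [hX]
          field_simp
          ring
      _ = _ := by
          rw [e3]
          field_simp

/-! ### Derivatives of the radial functions -/

theorem hasLineDerivAt_norm {m : ℕ} {x : Eu m} (hx : x ≠ 0) (v : Eu m) :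
    HasLineDerivAt ℝ (fun x : Eu m => ‖x‖) (inner ℝ x v / ‖x‖) x v := by
  have hr : 0 < ‖x‖ := norm_pos_iff.2 hx
  have h1 := (Real.hasDerivAt_sqrt (x := ‖x‖ ^ 2) (by positivity)).comp_hasLineDerivAt
    (g := fun x : Eu m => ‖x‖ ^ 2) (hasLineDerivAt_norm_sq x v)
  simp only [Real.sqrt_sq (norm_nonneg _)] at h1
  convert h1 using 1
  field_simp

theorem hasLineDerivAt_log_rpow {m : ℕ} {x : Eu m} (hx : x ≠ 0) (v : Eu m) (p q lam : ℝ) :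
    HasLineDerivAt ℝ (fun x : Eu m => (p * Real.log ‖x‖ + q) * ‖x‖ ^ lam)
      ((p + lam * (p * Real.log ‖x‖ + q)) * ‖x‖ ^ (lam - 2) * inner ℝ x v) x v := by
  have hr : 0 < ‖x‖ := norm_pos_iff.2 hx
  have h1 := (((Real.hasDerivAt_log hr.ne').const_mul p).add_const q).mul
    (Real.hasDerivAt_rpow_const (x := ‖x‖) (p := lam) (Or.inl hr.ne'))
  have h2 := h1.comp_hasLineDerivAt (g := fun x : Eu m => ‖x‖) (hasLineDerivAt_norm hx v)
  refine (HasDerivAt.congr_deriv h2 ?_)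
  rw [show lam - 1 = lam - 2 + 1 by ring, Real.rpow_add_one hr.ne',
    show lam = lam - 2 + 1 + 1 by ring, Real.rpow_add_one hr.ne', Real.rpow_add_one hr.ne',
    show lam - 2 + 1 + 1 - 2 = lam - 2 by ring]
  field_simp

theorem hasLineDerivAt_inner {m : ℕ} (x w v : Eu m) :
    HasLineDerivAt ℝ (fun x : Eu m => inner ℝ x w) (inner ℝ v w) x v := by
  have h1 := ((hasDerivAt_id (0 : ℝ)).mul_const (inner ℝ v w)).const_add (inner ℝ x w)
  simp only [one_mul] at h1
  refine h1.congr_of_eventuallyEq (Eventually.of_forall fun t => ?_)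
  simp [inner_add_left, inner_smul_left]

/-- Away from the origin, `b_n^+ = -∇ a_{n+1}^+`. -/
theorem hasLineDerivAt_aRad {m : ℕ} (hm : 2 ≤ m) (n : ℕ) {x : Eu m} (hx : x ≠ 0) (v : Eu m) :
    HasLineDerivAt ℝ (aRad m (n + 1)) (-(bRad m n x * inner ℝ x v)) x v := by
  refine (HasDerivAt.congr_deriv (hasLineDerivAt_log_rpow hx v _ _ _) ?_)
  rw [bRad, bLog_eq, bReg_eq hm, show ((n + 1 : ℕ) : ℝ) + 1 - m - 2 = n - m by push_cast; ring]
  push_cast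
  ring

theorem hasLineDerivAt_bRad_mul_inner {m : ℕ} (n : ℕ) {x : Eu m} (hx : x ≠ 0) (v w : Eu m) :
    HasLineDerivAt ℝ (fun x => bRad m n x * inner ℝ x w)
      ((bLog m n + ((n : ℝ) - m) * (bLog m n * Real.log ‖x‖ + bReg m n)) *
        ‖x‖ ^ ((n : ℝ) - m - 2) * inner ℝ x v * inner ℝ x w + bRad m n x * inner ℝ v w) x v :=
  (hasLineDerivAt_log_rpow hx v _ _ _).fun_mul (hasLineDerivAt_inner x w v)

/-! ### Integration by parts against the radial functions -/

theorem PowIntegrable.integrable_mul_inner {m : ℕ} (hm : 1 ≤ m) {A B : ℝ} {f : Eu m → ℝ}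
    (hf : PowIntegrable A B f) {σ : ℝ} (hσ : σ + 1 ∈ Ioo A B) (p q : ℝ) (v : Eu m) :
    Integrable fun x => ((p * Real.log ‖x‖ + q) * ‖x‖ ^ σ * inner ℝ x v) * f x := by
  have hmeas := hf.aestronglyMeasurable hm (hσ.1.trans hσ.2)
  refine ((hf.logpow_mul hm hσ p q).norm.const_mul ‖v‖).mono'
    ((Measurable.aestronglyMeasurable (by fun_prop)).mul hmeas) ?_
  filter_upwards [ae_ne_zero hm] with x hx
  have hr : 0 < ‖x‖ := norm_pos_iff.2 hx
  have h1 : |inner ℝ x v| ≤ ‖x‖ * ‖v‖ := abs_real_inner_le_norm x v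
  rw [Real.rpow_add_one hr.ne']
  simp only [norm_mul, Real.norm_eq_abs, abs_norm]
  calc |p * Real.log ‖x‖ + q| * |‖x‖ ^ σ| * |inner ℝ x v| * |f x|
      ≤ |p * Real.log ‖x‖ + q| * |‖x‖ ^ σ| * (‖x‖ * ‖v‖) * |f x| := by gcongr
    _ = _ := by ring

theorem PowIntegrable.integrable_mul_inner_inner {m : ℕ} (hm : 1 ≤ m) {A B : ℝ} {f : Eu m → ℝ}
    (hf : PowIntegrable A B f) {σ : ℝ} (hσ : σ + 2 ∈ Ioo A B) (p q : ℝ) (v w : Eu m) :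
    Integrable fun x => ((p * Real.log ‖x‖ + q) * ‖x‖ ^ σ * inner ℝ x v * inner ℝ x w) * f x := by
  have hmeas := hf.aestronglyMeasurable hm (hσ.1.trans hσ.2)
  have hσ' : σ + 1 + 1 ∈ Ioo A B := by rwa [show σ + 1 + 1 = σ + 2 by ring]
  refine ((hf.integrable_mul_inner hm hσ' p q v).norm.const_mul ‖w‖).mono'
    ((Measurable.aestronglyMeasurable (by fun_prop)).mul hmeas) ?_
  filter_upwards [ae_ne_zero hm] with x hx
  have hr : 0 < ‖x‖ := norm_pos_iff.2 hx
  have h1 : |inner ℝ x w| ≤ ‖x‖ * ‖w‖ := abs_real_inner_le_norm x w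
  rw [Real.rpow_add_one hr.ne']
  simp only [norm_mul, Real.norm_eq_abs, abs_norm]
  calc |p * Real.log ‖x‖ + q| * |‖x‖ ^ σ| * |inner ℝ x v| * |inner ℝ x w| * |f x|
      ≤ |p * Real.log ‖x‖ + q| * |‖x‖ ^ σ| * |inner ℝ x v| * (‖x‖ * ‖w‖) * |f x| := by gcongr
    _ = _ := by ring

theorem integrable_aRad_mul {m : ℕ} (hm : 1 ≤ m) {A B : ℝ} {f : Eu m → ℝ}
    (hf : PowIntegrable A B f) {n : ℕ} (hn : (n : ℝ) + 1 - m ∈ Ioo A B) :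
    Integrable fun x => aRad m n x * f x :=
  hf.logpow_mul hm hn _ _

theorem integrable_bRad_inner_mul {m : ℕ} (hm : 1 ≤ m) {A B : ℝ} {f : Eu m → ℝ}
    (hf : PowIntegrable A B f) {n : ℕ} (hn : (n : ℝ) + 1 - m ∈ Ioo A B) (v : Eu m) :
    Integrable fun x => (bRad m n x * inner ℝ x v) * f x :=
  hf.integrable_mul_inner hm (by rwa [show (n : ℝ) - m + 1 = n + 1 - m by ring]) _ _ v

/-- Integration by parts against `a_{n+1}^+`. -/
theorem integral_aRad_mul_lineDeriv {m : ℕ} (hm : 2 ≤ m) {A B : ℝ} {f f' : Eu m → ℝ} {v : Eu m}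
    (hff' : ∀ x, HasLineDerivAt ℝ f (f' x) x v) (hf : PowIntegrable A B f) {n : ℕ}
    (hn : (n : ℝ) + 1 - m ∈ Ioo A B) (hf' : Integrable fun x => aRad m (n + 1) x * f' x) :
    ∫ x, aRad m (n + 1) x * f' x = ∫ x, (bRad m n x * inner ℝ x v) * f x := by
  have hm1 : 1 ≤ m := by omega
  have i1 := (integrable_bRad_inner_mul hm1 hf hn v).neg
  have hz := integral_lineDeriv_eq_zero hm1 (W := fun x => aRad m (n + 1) x * f x)
    (W' := fun x => -((bRad m n x * inner ℝ x v) * f x) + aRad m (n + 1) x * f' x) (v := v)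
    (fun x hx => ?_) (i1.add hf') ?_
  · have := integral_add i1 hf'
    simp only [Pi.neg_apply] at this
    rw [this, integral_neg] at hz
    linarith
  · have := (hasLineDerivAt_aRad hm n hx v).fun_mul (hff' x)
    rwa [neg_mul] at this
  · refine (hf.logpow_mul hm1 hn (aLog m (n + 1)) (aReg m (n + 1))).congr ?_
    filter_upwards [ae_ne_zero hm1] with x hx
    have hr : 0 < ‖x‖ := norm_pos_iff.2 hx
    rw [aRad, show ((n + 1 : ℕ) : ℝ) + 1 - m = (n + 1 - m) + 1 by push_cast; ring,
      Real.rpow_add_one hr.ne']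
    field_simp

/-- `Σ_i ∂_i (b_{n+1}^+)_i = a_n^+`, tested on a Schwartz function. -/
theorem SchwartzMap.sum_integral_bRad_mul_lineDeriv {m : ℕ} (hm : 2 ≤ m) (φ : 𝓢(Eu m, ℝ)) (n : ℕ) :
    ∑ j : Fin m, ∫ x, (bRad m (n + 1) x * x j) *
      (∂_{EuclideanSpace.single j (1 : ℝ)} φ : 𝓢(Eu m, ℝ)) x = -∫ x, aRad m n x * φ x := by
  have hm1 : 1 ≤ m := by omega
  have hm2 : (2 : ℝ) ≤ m := by exact_mod_cast hm
  have hn0 : (0 : ℝ) ≤ n := n.cast_nonneg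
  have hin : ∀ (x : Eu m) (j : Fin m), inner ℝ x (EuclideanSpace.single j (1 : ℝ)) = x j := by
    intro x j
    simp [EuclideanSpace.inner_single_right]
  let B : ℝ := (n : ℝ) + 3
  have hφ := φ.powIntegrable hm1 B
  have hσ1 : (n : ℝ) + 1 - m ∈ Ioo (-(m : ℝ)) B := ⟨by linarith, by simp only [B]; linarith⟩
  have hσ2 : ((n + 1 : ℕ) : ℝ) + 1 - m ∈ Ioo (-(m : ℝ)) B := by
    push_cast
    exact ⟨by linarith, by simp only [B]; linarith⟩
  let D : Fin m → Eu m → ℝ := fun j x =>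
    (bLog m (n + 1) + (((n + 1 : ℕ) : ℝ) - m) * (bLog m (n + 1) * Real.log ‖x‖ + bReg m (n + 1))) *
        ‖x‖ ^ (((n + 1 : ℕ) : ℝ) - m - 2) * x j * x j + bRad m (n + 1) x
  have hDi : ∀ j, Integrable fun x => D j x * φ x := by
    intro j
    have k1 := hφ.integrable_mul_inner_inner hm1 (σ := ((n + 1 : ℕ) : ℝ) - m - 2)
      (by rw [show ((n + 1 : ℕ) : ℝ) - m - 2 + 2 = n + 1 - m by push_cast; ring]; exact hσ1)
      ((((n + 1 : ℕ) : ℝ) - m) * bLog m (n + 1))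
      (bLog m (n + 1) + (((n + 1 : ℕ) : ℝ) - m) * bReg m (n + 1))
      (EuclideanSpace.single j (1 : ℝ)) (EuclideanSpace.single j (1 : ℝ))
    have k2 := hφ.logpow_mul hm1 (σ := ((n + 1 : ℕ) : ℝ) - m)
      (by rw [show ((n + 1 : ℕ) : ℝ) - m = n + 1 - m by push_cast; ring]; exact hσ1)
      (bLog m (n + 1)) (bReg m (n + 1))
    refine (k1.add k2).congr (Eventually.of_forall fun x => ?_)
    simp only [Pi.add_apply, hin, D, bRad]
    ring
  have hibp : ∀ j, ∫ x, (bRad m (n + 1) x * x j) *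
      (∂_{EuclideanSpace.single j (1 : ℝ)} φ : 𝓢(Eu m, ℝ)) x = -∫ x, D j x * φ x := by
    intro j
    have i2 := integrable_bRad_inner_mul hm1
      ((∂_{EuclideanSpace.single j (1 : ℝ)} φ : 𝓢(Eu m, ℝ)).powIntegrable hm1 B) hσ2
      (EuclideanSpace.single j (1 : ℝ))
    simp only [hin] at i2
    have hz := integral_lineDeriv_eq_zero hm1
      (W := fun x => (bRad m (n + 1) x * x j) * φ x)
      (W' := fun x => D j x * φ x + (bRad m (n + 1) x * x j) *
        (∂_{EuclideanSpace.single j (1 : ℝ)} φ : 𝓢(Eu m, ℝ)) x)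
      (v := EuclideanSpace.single j (1 : ℝ)) (fun x hx => ?_) ((hDi j).add i2) ?_
    · rw [integral_add (hDi j) i2] at hz
      linarith
    · have h := (hasLineDerivAt_bRad_mul_inner (n + 1) hx (EuclideanSpace.single j (1 : ℝ))
        (EuclideanSpace.single j (1 : ℝ))).fun_mul (φ.hasLineDerivAt x _)
      simp only [hin] at h
      simpa [D] using h
    · have k2 := hφ.integrable_mul_inner hm1 (σ := ((n + 1 : ℕ) : ℝ) - m - 1)
        (by rw [show ((n + 1 : ℕ) : ℝ) - m - 1 + 1 = n + 1 - m by push_cast; ring]; exact hσ1)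
        (bLog m (n + 1)) (bReg m (n + 1)) (EuclideanSpace.single j (1 : ℝ))
      refine k2.congr ?_
      filter_upwards [ae_ne_zero hm1] with x hx
      have hr : 0 < ‖x‖ := norm_pos_iff.2 hx
      rw [hin, bRad, Real.rpow_sub_one hr.ne']
      field_simp
  simp only [hibp]
  rw [Finset.sum_neg_distrib, ← integral_finsetSum _ fun j _ => hDi j]
  congr 1
  refine integral_congr_ae ?_
  filter_upwards [ae_ne_zero hm1] with x hx
  have hr : 0 < ‖x‖ := norm_pos_iff.2 hx
  rw [← Finset.sum_mul]
  congr 1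
  simp only [D]
  have hsq : ∑ j, x j * x j = ‖x‖ ^ 2 := by
    rw [EuclideanSpace.norm_sq_eq]
    refine Finset.sum_congr rfl fun j _ => ?_
    rw [Real.norm_eq_abs, sq_abs, sq]
  simp only [mul_assoc, Finset.sum_add_distrib, ← Finset.mul_sum, Finset.sum_const, hsq]
  have hpow : ‖x‖ ^ (((n + 1 : ℕ) : ℝ) - m - 2) * ‖x‖ ^ 2 = ‖x‖ ^ ((n : ℝ) + 1 - m) := by
    rw [← Real.rpow_natCast ‖x‖ 2, ← Real.rpow_add hr]
    congr 1
    push_cast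
    ring
  -- The sum of the diagonal derivatives is now `div (f x) = m f + r f'` for the radial factor `f`;
  -- the coefficient recursions identify it with `a_n`.
  rw [hpow, bRad, aRad, aLog_eq, aReg_eq, show ((n + 1 : ℕ) : ℝ) - m = n + 1 - m by push_cast; ring]
  simp only [Finset.card_univ, Fintype.card_fin, nsmul_eq_mul]
  ring

/-! ### The principal value -/

/-- Near the origin the mean value inequality supplies the factor `|z|` that makes the
antisymmetrized principal value integrand integrable; for `|z| ≥ 1` that factor costs nothing. -/
theorem SchwartzMap.exists_abs_sub_le {m : ℕ} (φ : 𝓢(Eu m, ℝ)) (y : Eu m) :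
    ∃ C, ∀ z, |φ (y + z) - φ (y - z)| ≤ C * (‖z‖ * (1 + ‖z‖) ^ (-2 : ℝ)) := by
  obtain ⟨M, hM⟩ : ∃ M, ∀ x, ‖fderiv ℝ φ x‖ ≤ M := by
    refine ⟨SchwartzMap.seminorm ℝ 0 1 φ, fun x => ?_⟩
    have := SchwartzMap.norm_iteratedFDeriv_le_seminorm ℝ φ 1 x
    rwa [norm_iteratedFDeriv_one] at this
  have hM0 : 0 ≤ M := (norm_nonneg _).trans (hM 0)
  obtain ⟨C, hC0, hC⟩ := φ.exists_abs_le_rpow 2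
  refine ⟨M * 8 + 2 * (C * (1 + ‖y‖) ^ (2 : ℝ)), fun z => ?_⟩
  have hw : 0 ≤ (1 + ‖z‖) ^ (-2 : ℝ) := by positivity
  have hK : 0 ≤ C * (1 + ‖y‖) ^ (2 : ℝ) := by positivity
  rcases le_total ‖z‖ 1 with h | h
  · have h1 := (convex_univ (𝕜 := ℝ) (E := Eu m)).norm_image_sub_le_of_norm_fderiv_le (f := φ)
      (fun x _ => (φ.hasFDerivAt x).differentiableAt) (fun x _ => hM x) (mem_univ (y - z))
      (mem_univ (y + z))
    have h2 : ‖y + z - (y - z)‖ ≤ 2 * ‖z‖ := by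
      rw [show y + z - (y - z) = (2 : ℝ) • z by rw [two_smul]; abel, norm_smul]
      simp
    have h3 : 1 ≤ 4 * (1 + ‖z‖) ^ (-2 : ℝ) := by
      rw [Real.rpow_neg (by positivity), ← div_eq_mul_inv, le_div_iff₀ (by positivity)]
      norm_num
      nlinarith [norm_nonneg z]
    calc |φ (y + z) - φ (y - z)| ≤ M * (2 * ‖z‖) := h1.trans (by gcongr)
      _ ≤ M * (2 * ‖z‖) * (4 * (1 + ‖z‖) ^ (-2 : ℝ)) := le_mul_of_one_le_right (by positivity) h3
      _ = M * 8 * (‖z‖ * (1 + ‖z‖) ^ (-2 : ℝ)) := by ring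
      _ ≤ _ := mul_le_mul_of_nonneg_right (by linarith) (by positivity)
  · have k : ∀ z' : Eu m, ‖z'‖ = ‖z‖ →
        |φ (y + z')| ≤ C * (1 + ‖y‖) ^ (2 : ℝ) * (1 + ‖z‖) ^ (-2 : ℝ) := by
      intro z' hz'
      refine (hC _).trans ?_
      rw [mul_assoc, ← hz']
      exact mul_le_mul_of_nonneg_left (one_add_norm_add_rpow_le y z' (by norm_num)) hC0
    have k1 := k z rfl
    have k2 := k (-z) (norm_neg z)
    rw [← sub_eq_add_neg] at k2
    calc |φ (y + z) - φ (y - z)| ≤ |φ (y + z)| + |φ (y - z)| := abs_sub _ _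
      _ ≤ 2 * (C * (1 + ‖y‖) ^ (2 : ℝ)) * (1 * (1 + ‖z‖) ^ (-2 : ℝ)) := by linarith
      _ ≤ 2 * (C * (1 + ‖y‖) ^ (2 : ℝ)) * (‖z‖ * (1 + ‖z‖) ^ (-2 : ℝ)) := by gcongr
      _ ≤ _ := mul_le_mul_of_nonneg_right (by linarith) (by positivity)

/-- The principal value of `z_v |z|^(-m-1)` is the Riesz potential of a derivative. -/
theorem SchwartzMap.tendsto_truncated_integral {m : ℕ} (hm : 2 ≤ m) (φ : 𝓢(Eu m, ℝ))
    (y v : Eu m) :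
    Tendsto (fun ε : ℝ => ∫ z in {z : Eu m | ε < ‖z‖},
        φ (y + z) * (inner ℝ z v * ‖z‖ ^ (-(m : ℝ) - 1)))
      (𝓝[>] 0) (𝓝 (((m : ℝ) - 1)⁻¹ * rieszPot (∂_{v} φ : 𝓢(Eu m, ℝ)) y)) := by
  have hm1 : 1 ≤ m := by omega
  have hm2 : (2 : ℝ) ≤ m := by exact_mod_cast hm
  have hφc := φ.continuous
  obtain ⟨C, hC⟩ := φ.exists_abs_sub_le y
  let K : Eu m → ℝ := fun z => inner ℝ z v * ‖z‖ ^ (-(m : ℝ) - 1)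
  have hKm : Measurable K := by fun_prop
  have hKneg : ∀ z, K (-z) = -K z := by
    intro z
    simp [K, inner_neg_left]
  -- As `K` is odd, the integral of `φ (y + z) K z` over `|z| > ε` is half that of `F`, and `F` is
  -- integrable across the origin. The principal value thus becomes an ordinary integral.
  let F : Eu m → ℝ := fun z => (φ (y + z) - φ (y - z)) * K z
  have hKb : ∀ z ≠ 0, ‖z‖ * |K z| ≤ ‖v‖ * ‖z‖ ^ (1 - m : ℝ) := by
    intro z hz
    have hr : 0 < ‖z‖ := norm_pos_iff.2 hz
    have h1 : |inner ℝ z v| ≤ ‖z‖ * ‖v‖ := abs_real_inner_le_norm z v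
    simp only [K, abs_mul, Real.abs_rpow_of_nonneg hr.le, abs_norm]
    rw [show (1 - m : ℝ) = -m - 1 + 1 + 1 by ring, Real.rpow_add_one hr.ne',
      Real.rpow_add_one hr.ne']
    calc ‖z‖ * (|inner ℝ z v| * ‖z‖ ^ (-(m : ℝ) - 1))
        ≤ ‖z‖ * ((‖z‖ * ‖v‖) * ‖z‖ ^ (-(m : ℝ) - 1)) := by gcongr
      _ = _ := by ring
  have hFm : AEStronglyMeasurable F :=
    (Continuous.aestronglyMeasurable (by fun_prop)).mul hKm.aestronglyMeasurable
  have hw := integrable_rieszKernel_weight hm1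
  have hF : Integrable F := by
    refine (hw.const_mul (C * ‖v‖)).mono' hFm ?_
    filter_upwards [ae_ne_zero hm1] with z hz
    rw [norm_mul, Real.norm_eq_abs, Real.norm_eq_abs]
    have hC' : 0 ≤ C * (‖z‖ * (1 + ‖z‖) ^ (-2 : ℝ)) := (abs_nonneg _).trans (hC z)
    have hC0 : 0 ≤ C := by
      have hr : 0 < ‖z‖ := norm_pos_iff.2 hz
      exact nonneg_of_mul_nonneg_left hC' (by positivity)
    calc |φ (y + z) - φ (y - z)| * |K z|
        ≤ C * (‖z‖ * (1 + ‖z‖) ^ (-2 : ℝ)) * |K z| := by gcongr; exact hC z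
      _ = C * (1 + ‖z‖) ^ (-2 : ℝ) * (‖z‖ * |K z|) := by ring
      _ ≤ C * (1 + ‖z‖) ^ (-2 : ℝ) * (‖v‖ * ‖z‖ ^ (1 - m : ℝ)) :=
          mul_le_mul_of_nonneg_left (hKb z hz) (by positivity)
      _ = _ := by ring
  -- integration by parts
  have hpv : ((m : ℝ) - 1) * ∫ z, F z = 2 * rieszPot (∂_{v} φ : 𝓢(Eu m, ℝ)) y := by
    have hd : ∀ z, HasLineDerivAt ℝ (fun z => φ (y + z) - φ (y - z))
        ((∂_{v} φ : 𝓢(Eu m, ℝ)) (y + z) + (∂_{v} φ : 𝓢(Eu m, ℝ)) (y - z)) z v := by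
      intro z
      have h1 := φ.hasLineDerivAt (y + z) v
      have h2 := φ.hasLineDerivAt (y - z) v
      have h3 := HasDerivAt.comp_of_eq (0 : ℝ) h2 (hasDerivAt_neg 0) (by simp)
      have h4 := HasDerivAt.sub h1 h3
      refine (h4.congr_deriv (by ring)).congr_of_eventuallyEq (Eventually.of_forall fun t => ?_)
      simp only [Pi.sub_apply, Function.comp_apply, neg_smul, ← add_assoc]
      congr 2
      abel
    have i1 := (∂_{v} φ : 𝓢(Eu m, ℝ)).integrable_rieszKernel hm1 y
    have i2 : Integrable fun z => ‖z‖ ^ (1 - m : ℝ) * (∂_{v} φ : 𝓢(Eu m, ℝ)) (y - z) := by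
      have := i1.comp_neg
      simpa [sub_eq_add_neg] using this
    have e2 : ∫ z, ‖z‖ ^ (1 - m : ℝ) * (∂_{v} φ : 𝓢(Eu m, ℝ)) (y - z) =
        rieszPot (∂_{v} φ : 𝓢(Eu m, ℝ)) y := by
      rw [rieszPot, ← integral_neg_eq_self]
      refine integral_congr_ae (Eventually.of_forall fun z => ?_)
      simp
    have i3 := hF.const_mul (1 - m : ℝ)
    have i12 := i1.add i2
    simp only [Pi.add_def] at i12
    -- The point is that `∂_v |z|^(1-m) = (1 - m) K z`. The difference of values of `φ` supplies a
    -- factor `|z|`, so `|z|⁻¹ W` is still integrable.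
    have hz := integral_lineDeriv_eq_zero hm1 (v := v)
      (W := fun z => (φ (y + z) - φ (y - z)) * ‖z‖ ^ (1 - m : ℝ))
      (W' := fun z => (‖z‖ ^ (1 - m : ℝ) * (∂_{v} φ : 𝓢(Eu m, ℝ)) (y + z) +
        ‖z‖ ^ (1 - m : ℝ) * (∂_{v} φ : 𝓢(Eu m, ℝ)) (y - z)) + (1 - m) * F z)
      (fun z hz0 => ?_) (i12.add i3) ?_
    · rw [integral_add i12 i3, integral_add i1 i2, integral_const_mul, e2] at hz
      have : rieszPot (∂_{v} φ : 𝓢(Eu m, ℝ)) y =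
        ∫ z, ‖z‖ ^ (1 - m : ℝ) * (∂_{v} φ : 𝓢(Eu m, ℝ)) (y + z) := rfl
      rw [← this] at hz
      linarith
    · have h1 := hasLineDerivAt_log_rpow hz0 v 0 1 (1 - m : ℝ)
      simp only [zero_mul, zero_add, one_mul, mul_one] at h1
      refine HasDerivAt.congr_deriv ((hd z).fun_mul h1) ?_
      simp only [F, K]
      rw [show (1 - m : ℝ) - 2 = -m - 1 by ring]
      ring
    · refine (hw.const_mul C).mono' ?_ ?_
      · exact (Measurable.aestronglyMeasurable (by fun_prop)).mul
          ((Continuous.aestronglyMeasurable (by fun_prop)).mul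
            (Measurable.aestronglyMeasurable (by fun_prop)))
      · filter_upwards [ae_ne_zero hm1] with z hz0
        have hr : 0 < ‖z‖ := norm_pos_iff.2 hz0
        rw [norm_mul, norm_mul, norm_inv, norm_norm, Real.norm_eq_abs,
          Real.norm_of_nonneg (by positivity)]
        calc ‖z‖⁻¹ * (|φ (y + z) - φ (y - z)| * ‖z‖ ^ (1 - m : ℝ))
            ≤ ‖z‖⁻¹ * (C * (‖z‖ * (1 + ‖z‖) ^ (-2 : ℝ)) * ‖z‖ ^ (1 - m : ℝ)) := by
              gcongr; exact hC z
          _ = _ := by field_simp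
  have hS : ∀ ε : ℝ, MeasurableSet {z : Eu m | ε < ‖z‖} := fun ε =>
    measurableSet_lt measurable_const measurable_norm
  have hlim : Tendsto (fun ε : ℝ => ∫ z in {z : Eu m | ε < ‖z‖}, F z) (𝓝[>] 0) (𝓝 (∫ z, F z)) := by
    simp only [← integral_indicator (hS _)]
    refine tendsto_integral_filter_of_dominated_convergence (fun z => ‖F z‖)
      (Eventually.of_forall fun ε => hFm.indicator (hS ε))
      (Eventually.of_forall fun ε => Eventually.of_forall fun z => norm_indicator_le_norm_self _ _)
      hF.norm ?_
    filter_upwards [ae_ne_zero hm1] with z hz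
    refine tendsto_const_nhds.congr' ?_
    filter_upwards [mem_nhdsWithin_of_mem_nhds (gt_mem_nhds (norm_pos_iff.2 hz))] with ε hε
    rw [indicator_of_mem (show z ∈ {z : Eu m | ε < ‖z‖} from hε)]
  have heq : ∀ ε : ℝ, 0 < ε → ∫ z in {z : Eu m | ε < ‖z‖}, φ (y + z) * K z =
      (1 / 2) * ∫ z in {z : Eu m | ε < ‖z‖}, F z := by
    intro ε hε
    have hφi : Integrable fun z => φ (y + z) := φ.integrable.comp_add_left y
    have hφi' : Integrable fun z => φ (y - z) := φ.integrable.comp_sub_left y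
    have hKε : ∀ z ∈ {z : Eu m | ε < ‖z‖}, ‖K z‖ ≤ ‖v‖ * ε ^ (-m : ℝ) := by
      intro z hz
      have hz : ε < ‖z‖ := hz
      have hr : 0 < ‖z‖ := hε.trans hz
      have h1 := hKb z (norm_pos_iff.1 hr)
      rw [show (1 - m : ℝ) = -m + 1 by ring, Real.rpow_add_one hr.ne'] at h1
      have h2 : ‖z‖ ^ (-m : ℝ) ≤ ε ^ (-m : ℝ) :=
        Real.rpow_le_rpow_of_nonpos hε hz.le (by linarith)
      have h3 : |K z| ≤ ‖v‖ * ‖z‖ ^ (-m : ℝ) := by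
        refine le_of_mul_le_mul_left ?_ hr
        linarith
      exact h3.trans (by gcongr)
    have j1 : IntegrableOn (fun z => φ (y + z) * K z) {z : Eu m | ε < ‖z‖} :=
      hφi.integrableOn.mul_bdd hKm.aestronglyMeasurable
        ((ae_restrict_iff' (hS ε)).2 (Eventually.of_forall hKε))
    have j2 : IntegrableOn (fun z => φ (y - z) * K z) {z : Eu m | ε < ‖z‖} :=
      hφi'.integrableOn.mul_bdd hKm.aestronglyMeasurable
        ((ae_restrict_iff' (hS ε)).2 (Eventually.of_forall hKε))
    have hrefl : ∫ z in {z : Eu m | ε < ‖z‖}, φ (y - z) * K z =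
        -∫ z in {z : Eu m | ε < ‖z‖}, φ (y + z) * K z := by
      rw [← integral_indicator (hS ε), ← integral_indicator (hS ε), ← integral_neg_eq_self,
        ← integral_neg]
      refine integral_congr_ae (Eventually.of_forall fun z => ?_)
      simp only
      by_cases hz : ε < ‖z‖
      · rw [indicator_of_mem (show -z ∈ {z : Eu m | ε < ‖z‖} by simpa using hz),
          indicator_of_mem (show z ∈ {z : Eu m | ε < ‖z‖} from hz), hKneg]
        simp
      · rw [indicator_of_notMem (show -z ∉ {z : Eu m | ε < ‖z‖} by simpa using hz),
          indicator_of_notMem (show z ∉ {z : Eu m | ε < ‖z‖} from hz), neg_zero]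
    have : ∫ z in {z : Eu m | ε < ‖z‖}, F z = (∫ z in {z : Eu m | ε < ‖z‖}, φ (y + z) * K z) -
        ∫ z in {z : Eu m | ε < ‖z‖}, φ (y - z) * K z := by
      rw [← integral_sub j1 j2]
      refine integral_congr_ae (Eventually.of_forall fun z => ?_)
      simp only [F]
      ring
    rw [this, hrefl]
    ring
  have hfin : ((m : ℝ) - 1)⁻¹ * rieszPot (∂_{v} φ : 𝓢(Eu m, ℝ)) y = (1 / 2) * ∫ z, F z := by
    have : (m : ℝ) - 1 ≠ 0 := by linarith
    field_simp
    linarith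
  rw [hfin]
  refine (hlim.const_mul (1 / 2)).congr' ?_
  filter_upwards [self_mem_nhdsWithin] with ε hε
  exact (heq ε hε).symm

/-- Matches the normalizations in `H = -∂a_0`; the factor `(m - 1)⁻¹` compensates for the derivative
of `|x|^(1-m)`. -/
theorem aReg_zero_eq {m : ℕ} (hm : 2 ≤ m) :
    aReg m 0 = -(2 / sphereArea (m + 1)) * ((m : ℝ) - 1)⁻¹ := by
  have hm2 : (2 : ℝ) ≤ m := by exact_mod_cast hm
  have hne : ((m : ℝ) - 1) / 2 ≠ 0 := by
    have : 0 < ((m : ℝ) - 1) / 2 := by linarith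
    exact this.ne'
  have hne' : (m : ℝ) - 1 ≠ 0 := by linarith
  have hg := Real.Gamma_pos_of_pos (show 0 < ((m : ℝ) - 1) / 2 by linarith)
  rw [aReg_zero hm, sphereArea]
  push_cast
  rw [show ((m : ℝ) + 1) / 2 = (m - 1) / 2 + 1 by ring, Real.Gamma_add_one hne,
    show ((m : ℝ) - 1) / 2 + 1 = m / 2 + 1 / 2 by ring, Real.rpow_add Real.pi_pos,
    ← Real.sqrt_eq_rpow]
  have : 0 < √Real.pi := by positivity
  field_simp

/-- Since `H = -∂a_0` as a distribution, the derivative moves onto `φ`, leaving Riesz potentials of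
its partial derivatives. -/
theorem SchwartzMap.hilbertPV_eq {m : ℕ} (hm : 2 ≤ m) (φ : 𝓢(Eu m, ℝ)) (y : Eu m) :
    hilbertPV (fun z => φ (y + z)) = ∑ j : Fin m,
      (aReg m 0 * rieszPot (∂_{EuclideanSpace.single j (1 : ℝ)} φ : 𝓢(Eu m, ℝ)) y) •
        gen m j.succ := by
  have hm1 : 1 ≤ m := by omega
  have hm2 : (2 : ℝ) ≤ m := by exact_mod_cast hm
  refine Tendsto.limUnder_eq ?_
  have hS : ∀ ε : ℝ, MeasurableSet {z : Eu m | ε < ‖z‖} := fun ε =>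
    measurableSet_lt measurable_const measurable_norm
  have ht := tendsto_finsetSum (Finset.univ : Finset (Fin m)) fun j _ =>
    ((φ.tendsto_truncated_integral hm y (EuclideanSpace.single j (1 : ℝ))).const_mul
      (-(2 / sphereArea (m + 1)))).smul_const (gen m j.succ)
  simp only [← mul_assoc (-(2 / sphereArea (m + 1))), ← aReg_zero_eq hm] at ht
  refine ht.congr' ?_
  filter_upwards [self_mem_nhdsWithin] with ε hε
  have hε : 0 < ε := hε
  have hi : ∀ j : Fin m, Integrable (fun z => (-(2 / sphereArea (m + 1)) * (φ (y + z) *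
      (inner ℝ z (EuclideanSpace.single j (1 : ℝ)) * ‖z‖ ^ (-(m : ℝ) - 1)))) • gen m j.succ)
      (volume.restrict {z : Eu m | ε < ‖z‖}) := by
    intro j
    refine Integrable.smul_const (Integrable.const_mul ?_ _) _
    refine (φ.integrable.comp_add_left y).integrableOn.mul_bdd (c := ε ^ (-m : ℝ))
      (Measurable.aestronglyMeasurable (by fun_prop))
      ((ae_restrict_iff' (hS ε)).2 (Eventually.of_forall fun z hz => ?_))
    have hz : ε < ‖z‖ := hz
    have hr : 0 < ‖z‖ := hε.trans hz
    have h1 : |inner ℝ z (EuclideanSpace.single j (1 : ℝ))| ≤ ‖z‖ := by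
      refine (abs_real_inner_le_norm _ _).trans ?_
      simp
    rw [norm_mul, Real.norm_eq_abs, Real.norm_of_nonneg (by positivity), Real.rpow_sub_one hr.ne']
    calc |inner ℝ z (EuclideanSpace.single j (1 : ℝ))| * (‖z‖ ^ (-m : ℝ) / ‖z‖)
        ≤ ‖z‖ * (‖z‖ ^ (-m : ℝ) / ‖z‖) := by gcongr
      _ = ‖z‖ ^ (-m : ℝ) := by field_simp
      _ ≤ _ := Real.rpow_le_rpow_of_nonpos hε hz.le (by linarith)
  calc _ = ∑ j : Fin m, ∫ z in {z : Eu m | ε < ‖z‖}, (-(2 / sphereArea (m + 1)) * (φ (y + z) *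
      (inner ℝ z (EuclideanSpace.single j (1 : ℝ)) * ‖z‖ ^ (-(m : ℝ) - 1)))) • gen m j.succ := by
        refine Finset.sum_congr rfl fun j _ => ?_
        rw [integral_smul_const, integral_const_mul]
    _ = _ := by
        rw [← integral_finsetSum _ fun j _ => hi j]
        refine setIntegral_congr_fun (hS ε) fun z hz => ?_
        have hr : 0 < ‖z‖ := hε.trans hz
        simp only [hilbertDensity, vec, LinearMap.coe_mk, AddHom.coe_mk, Finset.smul_sum,
          smul_smul]
        refine Finset.sum_congr rfl fun j _ => ?_
        congr 1
        rw [Real.rpow_sub_one hr.ne', Real.rpow_neg hr.le, Real.rpow_natCast]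
        simp only [EuclideanSpace.inner_single_right]
        simp
        ring

/-! ### Scalar form of the Hilbert transforms -/

theorem inner_single_one {m : ℕ} (x : Eu m) (j : Fin m) :
    inner ℝ x (EuclideanSpace.single j (1 : ℝ)) = x j := by
  simp [EuclideanSpace.inner_single_right]

/-- Annihilation in degree `-1` is an empty condition, but one derivative raises it to degree `0`;
so every partial derivative has at least one vanishing moment. -/
theorem AnnihilatesPoly.max_neg_one {m : ℕ} {d : ℤ} {φ : 𝓢(Eu m, ℝ)} (h : AnnihilatesPoly d φ) :
    AnnihilatesPoly (max d (-1)) φ := by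
  rcases le_total d (-1) with hd | hd
  · rw [max_eq_right hd]
    exact annihilatesPoly_of_neg (by norm_num) φ
  · rwa [max_eq_left hd]

theorem SchwartzMap.integrable_aRad_mul_rieszPot {m : ℕ} (hm : 1 ≤ m) (ψ : 𝓢(Eu m, ℝ)) {N : ℕ}
    (hψ : VanishingMoments N ψ) {k : ℕ} (hkN : k + 3 ≤ N + m) :
    Integrable fun y => aRad m k y * rieszPot ψ y := by
  have hk0 : (0 : ℝ) ≤ k := k.cast_nonneg
  have hkN' : (k : ℝ) + 3 ≤ N + m := by exact_mod_cast hkN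
  exact integrable_aRad_mul hm (ψ.powIntegrable_rieszPot hm hψ) ⟨by linarith, by linarith⟩

/-- The semigroup property gives `a_{k+1}` tested on `∂_j φ`, and `b_k = -∇a_{k+1}` finishes. The
derivative annihilates degree `k + 2 - m`, one more than `φ`, which makes the integral against `a_k`
converge. -/
theorem AnnihilatesPoly.integral_aRad_mul_rieszPot {m : ℕ} (hm : 2 ≤ m) {k : ℕ} {φ : 𝓢(Eu m, ℝ)}
    (h : AnnihilatesPoly ((k : ℤ) + 1 - m) φ) (j : Fin m) :
    Integrable (fun y => aRad m k y *
      rieszPot (∂_{EuclideanSpace.single j (1 : ℝ)} φ : 𝓢(Eu m, ℝ)) y) ∧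
    aReg m 0 * ∫ y, aRad m k y *
      rieszPot (∂_{EuclideanSpace.single j (1 : ℝ)} φ : 𝓢(Eu m, ℝ)) y =
      ∫ x, (bRad m k x * x j) * φ x := by
  have hm1 : 1 ≤ m := by omega
  have hk0 : (0 : ℝ) ≤ k := k.cast_nonneg
  -- Truncated subtraction: for `k + 3 ≤ m` it gives `0`, and the maximum keeps the one moment that
  -- every derivative has.
  have hV : VanishingMoments (max (k + 3 - m) 1)
      (∂_{EuclideanSpace.single j (1 : ℝ)} φ : 𝓢(Eu m, ℝ)) :=
    (h.max_neg_one.lineDeriv hm j).vanishingMoments (by omega)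
  refine ⟨SchwartzMap.integrable_aRad_mul_rieszPot hm1 _ hV (by omega), ?_⟩
  rw [SchwartzMap.integral_aRad_mul_rieszPot hm _ (le_max_right _ _) hV (by omega),
    integral_aRad_mul_lineDeriv hm (fun x => φ.hasLineDerivAt x _)
      (φ.powIntegrable hm1 (k + 2)) ⟨by linarith, by linarith⟩ ?_]
  · simp only [inner_single_one]
  · exact integrable_aRad_mul hm1 (SchwartzMap.powIntegrable hm1 _ (k + 3))
      ⟨by push_cast; linarith, by push_cast; linarith⟩

/-- As `b_k = -∇a_{k+1}`, one may pass to `a_{k+1}` against the potential of a second derivative;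
the extra vanishing moment pays for the larger kernel. The semigroup property yields `a_{k+2}`, and
moving one derivative back yields `b_{k+1}`. -/
theorem AnnihilatesPoly.integral_bRad_mul_rieszPot {m : ℕ} (hm : 2 ≤ m) {k : ℕ} {φ : 𝓢(Eu m, ℝ)}
    (h : AnnihilatesPoly ((k : ℤ) + 1 - m) φ) (i j : Fin m) :
    Integrable (fun y => (bRad m k y * y j) *
      rieszPot (∂_{EuclideanSpace.single i (1 : ℝ)} φ : 𝓢(Eu m, ℝ)) y) ∧
    aReg m 0 * ∫ y, (bRad m k y * y j) *
      rieszPot (∂_{EuclideanSpace.single i (1 : ℝ)} φ : 𝓢(Eu m, ℝ)) y =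
      ∫ x, (bRad m (k + 1) x * x j) * (∂_{EuclideanSpace.single i (1 : ℝ)} φ : 𝓢(Eu m, ℝ)) x := by
  have hm1 : 1 ≤ m := by omega
  have hk0 : (0 : ℝ) ≤ k := k.cast_nonneg
  obtain ⟨N, hN⟩ : ∃ N, N = max (k + 3 - m) 1 := ⟨_, rfl⟩
  have hi := h.max_neg_one.lineDeriv hm i
  have hV := hi.vanishingMoments (N := N) (by omega)
  have hV' := (hi.lineDeriv hm j).vanishingMoments (N := N + 1) (by omega)
  have hkN : (k : ℝ) + 3 ≤ N + m := by exact_mod_cast (show k + 3 ≤ N + m by omega)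
  have hG := SchwartzMap.powIntegrable_rieszPot hm1 _ hV
  have hσ : (k : ℝ) + 1 - m ∈ Ioo (-(m : ℝ)) (N - 1) := ⟨by linarith, by linarith⟩
  have hI := integrable_bRad_inner_mul hm1 hG hσ (EuclideanSpace.single j (1 : ℝ))
  have hG' := SchwartzMap.integrable_aRad_mul_rieszPot hm1 _ hV' (k := k + 1) (by omega)
  have hibp := integral_aRad_mul_lineDeriv hm (fun y => SchwartzMap.hasLineDerivAt_rieszPot hm1
    (∂_{EuclideanSpace.single i (1 : ℝ)} φ : 𝓢(Eu m, ℝ)) y (EuclideanSpace.single j (1 : ℝ)))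
    hG hσ hG'
  simp only [inner_single_one] at hI hibp
  refine ⟨hI, ?_⟩
  rw [← hibp, SchwartzMap.integral_aRad_mul_rieszPot hm _ (by omega) hV' (by omega),
    integral_aRad_mul_lineDeriv hm (fun x => SchwartzMap.hasLineDerivAt _ x _)
      (SchwartzMap.powIntegrable hm1 _ (k + 3)) ⟨by push_cast; linarith, by push_cast; linarith⟩ ?_]
  · simp only [inner_single_one]
  · exact integrable_aRad_mul hm1 (SchwartzMap.powIntegrable hm1 _ (k + 4))
      ⟨by push_cast; linarith, by push_cast; linarith⟩

/-! ### The Dirac operator -/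

theorem SchwartzMap.lineDerivOp_comm {m : ℕ} (φ : 𝓢(Eu m, ℝ)) (v w : Eu m) :
    (∂_{v} (∂_{w} φ : 𝓢(Eu m, ℝ)) : 𝓢(Eu m, ℝ)) = ∂_{w} (∂_{v} φ : 𝓢(Eu m, ℝ)) := by
  ext x
  have key : ∀ v w : Eu m, (∂_{v} (∂_{w} φ : 𝓢(Eu m, ℝ)) : 𝓢(Eu m, ℝ)) x =
      fderiv ℝ (fderiv ℝ φ) x v w := by
    intro v w
    have hd : DifferentiableAt ℝ (fderiv ℝ φ) x :=
      ((φ.smooth 2).fderiv_right (m := 1) (by norm_num)).differentiable (by norm_num) x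
    rw [SchwartzMap.lineDerivOp_apply_eq_fderiv]
    have : ((∂_{w} φ : 𝓢(Eu m, ℝ)) : Eu m → ℝ) = fun y => fderiv ℝ φ y w :=
      funext fun y => SchwartzMap.lineDerivOp_apply_eq_fderiv ..
    rw [this, fderiv_clm_apply hd (differentiableAt_const w)]
    simp
  rw [key, key]
  exact ((φ.smooth 2).contDiffAt.isSymmSndFDerivAt (by simp)).eq v w

/-- Off the diagonal, symmetric coefficients cancel against anticommuting generators; adding the sum
to its transpose shows this. It is the algebra behind `∂² = -Δ`. -/
theorem sum_smul_gen_mul_gen {m : ℕ} {S : Fin m → Fin m → ℝ} (hS : ∀ i j, S i j = S j i) :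
    ∑ i, ∑ j, S i j • (gen m i.succ * gen m j.succ) = (-∑ i, S i i) • (1 : Cl m) := by
  have h1 : ∑ i, ∑ j, S i j • (gen m i.succ * gen m j.succ) =
      ∑ i, ∑ j, S i j • (gen m j.succ * gen m i.succ) := by
    rw [Finset.sum_comm]
    simp only [fun i j => hS j i]
  have h2 : (2 : ℝ) • ∑ i, ∑ j, S i j • (gen m i.succ * gen m j.succ) =
      (2 : ℝ) • ((-∑ i, S i i) • (1 : Cl m)) := by
    rw [two_smul]
    nth_rewrite 2 [h1]
    simp only [← Finset.sum_add_distrib, ← smul_add, gen_mul_gen_add, Fin.succ_inj, smul_ite,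
      smul_zero, Finset.sum_ite_eq, Finset.mem_univ, if_true]
    rw [neg_smul, smul_neg, Finset.sum_smul, Finset.smul_sum, ← Finset.sum_neg_distrib]
    refine Finset.sum_congr rfl fun i _ => ?_
    rw [smul_comm, two_smul, one_add_one_eq_two, smul_neg]
  exact smul_right_injective _ two_ne_zero h2

theorem regDist_aPlus {m : ℕ} (hm : 2 ≤ m) (n : ℕ) (φ : 𝓢(Eu m, ℝ)) :
    regDist (aPlus m n) φ = (∫ x, aRad m n x * φ x) • (1 : Cl m) := by
  rw [regDist_apply (isTempered_aPlus (by omega) n), ← integral_smul_const]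
  simp only [aPlus_eq, Algebra.algebraMap_eq_smul_one, smul_smul, mul_comm]

theorem regDist_bPlus {m : ℕ} (hm : 2 ≤ m) (n : ℕ) (φ : 𝓢(Eu m, ℝ)) :
    regDist (bPlus m n) φ = ∑ j : Fin m, (∫ x, (bRad m n x * x j) * φ x) • gen m j.succ := by
  have hm1 : 1 ≤ m := by omega
  have hn0 : (0 : ℝ) ≤ n := n.cast_nonneg
  rw [regDist_apply (isTempered_bPlus hm1 n)]
  simp only [← integral_smul_const]
  rw [← integral_finsetSum]
  · refine integral_congr_ae (Eventually.of_forall fun x => ?_)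
    simp only [bPlus_eq, vec, LinearMap.coe_mk, AddHom.coe_mk, Finset.smul_sum, smul_smul]
    refine Finset.sum_congr rfl fun j _ => ?_
    congr 1
    ring
  · intro j _
    have h := integrable_bRad_inner_mul hm1 (φ.powIntegrable hm1 (n + 2)) (n := n)
      ⟨by linarith, by linarith⟩ (EuclideanSpace.single j (1 : ℝ))
    simp only [inner_single_one] at h
    exact h.smul_const _

theorem neg_dirac_apply {m : ℕ} (T : CDist m) (φ : 𝓢(Eu m, ℝ)) :
    (-dirac T) φ = ∑ j : Fin m, gen m j.succ * T (∂_{EuclideanSpace.single j (1 : ℝ)} φ) := by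
  simp [dirac]

theorem neg_dirac_regDist_aPlus {m : ℕ} (hm : 2 ≤ m) (n : ℕ) :
    -dirac (regDist (aPlus m (n + 1))) = regDist (bPlus m n) := by
  have hm1 : 1 ≤ m := by omega
  have hn0 : (0 : ℝ) ≤ n := n.cast_nonneg
  ext φ
  rw [neg_dirac_apply, regDist_bPlus hm]
  refine Finset.sum_congr rfl fun j _ => ?_
  rw [regDist_aPlus hm, integral_aRad_mul_lineDeriv hm (fun x => φ.hasLineDerivAt x _)
      (φ.powIntegrable hm1 (n + 2)) ⟨by linarith, by linarith⟩ ?_]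
  · simp only [inner_single_one, mul_smul_comm, mul_one]
  · exact integrable_aRad_mul hm1 (SchwartzMap.powIntegrable hm1 _ (n + 3))
      ⟨by push_cast; linarith, by push_cast; linarith⟩

/-- Because `b_{n+1}` is a gradient and second derivatives of `φ` commute, the matrix of integrals
is symmetric. Only its trace survives, which is the divergence. Both `-∂b_{n+1} = a_n` and `H ∗ b_n
= a_n` are read off from this double sum. -/
theorem SchwartzMap.sum_integral_bRad_mul_lineDeriv_smul {m : ℕ} (hm : 2 ≤ m) (n : ℕ)
    (φ : 𝓢(Eu m, ℝ)) :
    ∑ i : Fin m, ∑ j : Fin m, (∫ x, (bRad m (n + 1) x * x j) *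
      (∂_{EuclideanSpace.single i (1 : ℝ)} φ : 𝓢(Eu m, ℝ)) x) • (gen m i.succ * gen m j.succ) =
      regDist (aPlus m n) φ := by
  have hm1 : 1 ≤ m := by omega
  have hn0 : (0 : ℝ) ≤ n := n.cast_nonneg
  have key : ∀ i j : Fin m, ∫ x, (bRad m (n + 1) x * x j) *
      (∂_{EuclideanSpace.single i (1 : ℝ)} φ : 𝓢(Eu m, ℝ)) x = ∫ x, aRad m (n + 2) x *
      (∂_{EuclideanSpace.single j (1 : ℝ)} (∂_{EuclideanSpace.single i (1 : ℝ)} φ : 𝓢(Eu m, ℝ)) :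
        𝓢(Eu m, ℝ)) x := by
    intro i j
    rw [integral_aRad_mul_lineDeriv hm (fun x => SchwartzMap.hasLineDerivAt _ x _)
      (SchwartzMap.powIntegrable hm1 _ (n + 3)) ⟨by push_cast; linarith, by push_cast; linarith⟩ ?_]
    · simp only [inner_single_one]
    · exact integrable_aRad_mul hm1 (SchwartzMap.powIntegrable hm1 _ (n + 4))
        ⟨by push_cast; linarith, by push_cast; linarith⟩
  rw [sum_smul_gen_mul_gen fun i j => ?_, φ.sum_integral_bRad_mul_lineDeriv hm, neg_neg,
    regDist_aPlus hm]
  rw [key, key, SchwartzMap.lineDerivOp_comm]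

theorem neg_dirac_regDist_bPlus {m : ℕ} (hm : 2 ≤ m) (n : ℕ) :
    -dirac (regDist (bPlus m (n + 1))) = regDist (aPlus m n) := by
  ext φ
  rw [neg_dirac_apply, ← φ.sum_integral_bRad_mul_lineDeriv_smul hm]
  simp only [regDist_bPlus hm, Finset.mul_sum, mul_smul_comm]

/-! ### The Hilbert transform -/

theorem tendsto_hilbertTrunc {m : ℕ} {u : Eu m → Cl m} {φ : 𝓢(Eu m, ℝ)}
    (h : Integrable fun y => hilbertPV (fun z => φ (y + z)) * u y) :
    Tendsto (hilbertTrunc u φ) atTop (𝓝 (∫ y, hilbertPV (fun z => φ (y + z)) * u y)) :=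
  (aecover_ball tendsto_id).integral_tendsto_of_countably_generated h

theorem hilbertPV_mul_aPlus {m : ℕ} (hm : 2 ≤ m) (φ : 𝓢(Eu m, ℝ)) (k : ℕ) (y : Eu m) :
    hilbertPV (fun z => φ (y + z)) * aPlus m k y = ∑ j : Fin m, (aReg m 0 * (aRad m k y *
      rieszPot (∂_{EuclideanSpace.single j (1 : ℝ)} φ : 𝓢(Eu m, ℝ)) y)) • gen m j.succ := by
  rw [φ.hilbertPV_eq hm, Finset.sum_mul]
  refine Finset.sum_congr rfl fun j _ => ?_
  rw [aPlus_eq, Algebra.algebraMap_eq_smul_one, mul_smul_comm, mul_one, smul_smul]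
  congr 1
  ring

theorem hilbertPV_mul_bPlus {m : ℕ} (hm : 2 ≤ m) (φ : 𝓢(Eu m, ℝ)) (k : ℕ) (y : Eu m) :
    hilbertPV (fun z => φ (y + z)) * bPlus m k y = ∑ i : Fin m, ∑ j : Fin m,
      (aReg m 0 * ((bRad m k y * y j) *
        rieszPot (∂_{EuclideanSpace.single i (1 : ℝ)} φ : 𝓢(Eu m, ℝ)) y)) •
          (gen m i.succ * gen m j.succ) := by
  rw [φ.hilbertPV_eq hm, Finset.sum_mul]
  refine Finset.sum_congr rfl fun i _ => ?_
  simp only [bPlus_eq, vec, LinearMap.coe_mk, AddHom.coe_mk, Finset.smul_sum, Finset.mul_sum]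
  refine Finset.sum_congr rfl fun j _ => ?_
  rw [smul_smul, smul_mul_smul_comm]
  congr 1
  ring

theorem isHilbertTransformMod_aPlus {m : ℕ} (hm : 2 ≤ m) (k : ℕ) :
    IsHilbertTransformMod ((k : ℤ) + 1 - m) (aPlus m k) (regDist (bPlus m k)) := by
  intro φ hφ
  have hi : ∀ j ∈ (Finset.univ : Finset (Fin m)), Integrable fun y => (aReg m 0 * (aRad m k y *
      rieszPot (∂_{EuclideanSpace.single j (1 : ℝ)} φ : 𝓢(Eu m, ℝ)) y)) • gen m j.succ :=
    fun j _ => ((hφ.integral_aRad_mul_rieszPot hm j).1.const_mul _).smul_const _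
  have hint := integrable_finsetSum _ hi
  have := tendsto_hilbertTrunc (u := aPlus m k) (φ := φ)
    (by simpa only [hilbertPV_mul_aPlus hm] using hint)
  simp only [hilbertPV_mul_aPlus hm] at this
  rw [integral_finsetSum _ hi] at this
  simp only [integral_smul_const, integral_const_mul] at this
  convert this using 2
  rw [regDist_bPlus hm]
  refine Finset.sum_congr rfl fun j _ => ?_
  rw [(hφ.integral_aRad_mul_rieszPot hm j).2]

theorem isHilbertTransformMod_bPlus {m : ℕ} (hm : 2 ≤ m) (k : ℕ) :
    IsHilbertTransformMod ((k : ℤ) + 1 - m) (bPlus m k) (regDist (aPlus m k)) := by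
  intro φ hφ
  have hi' : ∀ i j : Fin m, Integrable fun y => (aReg m 0 * ((bRad m k y * y j) *
        rieszPot (∂_{EuclideanSpace.single i (1 : ℝ)} φ : 𝓢(Eu m, ℝ)) y)) •
          (gen m i.succ * gen m j.succ) :=
    fun i j => ((hφ.integral_bRad_mul_rieszPot hm i j).1.const_mul _).smul_const _
  have hi : ∀ i ∈ (Finset.univ : Finset (Fin m)), Integrable fun y => ∑ j : Fin m,
      (aReg m 0 * ((bRad m k y * y j) *
        rieszPot (∂_{EuclideanSpace.single i (1 : ℝ)} φ : 𝓢(Eu m, ℝ)) y)) •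
          (gen m i.succ * gen m j.succ) :=
    fun i _ => integrable_finsetSum _ fun j _ => hi' i j
  have := tendsto_hilbertTrunc (u := bPlus m k) (φ := φ)
    (by simpa only [hilbertPV_mul_bPlus hm] using integrable_finsetSum _ hi)
  simp only [hilbertPV_mul_bPlus hm] at this
  rw [integral_finsetSum _ hi] at this
  convert this using 2
  rw [← φ.sum_integral_bRad_mul_lineDeriv_smul hm]
  refine Finset.sum_congr rfl fun i _ => ?_
  rw [integral_finsetSum _ fun j _ => hi' i j]
  refine Finset.sum_congr rfl fun j _ => ?_
  rw [integral_smul_const, integral_const_mul, (hφ.integral_bRad_mul_rieszPot hm i j).2]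

/-! ### The critical case of the Hilbert transform of `a_{m-1}` -/

/-- Inserting a power of `1 + |y|` and its inverse reduces integrability on a ball to
`PowIntegrable`, so `f` needs no decay. In the critical case the integral over the whole space need
not converge absolutely. -/
theorem Continuous.integrableOn_ball_aRad_mul {m : ℕ} {f : Eu m → ℝ} (hf : Continuous f)
    (hm : 1 ≤ m) (k : ℕ) (R : ℝ) :
    IntegrableOn (fun y => aRad m k y * f y) (Metric.ball 0 R) := by
  have hk0 : (0 : ℝ) ≤ k := k.cast_nonneg
  have hc : Continuous fun y : Eu m => (1 + ‖y‖) ^ (-((m : ℝ) + (k + 2))) :=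
    Continuous.rpow_const (by fun_prop) fun y => Or.inl (by positivity)
  have hc' : Continuous fun y : Eu m => (1 + ‖y‖) ^ ((m : ℝ) + (k + 2)) :=
    Continuous.rpow_const (by fun_prop) fun y => Or.inl (by positivity)
  have hP := powIntegrable_of_le hm hc.aestronglyMeasurable (C := 1) (s := (m : ℝ) + (k + 2))
    fun y => by rw [abs_of_nonneg (by positivity), one_mul]
  have hI := integrable_aRad_mul hm hP (n := k) ⟨by linarith, by linarith⟩
  have h := (hI.integrableOn (s := Metric.closedBall 0 R)).mul_continuousOn
    (hc'.mul hf).continuousOn (isCompact_closedBall 0 R)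
  refine (h.mono_set Metric.ball_subset_closedBall).congr (Eventually.of_forall fun y => ?_)
  have hy : (1 + ‖y‖) ^ (-((m : ℝ) + (k + 2))) * (1 + ‖y‖) ^ ((m : ℝ) + (k + 2)) = 1 := by
    rw [← Real.rpow_add (by positivity), neg_add_cancel, Real.rpow_zero]
  calc aRad m k y * (1 + ‖y‖) ^ (-((m : ℝ) + (k + 2))) * ((1 + ‖y‖) ^ ((m : ℝ) + (k + 2)) * f y)
      = aRad m k y * ((1 + ‖y‖) ^ (-((m : ℝ) + (k + 2))) * (1 + ‖y‖) ^ ((m : ℝ) + (k + 2))) *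
          f y := by ring
    _ = aRad m k y * f y := by rw [hy, mul_one]

theorem hilbertTrunc_aPlus {m : ℕ} (hm : 2 ≤ m) (k : ℕ) (φ : 𝓢(Eu m, ℝ)) (R : ℝ) :
    hilbertTrunc (aPlus m k) φ R = ∑ j : Fin m,
      (aReg m 0 * ∫ y in Metric.ball 0 R, aRad m k y *
        rieszPot (∂_{EuclideanSpace.single j (1 : ℝ)} φ : 𝓢(Eu m, ℝ)) y) • gen m j.succ := by
  have hm1 : 1 ≤ m := by omega
  simp only [hilbertTrunc, hilbertPV_mul_aPlus hm]
  rw [integral_finsetSum]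
  · simp only [integral_smul_const, integral_const_mul]
  · intro j _
    exact (((SchwartzMap.continuous_rieszPot hm1 _).integrableOn_ball_aRad_mul hm1 k R).const_mul _).smul_const _

/-- The reflection `x ↦ φ (-x)` of a Schwartz function. -/
def SchwartzMap.reflect {m : ℕ} (φ : 𝓢(Eu m, ℝ)) : 𝓢(Eu m, ℝ) :=
  SchwartzMap.compCLMOfContinuousLinearEquiv ℝ (ContinuousLinearEquiv.neg ℝ) φ

theorem SchwartzMap.reflect_apply {m : ℕ} (φ : 𝓢(Eu m, ℝ)) (x : Eu m) :
    φ.reflect x = φ (-x) := rfl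

theorem SchwartzMap.lineDeriv_reflect {m : ℕ} (φ : 𝓢(Eu m, ℝ)) (v : Eu m) :
    (∂_{v} φ.reflect : 𝓢(Eu m, ℝ)) = -(∂_{v} φ : 𝓢(Eu m, ℝ)).reflect := by
  rw [reflect, SchwartzMap.lineDerivOp_compCLMOfContinuousLinearEquiv]
  ext x
  simp [reflect]

theorem rieszPot_sub {m : ℕ} (hm : 1 ≤ m) (φ ψ : 𝓢(Eu m, ℝ)) (y : Eu m) :
    rieszPot (φ - ψ : 𝓢(Eu m, ℝ)) y = rieszPot φ y - rieszPot ψ y := by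
  simp only [rieszPot]
  rw [← integral_sub (φ.integrable_rieszKernel hm y) (ψ.integrable_rieszKernel hm y)]
  simp only [sub_apply, mul_sub]

theorem rieszPot_lineDeriv_reflect {m : ℕ} (φ : 𝓢(Eu m, ℝ)) (v y : Eu m) :
    rieszPot (∂_{v} φ.reflect : 𝓢(Eu m, ℝ)) y = -rieszPot (∂_{v} φ : 𝓢(Eu m, ℝ)) (-y) := by
  rw [rieszPot_neg, SchwartzMap.lineDeriv_reflect, rieszPot, rieszPot, ← integral_neg]
  simp only [neg_apply, SchwartzMap.reflect_apply, mul_neg]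

theorem aRad_neg {m : ℕ} (k : ℕ) (y : Eu m) : aRad m k (-y) = aRad m k y := by
  simp only [aRad, norm_neg]

theorem bRad_neg {m : ℕ} (k : ℕ) (y : Eu m) : bRad m k (-y) = bRad m k y := by
  simp only [bRad, norm_neg]

/-- `a_k` is even and `H` is odd, so truncation to a ball centred at the origin gives an odd
functional of `φ`. -/
theorem hilbertTrunc_aPlus_sub_reflect {m : ℕ} (hm : 2 ≤ m) (k : ℕ) (φ : 𝓢(Eu m, ℝ)) (R : ℝ) :
    hilbertTrunc (aPlus m k) (φ - φ.reflect) R = (2 : ℝ) • hilbertTrunc (aPlus m k) φ R := by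
  have hm1 : 1 ≤ m := by omega
  rw [hilbertTrunc_aPlus hm, hilbertTrunc_aPlus hm, Finset.smul_sum]
  refine Finset.sum_congr rfl fun j _ => ?_
  rw [smul_smul]
  congr 1
  have hi : ∀ ψ : 𝓢(Eu m, ℝ), Integrable (fun y => aRad m k y * rieszPot ψ y)
      (volume.restrict (Metric.ball 0 R)) := fun ψ =>
    (ψ.continuous_rieszPot hm1).integrableOn_ball_aRad_mul hm1 k R
  have hrefl : ∫ y in Metric.ball 0 R, aRad m k y *
      rieszPot (∂_{EuclideanSpace.single j (1 : ℝ)} φ.reflect : 𝓢(Eu m, ℝ)) y =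
      -∫ y in Metric.ball 0 R, aRad m k y *
        rieszPot (∂_{EuclideanSpace.single j (1 : ℝ)} φ : 𝓢(Eu m, ℝ)) y := by
    rw [← integral_indicator Metric.isOpen_ball.measurableSet,
      ← integral_indicator Metric.isOpen_ball.measurableSet, ← integral_neg_eq_self, ← integral_neg]
    refine integral_congr_ae (Eventually.of_forall fun y => ?_)
    simp only [indicator, mem_ball_zero_iff, norm_neg]
    split_ifs
    · rw [rieszPot_lineDeriv_reflect, neg_neg, aRad_neg, mul_neg]
    · rw [neg_zero]
  have hsub : (∂_{EuclideanSpace.single j (1 : ℝ)} (φ - φ.reflect) : 𝓢(Eu m, ℝ)) =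
      ∂_{EuclideanSpace.single j (1 : ℝ)} φ - ∂_{EuclideanSpace.single j (1 : ℝ)} φ.reflect :=
    (LineDeriv.lineDerivOpCLM ℝ 𝓢(Eu m, ℝ) (EuclideanSpace.single j (1 : ℝ))).map_sub φ _
  rw [hsub]
  simp only [rieszPot_sub hm1, mul_sub]
  rw [integral_sub (hi _) (hi _), hrefl]
  ring

theorem regDist_bPlus_sub_reflect {m : ℕ} (hm : 2 ≤ m) (k : ℕ) (φ : 𝓢(Eu m, ℝ)) :
    regDist (bPlus m k) (φ - φ.reflect) = (2 : ℝ) • regDist (bPlus m k) φ := by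
  have h : regDist (bPlus m k) φ.reflect = -regDist (bPlus m k) φ := by
    rw [regDist_bPlus hm, regDist_bPlus hm, ← Finset.sum_neg_distrib]
    refine Finset.sum_congr rfl fun j _ => ?_
    rw [← neg_smul, ← integral_neg, ← integral_neg_eq_self]
    congr 2
    ext x
    simp [SchwartzMap.reflect_apply, bRad_neg]
  rw [map_sub, h, sub_neg_eq_add, two_smul]

theorem annihilatesPoly_sub_reflect {m : ℕ} (φ : 𝓢(Eu m, ℝ)) :
    AnnihilatesPoly 0 (φ - φ.reflect) := by
  intro P hP
  rw [MvPolynomial.totalDegree_eq_zero_iff_eq_C.1 (by omega : P.totalDegree = 0)]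
  simp only [MvPolynomial.eval_C, integral_mul_const, sub_apply, SchwartzMap.reflect_apply]
  rw [integral_sub φ.integrable φ.integrable.comp_neg, integral_neg_eq_self (fun x => φ x),
    sub_self, zero_mul]

/-- For `k < m - 1` the condition on `φ` is empty; for `k = m - 1` it is a zero mean. In the latter
case both sides are odd under reflection, so testing on `φ - φ.reflect`, which has zero mean,
doubles both of them. -/
theorem isHilbertTransform_aPlus {m : ℕ} (hm : 2 ≤ m) {k : ℕ} (hk : k < m) :
    IsHilbertTransform (aPlus m k) (regDist (bPlus m k)) := by
  intro φ
  rcases (by omega : k + 1 < m ∨ k + 1 = m) with h | h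
  · exact isHilbertTransformMod_aPlus hm k φ (annihilatesPoly_of_neg (by omega) φ)
  · have hd : (k : ℤ) + 1 - m = 0 := by omega
    have ht := isHilbertTransformMod_aPlus hm k (φ - φ.reflect)
      (by rw [hd]; exact annihilatesPoly_sub_reflect φ)
    simp only [regDist_bPlus_sub_reflect hm,
      funext (hilbertTrunc_aPlus_sub_reflect hm k φ)] at ht
    simpa [smul_smul] using ht.const_smul (2⁻¹ : ℝ)

/-! ### Multiples, and the lower half-space -/

theorem regDist_const_smul {m : ℕ} {u : Eu m → Cl m} (hu : IsTempered u) (c : ℝ) :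
    regDist (fun x => c • u x) = c • regDist u := by
  ext φ
  rw [regDist_apply (hu.const_smul c), smul_apply, regDist_apply hu, ← integral_smul]
  simp only [smul_comm c]

theorem dirac_smul {m : ℕ} (c : ℝ) (T : CDist m) : dirac (c • T) = c • dirac T := by
  ext φ
  simp [dirac, Finset.smul_sum]

theorem hilbertTrunc_const_smul {m : ℕ} (c : ℝ) (u : Eu m → Cl m) (φ : 𝓢(Eu m, ℝ)) (R : ℝ) :
    hilbertTrunc (fun x => c • u x) φ R = c • hilbertTrunc u φ R := by
  simp only [hilbertTrunc, mul_smul_comm, integral_smul]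

theorem IsHilbertTransformMod.const_smul {m : ℕ} {d : ℤ} {u : Eu m → Cl m} {T : CDist m}
    (h : IsHilbertTransformMod d u T) (c : ℝ) :
    IsHilbertTransformMod d (fun x => c • u x) (c • T) := by
  intro φ hφ
  rw [funext (hilbertTrunc_const_smul c u φ)]
  exact (h φ hφ).const_smul c

theorem IsHilbertTransform.const_smul {m : ℕ} {u : Eu m → Cl m} {T : CDist m}
    (h : IsHilbertTransform u T) (c : ℝ) :
    IsHilbertTransform (fun x => c • u x) (c • T) := by
  intro φ
  rw [funext (hilbertTrunc_const_smul c u φ)]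
  exact (h φ).const_smul c

/-- The sign relating `a_n^-` to `a_n^+`. -/
def lowerSign (m n : ℕ) : ℝ := if Even n then 1 else (-1) ^ m

theorem neg_one_pow_mul_self (m : ℕ) : ((-1 : ℝ) ^ m) * (-1) ^ m = 1 := by
  rw [← mul_pow]
  norm_num

theorem aMinus_eq (m n : ℕ) : aMinus m n = fun x => lowerSign m n • aPlus m n x := by
  ext x
  unfold aMinus lowerSign
  split_ifs <;> simp

/-- `b_n^-` carries the sign of `a_{n+1}^-`, in keeping with `b_n = -∂a_{n+1}`. By linearity the
lower half-space then reduces to the upper one. -/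
theorem bMinus_eq (m n : ℕ) : bMinus m n = fun x => lowerSign m (n + 1) • bPlus m n x := by
  ext x
  unfold bMinus lowerSign
  split_ifs with h1 h2 <;> simp_all [Nat.even_add_one]

theorem lowerSign_succ (m n : ℕ) : lowerSign m (n + 1) = (-1) ^ m * lowerSign m n := by
  unfold lowerSign
  split_ifs <;> simp_all [Nat.even_add_one, neg_one_pow_mul_self]

theorem regDist_aMinus {m : ℕ} (hm : 1 ≤ m) (n : ℕ) :
    regDist (aMinus m n) = lowerSign m n • regDist (aPlus m n) := by
  rw [aMinus_eq, regDist_const_smul (isTempered_aPlus hm n)]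

theorem regDist_bMinus {m : ℕ} (hm : 1 ≤ m) (n : ℕ) :
    regDist (bMinus m n) = lowerSign m (n + 1) • regDist (bPlus m n) := by
  rw [bMinus_eq, regDist_const_smul (isTempered_bPlus hm n)]

theorem neg_one_pow_smul_regDist_bMinus {m : ℕ} (hm : 1 ≤ m) (n : ℕ) :
    (-1 : ℝ) ^ m • regDist (bMinus m n) = lowerSign m n • regDist (bPlus m n) := by
  rw [regDist_bMinus hm, smul_smul, lowerSign_succ, ← mul_assoc, neg_one_pow_mul_self, one_mul]

theorem neg_one_pow_smul_regDist_aMinus {m : ℕ} (hm : 1 ≤ m) (n : ℕ) :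
    (-1 : ℝ) ^ m • regDist (aMinus m n) = lowerSign m (n + 1) • regDist (aPlus m n) := by
  rw [regDist_aMinus hm, smul_smul, lowerSign_succ]

end

/-! ### The Dirac and Hilbert relations between the boundary values -/

theorem mainTheorem7 (m : ℕ) (hm : 2 ≤ m) (k : ℕ) (hk : 1 ≤ k) :
    -- the Dirac operator, upper half-space
    (-dirac (regDist (aPlus m k)) = regDist (bPlus m (k - 1)) ∧
      -dirac (regDist (bPlus m k)) = regDist (aPlus m (k - 1))) ∧
    -- the Dirac operator, lower half-space
    (-dirac (regDist (aMinus m k)) = regDist (bMinus m (k - 1)) ∧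
      -dirac (regDist (bMinus m k)) = regDist (aMinus m (k - 1))) ∧
    -- the Hilbert transform, upper half-space
    (IsHilbertTransformMod ((k : ℤ) + 1 - m) (aPlus m k) (regDist (bPlus m k)) ∧
      IsHilbertTransformMod ((k : ℤ) + 1 - m) (bPlus m k) (regDist (aPlus m k))) ∧
    -- the Hilbert transform, lower half-space
    (IsHilbertTransformMod ((k : ℤ) + 1 - m) (aMinus m k) ((-1 : ℝ) ^ m • regDist (bMinus m k)) ∧
      IsHilbertTransformMod ((k : ℤ) + 1 - m) (bMinus m k)
        ((-1 : ℝ) ^ m • regDist (aMinus m k))) ∧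
    -- without any correction by polynomials whenever the convolution integral converges
    (k < m →
      IsHilbertTransform (aPlus m k) (regDist (bPlus m k)) ∧
      IsHilbertTransform (aMinus m k) ((-1 : ℝ) ^ m • regDist (bMinus m k))) ∧
    (k + 1 < m →
      IsHilbertTransform (bPlus m k) (regDist (aPlus m k)) ∧
      IsHilbertTransform (bMinus m k) ((-1 : ℝ) ^ m • regDist (aMinus m k))) := by
  have hm1 : 1 ≤ m := by omega
  obtain ⟨n, rfl⟩ : ∃ n, k = n + 1 := ⟨k - 1, by omega⟩
  -- The factor `(-1)^m` in the lower Hilbert relations is the change of `lowerSign` from one index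
  -- to the next, so each of them is a scalar multiple of an upper one.
  rw [Nat.add_sub_cancel, neg_one_pow_smul_regDist_bMinus hm1, neg_one_pow_smul_regDist_aMinus hm1]
  refine ⟨⟨neg_dirac_regDist_aPlus hm n, neg_dirac_regDist_bPlus hm n⟩, ⟨?_, ?_⟩,
    ⟨isHilbertTransformMod_aPlus hm _, isHilbertTransformMod_bPlus hm _⟩, ⟨?_, ?_⟩,
    fun hk => ⟨isHilbertTransform_aPlus hm hk, ?_⟩, fun hk => ?_⟩
  · rw [regDist_aMinus hm1, regDist_bMinus hm1, dirac_smul, ← smul_neg,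
      neg_dirac_regDist_aPlus hm]
  · rw [regDist_aMinus hm1, regDist_bMinus hm1, dirac_smul, ← smul_neg,
      neg_dirac_regDist_bPlus hm, lowerSign_succ, lowerSign_succ, ← mul_assoc,
      neg_one_pow_mul_self, one_mul]
  · rw [aMinus_eq]
    exact (isHilbertTransformMod_aPlus hm _).const_smul _
  · rw [bMinus_eq]
    exact (isHilbertTransformMod_bPlus hm _).const_smul _
  · rw [aMinus_eq]
    exact (isHilbertTransform_aPlus hm hk).const_smul _
  -- The degree bound is negative here, so every test function is admissible.
  · have h : IsHilbertTransform (bPlus m (n + 1)) (regDist (aPlus m (n + 1))) := fun φ =>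
      isHilbertTransformMod_bPlus hm _ φ (annihilatesPoly_of_neg (by omega) φ)
    rw [bMinus_eq]
    exact ⟨h, h.const_smul _⟩
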